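/- Fix integers $k\ge 1$, $n\ge 0$ and a partition $\lambda$ with at most $\min(k,n)$ rows. Let $V_\lambda$ be an irreducible finite-dimensional holomorphic representation of $GL_n(\mathbb C)$ of highest weight $\lambda$, let $V_\lambda[\nu]$ be its weight spaces, and let $\mu\in\mathbb N^n$ be a weight of $V_\lambda$. Let $\mathbb C[x_{11},\dots,x_{kn}]$ be the algebra of polynomial functions on $k\times n$ matrices, with the commuting actions of $\mathfrak{gl}_k$ ($E_{ab}\mapsto\sum_j x_{aj}\partial_{bj}$) and $\mathfrak{gl}_n$ ($E_{ij}\mapsto\sum_a x_{ai}\partial_{aj}$). Let $M_\lambda$ be its subspace of highest weight vectors of weight $\lambda$ for $\mathfrak{gl}_k$, and for $\nu\in\mathbb N^n$ let $M_\lambda^\nu\subset M_\lambda$ be the subspace of those homogeneous of degree $\nu_j$ in $x_{1j},\dots,x_{kj}$ for every $j$. Let $X_n\subset\mathbb C^n$ be the set of points with distinct coordinates and $B_n=\pi_1(X_n/\mathfrak S_n)$, based at the image of a real point $t$ with $t_1>\dots>t_n$. Let $T_j\in B_n$ ($1\le j\le n-1$) be the class of the half-twist in which $z_j,z_{j+1}$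 rotate by the angle $\pi$ in the positive direction about their midpoint. Let $h\in\mathbb C$ and consider $$\nabla_{KZ}^{2h}=d-2h\sum_{i<j}\frac{dz_i-dz_j}{z_i-z_j}\,\Omega_{ij},\qquad \nabla_\kappa^{h}=d-h\sum_{i<j}\frac{dz_i-dz_j}{z_i-z_j}\,\kappa_{ij},$$ on $X_n$, with fibres $\bigoplus_{\nu\in\mathfrak S_n\mu}M_\lambda^\nu$ and $\bigoplus_{\nu\in\mathfrak S_n\mu}V_\lambda[\nu]$. Here $\Omega_{ij}=\sum_a X_a^{(i)}X^{a\,(j)}$ for bases $X_a,X^a$ of $\mathfrak{sl}_k$ dual with respect to $\operatorname{tr}(XY)$, where $X^{(i)}$ is the action of $X$ on the variables of the $i$-th column, and $\kappa_{ij}=E_{ij}E_{ji}+E_{ji}E_{ij}$. The group $\mathfrak S_n$ acts on the first fibre by permuting the columns of variables. The group $B_n$ acts on the second through a homomorphism $\sigma$ from $B_n$ to the normaliser of the diagonal torus in $SL_n(\mathbb C)$ that lifts the projection $B_n\to\mathfrak S_n$ and satisfies $\sigma(T_j)=\exp(E_{j,j+1})\exp(-E_{j+1,j})\exp(E_{j,j+1})$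 for all $j$; such a $\sigma$ exists. With these actions the connections have well-defined monodromy representations $$\pi_{KZ}^{2h}:B_n\to GL\Big(\bigoplus_{\nu\in\mathfrak S_n\mu}M_\lambda^\nu\Big),\qquad \pi_\kappa^{h}:B_n\to GL\Big(\bigoplus_{\nu\in\mathfrak S_n\mu}V_\lambda[\nu]\Big).$$ If a loop $\gamma$ lifts to a path $\tilde\gamma$ in $X_n$ from $t$ to $w^{-1}t$, then $\pi(\gamma)$ is parallel transport along $\tilde\gamma$ followed by the action of $w$ for KZ, and of $\sigma(\gamma)$ for the Casimir connection. Then there is a $\mathfrak{gl}_n$-equivariant isomorphism $\iota:V_\lambda\to M_\lambda$, independent of $t$, $\sigma$ and $h$, which restricts to an isomorphism of the two fibres. Identify the fibres at the base point $t$ by $G\circ\iota^{-1}$, where $G$ acts on $V_\lambda[\nu]$ as multiplication by $\prod_{i<j}(t_i-t_j)^{h(\nu_i+\nu_j+2\nu_i\nu_j/k)}$. Then, for every $j=1,\dots,n-1$, $$\pi_{KZ}^{2h}(T_j)=\pi_\kappa^{h}(T_j)\cdot e^{-\pi i h(E_{jj}+E_{j+1,j+1}+2E_{jj}E_{j+1,j+1}/k)}\cdot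 e^{i\pi E_{jj}}.$$ More precisely, $G\,\iota^{-1}\,\pi_{KZ}^{2h}(T_j)\,\iota=\pi_\kappa^{h}(T_j)\,e^{-\pi i h(E_{jj}+E_{j+1,j+1}+2E_{jj}E_{j+1,j+1}/k)}\,e^{i\pi E_{jj}}\,G$. -/

import Mathlib

open Topology

noncomputable section

namespace DualPair

/-! ### Configurations of points and the braid group -/

/-- The space `X_n` of ordered configurations of `n` distinct points of `ℂ`. -/
def Conf (n : ℕ) : Type := {z : Fin n → ℂ // Function.Injective z}

instance (n : ℕ) : TopologicalSpace (Conf n) :=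
  inferInstanceAs (TopologicalSpace {z : Fin n → ℂ // Function.Injective z})

/-- The symmetric group acts on `X_n` by `(w • z)_{w i} = z_i`. -/
instance (n : ℕ) : MulAction (Equiv.Perm (Fin n)) (Conf n) where
  smul w z := ⟨fun i => z.1 (w⁻¹ i), z.2.comp (w⁻¹).injective⟩
  one_smul _ := rfl
  mul_smul w w' z := Subtype.ext (funext fun i => by
    change z.1 ((w * w')⁻¹ i) = z.1 (w'⁻¹ (w⁻¹ i))
    rw [mul_inv_rev, Equiv.Perm.mul_apply])

/-- The space `X_n / 𝔖_n` of unordered configurations, with the quotient topology. -/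
abbrev UConf (n : ℕ) : Type := MulAction.orbitRel.Quotient (Equiv.Perm (Fin n)) (Conf n)

/-- The projection `X_n → X_n / 𝔖_n`. -/
def toUConf {n : ℕ} (z : Conf n) : UConf n := Quotient.mk _ z

theorem continuous_toUConf {n : ℕ} : Continuous (toUConf (n := n)) := continuous_quotient_mk'

theorem toUConf_smul {n : ℕ} (w : Equiv.Perm (Fin n)) (z : Conf n) :
    toUConf (w • z) = toUConf z :=
  Quotient.sound (MulAction.orbitRel_apply.2 ⟨w, rfl⟩)

/-- Artin's braid group `B_n = π₁(X_n / 𝔖_n)`, based at the image of `z`. In Mathlib's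
multiplication, `p * q` is the loop `q` followed by the loop `p`. -/
abbrev BraidGroup {n : ℕ} (z : Conf n) : Type := FundamentalGroup (UConf n) (toUConf z)

/-- The element of the braid group represented by the loop whose lift through `z` is `γ`. -/
def braidOf {n : ℕ} {z : Conf n} (w : Equiv.Perm (Fin n)) (γ : Path z (w⁻¹ • z)) :
    BraidGroup z :=
  FundamentalGroup.fromPath (Path.Homotopic.Quotient.mk
    ((γ.map continuous_toUConf).cast rfl (toUConf_smul w⁻¹ z).symm))

/-- A point `t_1 > ⋯ > t_n` of the fundamental chamber, as a configuration. -/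
def basePt {n : ℕ} (t : Fin n → ℝ) (ht : StrictAnti t) : Conf n :=
  ⟨fun i => (t i : ℂ), fun _ _ h => ht.injective (Complex.ofReal_injective h)⟩

/-- The half-twist at time `τ`: the points `t_i`, `t_j` turn by the angle `πτ` in the positive
direction about their midpoint, and the other points do not move. -/
def halfTwistFun {n : ℕ} (t : Fin n → ℝ) (i j : Fin n) (τ : ℝ) (l : Fin n) : ℂ :=
  if l = i then
    ((t i + t j) / 2 : ℝ) + ((t i - t j) / 2 : ℝ) * Complex.exp (Real.pi * τ * Complex.I)
  else if l = j then
    ((t i + t j) / 2 : ℝ) - ((t i - t j) / 2 : ℝ) * Complex.exp (Real.pi * τ * Complex.I)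
  else (t l : ℂ)

theorem halfTwistFun_injective {n : ℕ} (t : Fin n → ℝ) (ht : StrictAnti t) (i j : Fin n)
    (hij : (i : ℕ) + 1 = j) (τ : ℝ) : Function.Injective (halfTwistFun t i j τ) := by
  have hlt : i < j := Fin.lt_def.2 (by omega)
  have hne : j ≠ i := hlt.ne'
  have hd : 0 < (t i - t j) / 2 := by linarith [ht hlt]
  set e : ℂ := Complex.exp (Real.pi * τ * Complex.I) with he
  have hnorm : ‖e‖ = 1 := by
    have : (Real.pi * τ * Complex.I : ℂ) = ((Real.pi * τ : ℝ) : ℂ) * Complex.I := by push_cast; ring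
    rw [he, this, Complex.norm_exp_ofReal_mul_I]
  have hfar : ∀ l, l ≠ i → l ≠ j → (t i - t j) / 2 < |t l - (t i + t j) / 2| := by
    intro l hli hlj
    rcases lt_or_gt_of_ne hli with h | h
    · exact lt_of_lt_of_le (by linarith [ht h]) (le_abs_self _)
    · have : j < l := by
        refine lt_of_le_of_ne (Fin.le_def.2 ?_) hlj.symm
        have := Fin.lt_def.1 h
        omega
      exact lt_of_lt_of_le (by linarith [ht this]) (neg_le_abs _)
  have hcirc : ∀ u : ℂ, ‖u‖ = 1 → ∀ l, l ≠ i → l ≠ j →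
      (((t i + t j) / 2 : ℝ) : ℂ) + ((t i - t j) / 2 : ℝ) * u ≠ (t l : ℂ) := by
    intro u hu l hli hlj h
    have h1 : ((t l - (t i + t j) / 2 : ℝ) : ℂ) = ((t i - t j) / 2 : ℝ) * u := by
      rw [Complex.ofReal_sub, ← h]; ring
    have h2 := congrArg norm h1
    rw [norm_mul, hu, Complex.norm_real, Complex.norm_real, Real.norm_eq_abs, Real.norm_eq_abs,
      abs_of_pos hd, mul_one] at h2
    exact absurd h2 (hfar l hli hlj).ne'
  have hcirc' : ∀ l, l ≠ i → l ≠ j →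
      (((t i + t j) / 2 : ℝ) : ℂ) - ((t i - t j) / 2 : ℝ) * e ≠ (t l : ℂ) := by
    intro l hli hlj h
    refine hcirc (-e) (by rw [norm_neg, hnorm]) l hli hlj ?_
    rw [← h]; ring
  have hpm : (((t i + t j) / 2 : ℝ) : ℂ) + ((t i - t j) / 2 : ℝ) * e ≠
      ((t i + t j) / 2 : ℝ) - ((t i - t j) / 2 : ℝ) * e := by
    intro h
    have h1 : (((t i - t j) / 2 : ℝ) : ℂ) * e = 0 := by linear_combination h / 2
    rcases mul_eq_zero.1 h1 with h2 | h2
    · exact hd.ne' (Complex.ofReal_eq_zero.1 h2)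
    · exact Complex.exp_ne_zero _ h2
  have hi : halfTwistFun t i j τ i = ((t i + t j) / 2 : ℝ) + ((t i - t j) / 2 : ℝ) * e := by
    simp [halfTwistFun, he]
  have hj : halfTwistFun t i j τ j = ((t i + t j) / 2 : ℝ) - ((t i - t j) / 2 : ℝ) * e := by
    simp [halfTwistFun, he, hne]
  have ho : ∀ l, l ≠ i → l ≠ j → halfTwistFun t i j τ l = (t l : ℂ) := by
    intro l h1 h2
    simp [halfTwistFun, h1, h2]
  intro a b hab
  by_cases ai : a = i
  · by_cases bi : b = i
    · rw [ai, bi]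
    by_cases bj : b = j
    · rw [ai, bj, hi, hj] at hab; exact absurd hab hpm
    · rw [ai, hi, ho b bi bj] at hab; exact absurd hab (hcirc e hnorm b bi bj)
  by_cases aj : a = j
  · by_cases bi : b = i
    · rw [aj, bi, hi, hj] at hab; exact absurd hab.symm hpm
    by_cases bj : b = j
    · rw [aj, bj]
    · rw [aj, hj, ho b bi bj] at hab; exact absurd hab (hcirc' b bi bj)
  by_cases bi : b = i
  · rw [bi, hi, ho a ai aj] at hab; exact absurd hab.symm (hcirc e hnorm a ai aj)
  by_cases bj : b = j
  · rw [bj, hj, ho a ai aj] at hab; exact absurd hab.symm (hcirc' a ai aj)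
  rw [ho a ai aj, ho b bi bj] at hab
  exact ht.injective (Complex.ofReal_injective hab)

/-- The half-twist as a path in `X_n`, for adjacent indices `i`, `j = i + 1`. -/
def halfTwist {n : ℕ} (t : Fin n → ℝ) (ht : StrictAnti t) (i j : Fin n) (hij : (i : ℕ) + 1 = j) :
    Path (basePt t ht) ((Equiv.swap i j)⁻¹ • basePt t ht) where
  toFun τ := ⟨halfTwistFun t i j τ, halfTwistFun_injective t ht i j hij τ⟩
  continuous_toFun := by
    refine Continuous.subtype_mk (continuous_pi fun l => ?_) _
    unfold halfTwistFun
    split_ifs <;> fun_prop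
  source' := by
    refine Subtype.ext (funext fun l => ?_)
    change halfTwistFun t i j _ l = (t l : ℂ)
    unfold halfTwistFun
    split_ifs with h1 h2
    · subst h1; simp; ring
    · subst h2; simp; ring
    · rfl
  target' := by
    refine Subtype.ext (funext fun l => ?_)
    change halfTwistFun t i j _ l = ((t (((Equiv.swap i j)⁻¹)⁻¹ l) : ℝ) : ℂ)
    rw [inv_inv]
    unfold halfTwistFun
    split_ifs with h1 h2
    · subst h1; simp; ring
    · subst h2; simp; ring
    · rw [Equiv.swap_apply_of_ne_of_ne h1 h2]

/-- The generator `T_i` of the braid group. -/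
def braidGen {n : ℕ} (t : Fin n → ℝ) (ht : StrictAnti t) (i j : Fin n) (hij : (i : ℕ) + 1 = j) :
    BraidGroup (basePt t ht) :=
  braidOf (Equiv.swap i j) (halfTwist t ht i j hij)

/-! ### Logarithmic connections on `X_n` and parallel transport -/

section Connection

variable {n : ℕ} {W : Type*} [AddCommGroup W] [Module ℂ W]

/-- `f` is, on the set `U`, a horizontal section with values in `F` of the connection
`d - c ∑_{i<j} (dz_i - dz_j) / (z_i - z_j) A_{ij}`.
Differentiability of the vector-valued `f` is tested against all linear functionals. -/
def IsHorizontalOn (A : Fin n → Fin n → Module.End ℂ W) (c : ℂ) (F : Submodule ℂ W)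
    (U : Set (Fin n → ℂ)) (f : (Fin n → ℂ) → W) : Prop :=
  ∀ z ∈ U, f z ∈ F ∧ ∀ φ : Module.Dual ℂ W,
    HasFDerivAt (fun y => φ (f y))
      (∑ i : Fin n, ∑ j ∈ Finset.Ioi i, (c * φ (A i j (f z)) / (z i - z j)) •
        ((ContinuousLinearMap.proj i : (Fin n → ℂ) →L[ℂ] ℂ) - ContinuousLinearMap.proj j)) z

/-- `s` is a parallel section along the path `γ`: locally it is the restriction to `γ` of a
horizontal section defined on an open subset of `X_n`. -/
def IsParallelAlong (A : Fin n → Fin n → Module.End ℂ W) (c : ℂ) (F : Submodule ℂ W)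
    {x y : Conf n} (γ : Path x y) (s : unitInterval → W) : Prop :=
  ∀ τ : unitInterval, ∃ (U : Set (Fin n → ℂ)) (f : (Fin n → ℂ) → W),
    IsOpen U ∧ U ⊆ {z | Function.Injective z} ∧ (γ τ).1 ∈ U ∧ IsHorizontalOn A c F U f ∧
      ∀ᶠ τ' in 𝓝 τ, s τ' = f (γ τ').1

/-- `π` is the monodromy representation on the fibre `F` of the connection induced on `X_n / 𝔖_n`:
if the loop `b` lifts to the path `γ` from `z` to `w⁻¹ z`, then `π b` is parallel transport
along `γ` followed by the identification `θ b w` of the fibre at `w⁻¹ z` with the fibre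
at `z`. -/
def IsMonodromy (A : Fin n → Fin n → Module.End ℂ W) (c : ℂ) (F : Submodule ℂ W) {z : Conf n}
    (θ : BraidGroup z → Equiv.Perm (Fin n) → W → W) (π : BraidGroup z →* (F ≃ₗ[ℂ] F)) : Prop :=
  ∀ (w : Equiv.Perm (Fin n)) (γ : Path z (w⁻¹ • z)) (v : F),
    ∃ s : unitInterval → W, IsParallelAlong A c F γ s ∧ s 0 = v ∧
      (π (braidOf w γ) v : W) = θ (braidOf w γ) w (s 1)

end Connection

/-! ### Polynomials on `k × n` matrices -/

/-- The algebra `ℂ[x_{11}, …, x_{kn}]` of polynomial functions on `k × n` matrices, i.e. the tensor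
product over the columns `j` of the algebras `ℂ[x_{1j}, …, x_{kj}]`. -/
abbrev Poly (k n : ℕ) : Type := MvPolynomial (Fin k × Fin n) ℂ

section Poly

variable {k n : ℕ}

/-- The operator `x_p ∂_q`. -/
def mulDeriv (p q : Fin k × Fin n) : Module.End ℂ (Poly k n) :=
  LinearMap.mulLeft ℂ (MvPolynomial.X p) ∘ₗ (MvPolynomial.pderiv q).toLinearMap

/-- The action of `X ∈ 𝔤𝔩_k` on the `j`-th tensor factor: `E_{ab}` acts as `x_{aj} ∂_{bj}`. -/
def colAct (j : Fin n) (X : Matrix (Fin k) (Fin k) ℂ) : Module.End ℂ (Poly k n) :=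
  ∑ a, ∑ b, X a b • mulDeriv (a, j) (b, j)

/-- The diagonal action of `𝔤𝔩_k`. -/
def glkAct (X : Matrix (Fin k) (Fin k) ℂ) : Module.End ℂ (Poly k n) := ∑ j, colAct j X

/-- The action of `𝔤𝔩_n`: `E_{ij}` acts as `∑_a x_{ai} ∂_{aj}`. -/
def glnAct (Y : Matrix (Fin n) (Fin n) ℂ) : Module.End ℂ (Poly k n) :=
  ∑ i, ∑ j, Y i j • ∑ a, mulDeriv (a, i) (a, j)

/-- The space of highest weight vectors of weight `lam` for the action of `𝔤𝔩_k`. -/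
def singular (k n : ℕ) (lam : ℕ → ℕ) : Submodule ℂ (Poly k n) :=
  (⨅ (a : Fin k) (b : Fin k) (_ : a < b), LinearMap.ker (glkAct (Matrix.single a b 1))) ⊓
    ⨅ a : Fin k, LinearMap.ker (glkAct (Matrix.single a a 1) - (lam a : ℂ) • LinearMap.id)

/-- `S^{ν_1} ⊗ ⋯ ⊗ S^{ν_n}`: the polynomials that are, for each `j`, homogeneous of degree `ν_j` in
the variables of the `j`-th column. -/
def colHomogeneous (k : ℕ) {n : ℕ} (ν : Fin n → ℕ) : Submodule ℂ (Poly k n) :=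
  MvPolynomial.weightedHomogeneousSubmodule ℂ
    (fun p : Fin k × Fin n => (Pi.single p.2 1 : Fin n → ℕ)) ν

/-- The fibre `⨁_{ν ∈ 𝔖_n μ} M_lam^ν`, where `M_lam^ν` is the space of highest weight vectors of
weight `lam` in `S^{ν_1} ⊗ ⋯ ⊗ S^{ν_n}`. -/
def kzFibre (k : ℕ) {n : ℕ} (lam : ℕ → ℕ) (μ : Fin n → ℕ) : Submodule ℂ (Poly k n) :=
  ⨆ w : Equiv.Perm (Fin n), singular k n lam ⊓ colHomogeneous k (μ ∘ w)

/-- `Ω_{ij} = ∑_a X_a^{(i)} X^a^{(j)}`, for bases `X_a`, `X^a` of `𝔰𝔩_k`. -/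
def omega {B : Type*} [Fintype B]
    (X X' : Module.Basis B ℂ (LieAlgebra.SpecialLinear.sl (Fin k) ℂ)) (i j : Fin n) :
    Module.End ℂ (Poly k n) :=
  ∑ a, colAct i (X a : Matrix (Fin k) (Fin k) ℂ) * colAct j (X' a : Matrix (Fin k) (Fin k) ℂ)

/-- `π` is the monodromy representation of the KZ connection with parameter `c`, where `𝔖_n` acts
on the fibre by permuting the tensor factors. -/
def IsKZMonodromy {B : Type*} [Fintype B]
    (X X' : Module.Basis B ℂ (LieAlgebra.SpecialLinear.sl (Fin k) ℂ)) (c : ℂ) (lam : ℕ → ℕ)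
    (μ : Fin n → ℕ) {z : Conf n}
    (π : BraidGroup z →* (kzFibre k lam μ ≃ₗ[ℂ] kzFibre k lam μ)) : Prop :=
  IsMonodromy (omega X X') c (kzFibre k lam μ)
    (fun _ w p => MvPolynomial.rename (fun q : Fin k × Fin n => (q.1, w q.2)) p) π

end Poly

/-! ### Representations of `GL_n(ℂ)` and the Casimir connection -/

/-- The exponential map `𝔤𝔩_n → GL_n(ℂ)`. -/
def expGL {n : ℕ} (X : Matrix (Fin n) (Fin n) ℂ) : GL (Fin n) ℂ := (Matrix.isUnit_exp X).unit

/-- A holomorphic representation of `GL_n(ℂ)` on `V`, with its differential: the action of `𝔤𝔩_n`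
given by the derivatives at `0` of the one-parameter subgroups. -/
structure GLRep (n : ℕ) (V : Type*) [AddCommGroup V] [Module ℂ V] where
  /-- the action of the group -/
  act : Representation ℂ (GL (Fin n) ℂ) V
  /-- the action of the Lie algebra -/
  diff : Matrix (Fin n) (Fin n) ℂ →ₗ[ℂ] Module.End ℂ V
  map_lie : ∀ X Y : Matrix (Fin n) (Fin n) ℂ,
    diff (X * Y - Y * X) = diff X * diff Y - diff Y * diff X
  hasDerivAt : ∀ (X : Matrix (Fin n) (Fin n) ℂ) (v : V) (φ : Module.Dual ℂ V),
    HasDerivAt (fun s : ℂ => φ (act (expGL (s • X)) v)) (φ (diff X v)) 0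

section GLRep

variable {n : ℕ} {V : Type*} [AddCommGroup V] [Module ℂ V]

/-- The representation is irreducible with highest weight `lam`. -/
def GLRep.IsIrreducibleOfHighestWeight (R : GLRep n V) (lam : ℕ → ℕ) : Prop :=
  R.act.IsIrreducible ∧
    ∃ v : V, v ≠ 0 ∧ (∀ i j : Fin n, i < j → R.diff (Matrix.single i j 1) v = 0) ∧
      ∀ i : Fin n, R.diff (Matrix.single i i 1) v = (lam i : ℂ) • v

/-- The weight space `V[ν]`. -/
def GLRep.weightSpace (R : GLRep n V) (ν : Fin n → ℕ) : Submodule ℂ V :=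
  ⨅ i : Fin n, LinearMap.ker (R.diff (Matrix.single i i 1) - (ν i : ℂ) • LinearMap.id)

/-- The fibre `⨁_{ν ∈ 𝔖_n μ} V[ν]`. -/
def GLRep.fibre (R : GLRep n V) (μ : Fin n → ℕ) : Submodule ℂ V :=
  ⨆ w : Equiv.Perm (Fin n), R.weightSpace (μ ∘ w)

theorem GLRep.fibre_le_comap (R : GLRep n V) (μ : Fin n → ℕ) (i : Fin n) :
    R.fibre μ ≤ (R.fibre μ).comap (R.diff (Matrix.single i i 1)) := by
  refine iSup_le fun w v hv => ?_
  have h := (Submodule.mem_iInf _).1 hv i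
  rw [LinearMap.mem_ker, LinearMap.sub_apply, sub_eq_zero] at h
  rw [Submodule.mem_comap, h]
  exact Submodule.smul_mem _ _ (le_iSup (fun w : Equiv.Perm (Fin n) => R.weightSpace (μ ∘ w)) w hv)

/-- The operator `E_{ii}` on the fibre `⨁_{ν ∈ 𝔖_n μ} V[ν]`. -/
def GLRep.cartan (R : GLRep n V) (μ : Fin n → ℕ) (i : Fin n) : Module.End ℂ (R.fibre μ) :=
  (R.diff (Matrix.single i i 1)).restrict (R.fibre_le_comap μ i)

/-- The truncated Casimir operator `κ_{ij} = E_{ij} E_{ji} + E_{ji} E_{ij}`. -/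
def GLRep.kappa (R : GLRep n V) (i j : Fin n) : Module.End ℂ V :=
  R.diff (Matrix.single i j 1) * R.diff (Matrix.single j i 1) +
    R.diff (Matrix.single j i 1) * R.diff (Matrix.single i j 1)

/-- `σ` is the homomorphism from `B_n` to the normaliser of the torus in `SL_n(ℂ)` which lifts the
projection of `B_n` to the Weyl group `𝔖_n` and maps each generator `T_i` to
`exp(E_{i,i+1}) exp(-E_{i+1,i}) exp(E_{i,i+1})`. -/
def IsTitsHom {n : ℕ} (t : Fin n → ℝ) (ht : StrictAnti t)
    (σ : BraidGroup (basePt t ht) →* Matrix.SpecialLinearGroup (Fin n) ℂ) : Prop :=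
  (∀ (w : Equiv.Perm (Fin n)) (γ : Path (basePt t ht) (w⁻¹ • basePt t ht)) (a b : Fin n),
      a ≠ w b → (σ (braidOf w γ) : Matrix (Fin n) (Fin n) ℂ) a b = 0) ∧
    ∀ (i j : Fin n) (hij : (i : ℕ) + 1 = j),
      (σ (braidGen t ht i j hij) : Matrix (Fin n) (Fin n) ℂ) =
        NormedSpace.exp (Matrix.single i j (1 : ℂ)) *
          NormedSpace.exp (-Matrix.single j i (1 : ℂ)) *
            NormedSpace.exp (Matrix.single i j (1 : ℂ))

/-- `π` is the monodromy representation of the Casimir connection with parameter `h`, where `B_n`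
acts on the fibre through `σ`. -/
def IsCasimirMonodromy (R : GLRep n V) (h : ℂ) (μ : Fin n → ℕ) {z : Conf n}
    (σ : BraidGroup z →* Matrix.SpecialLinearGroup (Fin n) ℂ)
    (π : BraidGroup z →* (R.fibre μ ≃ₗ[ℂ] R.fibre μ)) : Prop :=
  IsMonodromy R.kappa h (R.fibre μ) (fun b _ v => R.act (σ b : GL (Fin n) ℂ) v) π

end GLRep

/-- The exponential of an endomorphism of a finite-dimensional space, computed in a basis. -/
def endExp {V : Type*} [AddCommGroup V] [Module ℂ V] [FiniteDimensional ℂ V]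
    (T : Module.End ℂ V) : Module.End ℂ V :=
  Matrix.toLin (Module.finBasis ℂ V) (Module.finBasis ℂ V)
    (NormedSpace.exp (LinearMap.toMatrix (Module.finBasis ℂ V) (Module.finBasis ℂ V) T))

section Gauge

variable {n : ℕ} {V : Type*} [AddCommGroup V] [Module ℂ V]

/-- The operator `E_{ii} + E_{jj} + 2 E_{ii} E_{jj} / k` on the fibre `⨁_{ν ∈ 𝔖_n μ} V[ν]`. -/
def GLRep.twist (R : GLRep n V) (k : ℕ) (μ : Fin n → ℕ) (i j : Fin n) :
    Module.End ℂ (R.fibre μ) :=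
  R.cartan μ i + R.cartan μ j + (2 / k : ℂ) • (R.cartan μ i * R.cartan μ j)

/-- The operator acting on `V[ν]` as `∏_{i<j} (t_i - t_j) ^ (h (ν_i + ν_j + 2 ν_i ν_j / k))`. -/
def GLRep.gauge [FiniteDimensional ℂ V] (R : GLRep n V) (k : ℕ) (h : ℂ) (μ : Fin n → ℕ)
    (t : Fin n → ℝ) : Module.End ℂ (R.fibre μ) :=
  endExp (∑ i : Fin n, ∑ j ∈ Finset.Ioi i,
    (h * (Real.log (t i - t j) : ℂ)) • R.twist k μ i j)

end Gauge

end DualPair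

end

/-!
The connections are compared fibrewise, by an isomorphism between the two fibres that intertwines
them up to connection forms with scalar values on each weight space.

The isomorphism is `(GL_k, GL_n)`-duality. A polynomial on `k × n` matrices that is killed by the
raising operators of both `𝔤𝔩_k` and `𝔤𝔩_n`, and has a weight for `𝔤𝔩_k`, is determined by its
value at the matrix `1_{k × n}`: the equations express its partial derivatives there by terms of
lower order (`eq_zero_of_eval_idPt`). Hence it is a multiple of `hwPoly`, a product of powers of
leading principal minors, and `hwPoly` lies in every nonzero `𝔤𝔩_n`-stable space of singular
polynomials (`hwPoly_mem`). Together with the apolar form, for which `E_{ij}` and `E_{ji}` are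
adjoint, this shows that such a space, if it is finite-dimensional, consists of all singular
polynomials (`eq_singular_of_invariant`). The submodule of `V × Poly k n` generated by the pair of
highest weight vectors is therefore the graph of an isomorphism `ι` of `V` with the space of
singular polynomials (`exists_equiv_singular`), which matches weights with multidegrees
(`equiv_mem_colHomogeneous_iff`) and the action of `GL_n` with right translations
(`eval_equiv_act`).

On polynomials, `2 Ω_{ij} = κ_{ij} - (E_{ii} + E_{jj} + 2 E_{ii} E_{jj} / k)` (`two_smul_omega`).
On vectors of weight `ν` the last term is a scalar `D_{ij}(ν)`, so `ι` takes a parallel section of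
the Casimir connection, multiplied by `∏ (z_i - z_j) ^ (-h D_{ij}(ν))`, to a parallel section of
the KZ connection (`IsParallelFun.twist`). Along a half-twist, the logarithm of the difference of
the two moving points increases by `π I`, and the end points of the other logarithms are permuted
(`sum_twistLog_one`): this yields the phase `exp (-π I h D_{ij})` and the gauge transformation. The
permutation of two columns of variables is right translation by a permutation matrix, and differs
from the lift of the transposition in `SL_n` by the sign `exp (π I E_{ii})`
(`permCols_swap_equiv`). The three factors are put together in `gauge_comp_monodromy`.

Two existence statements precede the comparison. The truncated Casimir operators satisfy the
infinitesimal braid relations, also after a shift by functions of the weights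
(`IsGlAction.isInfinitesimalBraid_sub`); with Arnold's relation between the forms
`d log (z_i - z_j)` these make both connections integrable (`IsInfinitesimalBraid.commute`). Local
horizontal sections are obtained by iterated integration (`exists_hasFDerivAt_flip`); their germs
form a covering space of `X_n` (`coverCore`), and the lifting of paths and homotopies gives
parallel transport and the monodromy representation (`exists_forall_isMonodromy_iff`). The
homomorphism `σ` is itself a monodromy representation, of the connection
`d - 1/2 ∑ d log (z_i - z_j) (E_{ii} + E_{jj})` on `ℂ ^ n`, conjugated by a diagonal matrix; that
its values have determinant `1` reflects the antisymmetry of the Vandermonde product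
(`exists_isTitsHom`).
-/

open Topology

noncomputable section

namespace DualPair

/-! ### Local horizontal sections -/

section Frobenius

variable {H E : Type*} [NormedAddCommGroup H] [NormedSpace ℂ H]
  [NormedAddCommGroup E] [NormedSpace ℂ E]

/-- A horizontal section of a connection form vanishes on a small convex set as soon as it vanishes
at one point. Sections have derivative `u ↦ Ω z u (f z)`, that is, `(Ω z).flip (f z)`; the set is
small in the sense that `M * r ≤ 1 / 2`, so the mean value inequality halves the maximum of `‖f‖`
on a segment. -/
theorem eq_zero_of_hasFDerivAt_flip {Ω : H → H →L[ℂ] E →L[ℂ] E} {U : Set H} (hU : Convex ℝ U)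
    {M r : ℝ} (hM : ∀ z ∈ U, ‖Ω z‖ ≤ M) (hr : ∀ x ∈ U, ∀ y ∈ U, ‖x - y‖ ≤ r) (hMr : M * r ≤ 1 / 2)
    {f : H → E} (hf : ∀ z ∈ U, HasFDerivAt f ((Ω z).flip (f z)) z) {x : H} (hx : x ∈ U)
    (hfx : f x = 0) {y : H} (hy : y ∈ U) : f y = 0 := by
  have hM0 : 0 ≤ M := le_trans (norm_nonneg (Ω x)) (hM x hx)
  have hseg : segment ℝ x y ⊆ U := hU.segment_subset hx hy
  have hcpt : IsCompact (segment ℝ x y) := by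
    rw [segment_eq_image_lineMap]
    exact isCompact_Icc.image (AffineMap.lineMap_continuous)
  obtain ⟨w, hw, hmax⟩ := hcpt.exists_isMaxOn ⟨x, left_mem_segment ℝ x y⟩
    (f := fun z => ‖f z‖) (fun z hz => (hf z (hseg hz)).continuousAt.norm.continuousWithinAt)
  have key : ‖f w - f x‖ ≤ (M * ‖f w‖) * ‖w - x‖ := by
    refine (convex_segment x y).norm_image_sub_le_of_norm_hasFDerivWithin_le (𝕜 := ℂ)
      (f' := fun z => (Ω z).flip (f z))
      (fun z hz => (hf z (hseg hz)).hasFDerivWithinAt) (fun z hz => ?_)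
      (left_mem_segment ℝ x y) hw
    calc ‖(Ω z).flip (f z)‖ ≤ ‖(Ω z).flip‖ * ‖f z‖ := ContinuousLinearMap.le_opNorm _ _
      _ ≤ M * ‖f w‖ := by
        rw [ContinuousLinearMap.opNorm_flip]
        exact mul_le_mul (hM z (hseg hz)) (hmax hz) (norm_nonneg _) hM0
  rw [hfx, sub_zero] at key
  have h1 : ‖f w‖ ≤ 0 := by
    have h2 := hr w (hseg hw) x hx
    have h3 : (M * ‖f w‖) * ‖w - x‖ ≤ (M * ‖f w‖) * r :=
      mul_le_mul_of_nonneg_left h2 (by positivity)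
    nlinarith [norm_nonneg (f w)]
  have h2 : ‖f y‖ ≤ ‖f w‖ := hmax (right_mem_segment ℝ x y)
  exact norm_le_zero_iff.1 (h2.trans h1)

/-- The Poincaré lemma, applied to the `1`-form `Ω f`: if `f` is a primitive of `Ω g`, then `Ω f` is
closed, because `Ω` is closed and `Ω ∧ Ω = 0`. -/
theorem exists_primitive_flip [CompleteSpace E] {Ω : H → H →L[ℂ] E →L[ℂ] E} {U : Set H}
    (hU : Convex ℝ U) (hUo : IsOpen U) {Ω' : H → H →L[ℂ] H →L[ℂ] E →L[ℂ] E}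
    (hΩ : ∀ z ∈ U, HasFDerivAt Ω (Ω' z) z) (hsymm : ∀ z ∈ U, ∀ u v, Ω' z u v = Ω' z v u)
    (hcomm : ∀ z ∈ U, ∀ u v w, Ω z u (Ω z v w) = Ω z v (Ω z u w))
    {f g : H → E} (hf : ∀ z ∈ U, HasFDerivAt f ((Ω z).flip (g z)) z) {x : H} :
    ∃ F : H → E, F x = 0 ∧ ∀ z ∈ U, HasFDerivAt F ((Ω z).flip (f z)) z := by
  let L : (H →L[ℂ] E →L[ℂ] E) →L[ℂ] (E →L[ℂ] H →L[ℂ] E) :=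
    (ContinuousLinearMap.flipₗᵢ ℂ H E E).toContinuousLinearEquiv.toContinuousLinearMap
  have hd : ∀ z ∈ U, HasFDerivAt (fun z => (Ω z).flip (f z))
      (((Ω z).flip.comp ((Ω z).flip (g z))) + (L.comp (Ω' z)).flip (f z)) z := by
    intro z hz
    have h1 : HasFDerivAt (fun z => L (Ω z)) (L.comp (Ω' z)) z :=
      HasFDerivAt.comp (𝕜 := ℂ) (E := H) (F := H →L[ℂ] E →L[ℂ] E) (G := E →L[ℂ] H →L[ℂ] E)
        (g := L) (f := Ω) z L.hasFDerivAt (hΩ z hz)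
    exact h1.clm_apply (hf z hz)
  let _ : NormedSpace ℝ H := NormedSpace.restrictScalars ℝ ℂ H
  let _ : NormedSpace ℝ E := NormedSpace.restrictScalars ℝ ℂ E
  obtain ⟨F, hF⟩ := hU.exists_forall_hasFDerivAt_of_fderiv_symmetric (𝕜 := ℂ) hUo
    (ω := fun z => (Ω z).flip (f z))
    (fun z hz => ((hd z hz).restrictScalars ℝ).differentiableAt.differentiableWithinAt) (by
      intro z hz u v
      rw [((hd z hz).restrictScalars ℝ).fderiv]
      simp [L, hsymm z hz u v, hcomm z hz u v])
  exact ⟨fun z => F z - F x, sub_self _, fun z hz => (hF z hz).sub_const _⟩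

/-- The Frobenius theorem for an integrable linear connection `d - Ω`, on a small convex open set.
The section is the sum of the iterated integrals of `Ω` (Picard iteration). -/
theorem exists_hasFDerivAt_flip [CompleteSpace E] {Ω : H → H →L[ℂ] E →L[ℂ] E} {U : Set H}
    (hU : Convex ℝ U) (hUo : IsOpen U) {M r : ℝ} (hM : ∀ z ∈ U, ‖Ω z‖ ≤ M)
    (hr : ∀ x ∈ U, ∀ y ∈ U, ‖x - y‖ ≤ r) (hMr : M * r ≤ 1 / 2) {Ω' : H → H →L[ℂ] H →L[ℂ] E →L[ℂ] E}
    (hΩ : ∀ z ∈ U, HasFDerivAt Ω (Ω' z) z) (hsymm : ∀ z ∈ U, ∀ u v, Ω' z u v = Ω' z v u)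
    (hcomm : ∀ z ∈ U, ∀ u v w, Ω z u (Ω z v w) = Ω z v (Ω z u w))
    {x : H} (hx : x ∈ U) (v : E) :
    ∃ f : H → E, f x = v ∧ ∀ z ∈ U, HasFDerivAt f ((Ω z).flip (f z)) z := by
  have hM0 : 0 ≤ M := le_trans (norm_nonneg (Ω x)) (hM x hx)
  -- the functions to which `exists_primitive_flip` applies
  let S := {f : H → E // ∃ g : H → E, ∀ z ∈ U, HasFDerivAt f ((Ω z).flip (g z)) z}
  have step : ∀ f : S, ∃ F : S, F.1 x = 0 ∧ ∀ z ∈ U, HasFDerivAt F.1 ((Ω z).flip (f.1 z)) z := by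
    rintro ⟨f, g, hf⟩
    obtain ⟨F, h0, hF⟩ := exists_primitive_flip hU hUo hΩ hsymm hcomm hf (x := x)
    exact ⟨⟨F, f, hF⟩, h0, hF⟩
  choose nxt hnxt0 hnxt using step
  let e0 : S := ⟨fun _ => v, fun _ => 0, fun z _ => by
    simpa using hasFDerivAt_const v z⟩
  let e : ℕ → S := fun m => nxt^[m] e0
  have he : ∀ m, e (m + 1) = nxt (e m) := fun m => Function.iterate_succ_apply' _ _ _
  let u : ℕ → ℝ := fun m => ‖v‖ * (1 / 2) ^ m
  have hu : Summable u := (summable_geometric_of_lt_one (by norm_num) (by norm_num)).mul_left _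
  have hform : ∀ m, ∀ z ∈ U, ‖(e m).1 z‖ ≤ u m → ‖(Ω z).flip ((e m).1 z)‖ ≤ M * u m := by
    intro m z hz h
    refine (ContinuousLinearMap.le_opNorm _ _).trans ?_
    rw [ContinuousLinearMap.opNorm_flip]
    exact mul_le_mul (hM z hz) h (norm_nonneg _) hM0
  -- each iteration halves the bound, since `M * r ≤ 1 / 2`
  have hb : ∀ m, ∀ z ∈ U, ‖(e m).1 z‖ ≤ u m := by
    intro m
    induction m with
    | zero => intro z hz; simp [e, u, e0]
    | succ m ih =>
      intro z hz
      have key : ‖(e (m + 1)).1 z - (e (m + 1)).1 x‖ ≤ (M * u m) * ‖z - x‖ := by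
        refine hU.norm_image_sub_le_of_norm_hasFDerivWithin_le (𝕜 := ℂ)
          (f' := fun z => (Ω z).flip ((e m).1 z)) (fun y hy => ?_)
          (fun y hy => hform m y hy (ih y hy)) hx hz
        rw [he]
        exact (hnxt _ y hy).hasFDerivWithinAt
      have h0 : (e (m + 1)).1 x = 0 := by rw [he]; exact hnxt0 _
      rw [h0, sub_zero] at key
      have hum : 0 ≤ u m := by positivity
      have h3 : (M * u m) * ‖z - x‖ ≤ (M * u m) * r :=
        mul_le_mul_of_nonneg_left (hr z hz x hx) (by positivity)
      have h4 : u (m + 1) = u m / 2 := by simp only [u]; ring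
      rw [h4]
      nlinarith
  have hsum : ∀ z ∈ U, Summable fun m => (e m).1 z := fun z hz =>
    Summable.of_norm_bounded hu fun m => hb m z hz
  -- the derivative of the `m`-th term is `Ω` applied to the preceding term
  let e' : ℕ → H → E := fun m => match m with
    | 0 => fun _ => 0
    | m + 1 => (e m).1
  have hder : ∀ m z, z ∈ U → HasFDerivAt (e m).1 ((Ω z).flip (e' m z)) z := by
    intro m z hz
    cases m with
    | zero => simpa [e', e, e0] using hasFDerivAt_const v z
    | succ m => rw [he]; exact hnxt _ z hz
  let u' : ℕ → ℝ := fun m => match m with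
    | 0 => 0
    | m + 1 => M * u m
  have hu' : Summable u' := (summable_nat_add_iff 1).1 (hu.mul_left M)
  refine ⟨fun z => ∑' m, (e m).1 z, ?_, fun z hz => ?_⟩
  · beta_reduce
    have : ∀ m, (e (m + 1)).1 x = 0 := fun m => by rw [he]; exact hnxt0 _
    rw [(hsum x hx).tsum_eq_zero_add, tsum_congr this, tsum_zero, add_zero]
    rfl
  · have h := hasFDerivAt_tsum_of_isPreconnected (𝕜 := ℂ) hu' hUo hU.isPreconnected
      (fun m z hz => hder m z hz) (fun m z hz => by
        cases m with
        | zero => simp [e', u']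
        | succ m => exact hform m z hz (hb m z hz)) hx (hsum x hx) hz
    convert! h using 1
    have hs' : Summable fun m => e' m z := (summable_nat_add_iff 1).1 (hsum z hz)
    rw [← ContinuousLinearMap.map_tsum _ hs', hs'.tsum_eq_zero_add]
    simp [e']

end Frobenius

/-! ### Logarithmic connections with values in a normed space -/

section LogForm

variable {n : ℕ} {E : Type*} [NormedAddCommGroup E] [NormedSpace ℂ E]

/-- The linear form `dz_i - dz_j`. -/
def diffProj (i j : Fin n) : (Fin n → ℂ) →L[ℂ] ℂ :=
  (ContinuousLinearMap.proj i : (Fin n → ℂ) →L[ℂ] ℂ) - ContinuousLinearMap.proj j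

@[simp] theorem diffProj_apply (i j : Fin n) (u : Fin n → ℂ) : diffProj i j u = u i - u j := rfl

/-- The `End E`-valued `1`-form `c ∑_{i<j} (dz_i - dz_j) / (z_i - z_j) A_{ij}`. -/
def logForm (A : Fin n → Fin n → E →L[ℂ] E) (c : ℂ) (z : Fin n → ℂ) :
    (Fin n → ℂ) →L[ℂ] E →L[ℂ] E :=
  ∑ i : Fin n, ∑ j ∈ Finset.Ioi i, (c * (z i - z j)⁻¹) • (diffProj i j).smulRight (A i j)

theorem logForm_apply (A : Fin n → Fin n → E →L[ℂ] E) (c : ℂ) (z u : Fin n → ℂ) (v : E) :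
    logForm A c z u v =
      ∑ i : Fin n, ∑ j ∈ Finset.Ioi i, (c * ((u i - u j) / (z i - z j))) • A i j v := by
  simp only [logForm, sum_apply, smul_apply,
    ContinuousLinearMap.smulRight_apply, diffProj_apply, smul_smul]
  refine Finset.sum_congr rfl fun i _ => Finset.sum_congr rfl fun j _ => ?_
  congr 1
  ring

/-- The derivative of `logForm A c` as a function of the point. -/
def logFormDeriv (A : Fin n → Fin n → E →L[ℂ] E) (c : ℂ) (z : Fin n → ℂ) :
    (Fin n → ℂ) →L[ℂ] (Fin n → ℂ) →L[ℂ] E →L[ℂ] E :=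
  ∑ i : Fin n, ∑ j ∈ Finset.Ioi i, ((c * -((z i - z j) ^ 2)⁻¹) • diffProj i j).smulRight
    ((diffProj i j).smulRight (A i j))

theorem isOpen_injective : IsOpen {z : Fin n → ℂ | Function.Injective z} := by
  have : {z : Fin n → ℂ | Function.Injective z} = ⋂ i, ⋂ j, {z | i ≠ j → z i ≠ z j} := by
    ext z
    simp only [Set.mem_ofPred_eq, Set.mem_iInter, Function.Injective]
    exact forall₂_congr fun i j => not_imp_not.symm
  rw [this]
  refine isOpen_iInter_of_finite fun i => isOpen_iInter_of_finite fun j => ?_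
  by_cases h : i = j
  · simp [h]
  · simpa [h] using isOpen_ne_fun (continuous_apply i) (continuous_apply j)

theorem hasFDerivAt_inv_smul {H G : Type*} [NormedAddCommGroup H] [NormedSpace ℂ H]
    [NormedAddCommGroup G] [NormedSpace ℂ G] (c : ℂ) (l : H →L[ℂ] ℂ) {z : H} (hz : l z ≠ 0)
    (X : G) :
    HasFDerivAt (fun y => (c * (l y)⁻¹) • X) (((c * -((l z) ^ 2)⁻¹) • l).smulRight X) z := by
  have := ((hasDerivAt_inv hz).comp_hasFDerivAt z l.hasFDerivAt).const_mul c
  rw [mul_smul]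
  exact HasFDerivAt.smul_const this X

theorem hasFDerivAt_logForm (A : Fin n → Fin n → E →L[ℂ] E) (c : ℂ) {z : Fin n → ℂ}
    (hz : Function.Injective z) : HasFDerivAt (logForm A c) (logFormDeriv A c z) z := by
  unfold logForm logFormDeriv
  refine HasFDerivAt.fun_sum (𝕜 := ℂ) (E := Fin n → ℂ) (F := (Fin n → ℂ) →L[ℂ] E →L[ℂ] E) fun i _ =>
    HasFDerivAt.fun_sum (𝕜 := ℂ) (E := Fin n → ℂ) (F := (Fin n → ℂ) →L[ℂ] E →L[ℂ] E) fun j hj => ?_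
  have hne : diffProj i j z ≠ 0 := by
    rw [diffProj_apply, sub_ne_zero]
    exact hz.ne (Finset.mem_Ioi.1 hj).ne
  exact hasFDerivAt_inv_smul c (diffProj i j) hne ((diffProj i j).smulRight (A i j))

theorem logFormDeriv_symm (A : Fin n → Fin n → E →L[ℂ] E) (c : ℂ) (z u v : Fin n → ℂ) :
    logFormDeriv A c z u v = logFormDeriv A c z v u := by
  simp only [logFormDeriv, sum_apply, smul_apply,
    ContinuousLinearMap.smulRight_apply, diffProj_apply, smul_smul, smul_eq_mul]
  refine Finset.sum_congr rfl fun i _ => Finset.sum_congr rfl fun j _ => ?_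
  congr 1
  ring

/-- Integrability of the connection `d - logForm A c`: the values of the form commute. -/
def IsFlat (A : Fin n → Fin n → E →L[ℂ] E) (c : ℂ) : Prop :=
  ∀ z : Fin n → ℂ, Function.Injective z → ∀ u v w,
    logForm A c z u (logForm A c z v w) = logForm A c z v (logForm A c z u w)

/-- `f` is a horizontal section on `U` of the connection `d - logForm A c`. -/
def IsHorizontal (A : Fin n → Fin n → E →L[ℂ] E) (c : ℂ) (U : Set (Fin n → ℂ))
    (f : (Fin n → ℂ) → E) : Prop :=
  ∀ z ∈ U, HasFDerivAt f ((logForm A c z).flip (f z)) z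

theorem IsHorizontal.mono {A : Fin n → Fin n → E →L[ℂ] E} {c : ℂ} {U V : Set (Fin n → ℂ)}
    {f : (Fin n → ℂ) → E} (hf : IsHorizontal A c U f) (h : V ⊆ U) : IsHorizontal A c V f :=
  fun z hz => hf z (h hz)

theorem IsHorizontal.sub {A : Fin n → Fin n → E →L[ℂ] E} {c : ℂ} {U : Set (Fin n → ℂ)}
    {f g : (Fin n → ℂ) → E} (hf : IsHorizontal A c U f) (hg : IsHorizontal A c U g) :
    IsHorizontal A c U (fun z => f z - g z) := fun z hz => by
  rw [map_sub]; exact (hf z hz).sub (hg z hz)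

/-- `U` is a convex open set on which horizontal sections exist with any given
initial value, and are determined on each convex subset by their value at one point. -/
structure IsGood (A : Fin n → Fin n → E →L[ℂ] E) (c : ℂ) (U : Set (Fin n → ℂ)) : Prop where
  isOpen : IsOpen U
  convex : Convex ℝ U
  exists_section : ∀ x ∈ U, ∀ v, ∃ f, f x = v ∧ IsHorizontal A c U f
  eq_zero : ∀ V ⊆ U, Convex ℝ V → ∀ f, IsHorizontal A c V f → ∀ x ∈ V, f x = 0 → ∀ y ∈ V, f y = 0

theorem IsGood.eqOn {A : Fin n → Fin n → E →L[ℂ] E} {c : ℂ} {U V : Set (Fin n → ℂ)}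
    (hU : IsGood A c U) (hVU : V ⊆ U) (hV : Convex ℝ V) {f g : (Fin n → ℂ) → E}
    (hf : IsHorizontal A c V f) (hg : IsHorizontal A c V g) {x : Fin n → ℂ} (hx : x ∈ V)
    (h : f x = g x) {y : Fin n → ℂ} (hy : y ∈ V) : f y = g y :=
  sub_eq_zero.1 (hU.eq_zero V hVU hV _ (hf.sub hg) x hx (sub_eq_zero.2 h) y hy)

/-- Good neighbourhoods are arbitrarily small: a ball of radius at most `1 / (4 M)`, where `M`
bounds the connection form, has diameter at most `1 / (2 M)`. -/
theorem exists_isGood [CompleteSpace E] {A : Fin n → Fin n → E →L[ℂ] E} {c : ℂ} (hA : IsFlat A c)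
    {x : Fin n → ℂ} (hx : Function.Injective x) {N : Set (Fin n → ℂ)} (hN : N ∈ 𝓝 x) :
    ∃ U ⊆ N, x ∈ U ∧ IsGood A c U := by
  have hcont : ContinuousAt (fun z => ‖logForm A c z‖) x :=
    ContinuousAt.norm (E := (Fin n → ℂ) →L[ℂ] E →L[ℂ] E) (hasFDerivAt_logForm A c hx).continuousAt
  set M := ‖logForm A c x‖ + 1 with hMdef
  have hM : 0 < M := by positivity
  have h1 : ∀ᶠ z in 𝓝 x, ‖logForm A c z‖ < M := hcont.eventually_lt_const (by simp [hMdef])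
  have h2 : ∀ᶠ z in 𝓝 x, Function.Injective z := isOpen_injective.mem_nhds hx
  obtain ⟨ρ, hρ, hball⟩ := Metric.eventually_nhds_iff_ball.1 (h1.and (h2.and hN))
  set δ := min ρ (1 / (4 * M)) with hδ
  have hδ0 : 0 < δ := lt_min hρ (by positivity)
  have hsub : Metric.ball x δ ⊆ Metric.ball x ρ := Metric.ball_subset_ball (min_le_left _ _)
  have hMb : ∀ z ∈ Metric.ball x δ, ‖logForm A c z‖ ≤ M := fun z hz => (hball z (hsub hz)).1.le
  have hr : ∀ y ∈ Metric.ball x δ, ∀ z ∈ Metric.ball x δ, ‖y - z‖ ≤ 2 * δ := by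
    intro y hy z hz
    rw [← dist_eq_norm]
    have := dist_triangle_right y z x
    have h3 := Metric.mem_ball.1 hy
    have h4 := Metric.mem_ball.1 hz
    linarith
  have hMr : M * (2 * δ) ≤ 1 / 2 := by
    have h5 : δ ≤ 1 / (4 * M) := min_le_right _ _
    calc M * (2 * δ) ≤ M * (2 * (1 / (4 * M))) := by gcongr
      _ = 1 / 2 := by field_simp; norm_num
  refine ⟨Metric.ball x δ, fun z hz => (hball z (hsub hz)).2.2, Metric.mem_ball_self hδ0,
    Metric.isOpen_ball, convex_ball _ _, ?_, ?_⟩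
  · intro y hy v
    exact exists_hasFDerivAt_flip (convex_ball _ _) Metric.isOpen_ball hMb hr hMr
      (fun z hz => hasFDerivAt_logForm A c (hball z (hsub hz)).2.1)
      (fun z _ => logFormDeriv_symm A c z) (fun z hz => hA z (hball z (hsub hz)).2.1) hy v
  · intro V hV hVc f hf y hy h0 w hw
    exact eq_zero_of_hasFDerivAt_flip hVc (fun z hz => hMb z (hV hz))
      (fun a ha b hb => hr a (hV ha) b (hV hb)) hMr hf hy h0 hw

end LogForm

/-! ### Parallel transport along paths -/

section Covering

variable {n : ℕ} {E : Type*} [NormedAddCommGroup E] [NormedSpace ℂ E]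

/-- `s` is a parallel section along `γ` of the connection `d - logForm A c`. -/
def IsParallel (A : Fin n → Fin n → E →L[ℂ] E) (c : ℂ) (γ : unitInterval → Conf n)
    (s : unitInterval → E) : Prop :=
  ∀ τ : unitInterval, ∃ (U : Set (Fin n → ℂ)) (f : (Fin n → ℂ) → E),
    IsOpen U ∧ (γ τ).1 ∈ U ∧ IsHorizontal A c U f ∧ ∀ᶠ τ' in 𝓝 τ, s τ' = f (γ τ').1

/-- Parallel sections along a path are determined by their initial value: the set where two of them
agree is open and closed. -/
theorem IsParallel.eq_of_eq [CompleteSpace E] {A : Fin n → Fin n → E →L[ℂ] E} {c : ℂ}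
    (hA : IsFlat A c) {γ : unitInterval → Conf n} (hγ : Continuous γ) {s s' : unitInterval → E}
    (hs : IsParallel A c γ s) (hs' : IsParallel A c γ s') (h0 : s 0 = s' 0) (τ : unitInterval) :
    s τ = s' τ := by
  have hlc : IsLocallyConstant (fun τ => s τ = s' τ) := by
    rw [IsLocallyConstant.iff_eventually_eq]
    intro τ
    obtain ⟨U, f, hU, hτ, hf, hsf⟩ := hs τ
    obtain ⟨U', f', hU', hτ', hf', hsf'⟩ := hs' τ
    obtain ⟨V, hVN, hxV, hV⟩ := exists_isGood hA (γ τ).2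
      (Filter.inter_mem (hU.mem_nhds hτ) (hU'.mem_nhds hτ'))
    have hVγ : ∀ᶠ τ' in 𝓝 τ, (γ τ').1 ∈ V :=
      (continuous_subtype_val.comp hγ).continuousAt.eventually (hV.isOpen.mem_nhds hxV)
    have hfV := hf.mono (fun z hz => (hVN hz).1)
    have hfV' := hf'.mono (fun z hz => (hVN hz).2)
    filter_upwards [hsf, hsf', hVγ] with τ' h1 h2 h3
    rw [h1, h2, hsf.self_of_nhds, hsf'.self_of_nhds]
    exact propext ⟨fun h => hV.eqOn le_rfl hV.convex hfV hfV' h3 h hxV,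
      fun h => hV.eqOn le_rfl hV.convex hfV hfV' hxV h h3⟩
  have := hlc.apply_eq_of_isPreconnected isPreconnected_univ (Set.mem_univ 0) (Set.mem_univ τ)
  exact this.mp h0

/-- A copy of `E` with the discrete topology, the fibre of the covering by germs of horizontal
sections. -/
def Disc (E : Type*) : Type _ := E

instance (E : Type*) : TopologicalSpace (Disc E) := ⊥
instance (E : Type*) : DiscreteTopology (Disc E) := ⟨rfl⟩

variable [CompleteSpace E] {A : Fin n → Fin n → E →L[ℂ] E} {c : ℂ}

section

variable (hA : IsFlat A c)

/-- A good neighbourhood of a configuration. -/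
def goodNhd (x : Conf n) : Set (Fin n → ℂ) := (exists_isGood hA x.2 Filter.univ_mem).choose

theorem mem_goodNhd (x : Conf n) : x.1 ∈ goodNhd hA x :=
  (exists_isGood hA x.2 Filter.univ_mem).choose_spec.2.1

theorem isGood_goodNhd (x : Conf n) : IsGood A c (goodNhd hA x) :=
  (exists_isGood hA x.2 Filter.univ_mem).choose_spec.2.2

open Classical in
/-- The horizontal section on the good neighbourhood of `i` with value `v` at `x`. -/
def localSec (i x : Conf n) (v : E) : (Fin n → ℂ) → E :=
  if h : x.1 ∈ goodNhd hA i then ((isGood_goodNhd hA i).exists_section x.1 h v).choose else 0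

theorem localSec_self {i x : Conf n} (h : x.1 ∈ goodNhd hA i) (v : E) :
    localSec hA i x v x.1 = v := by
  rw [localSec, dif_pos h]
  exact ((isGood_goodNhd hA i).exists_section x.1 h v).choose_spec.1

theorem isHorizontal_localSec {i x : Conf n} (h : x.1 ∈ goodNhd hA i) (v : E) :
    IsHorizontal A c (goodNhd hA i) (localSec hA i x v) := by
  rw [localSec, dif_pos h]
  exact ((isGood_goodNhd hA i).exists_section x.1 h v).choose_spec.2

/-- Every horizontal section on a good neighbourhood is a `localSec`. -/
theorem localSec_eq {i x : Conf n} (h : x.1 ∈ goodNhd hA i) {f : (Fin n → ℂ) → E}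
    (hf : IsHorizontal A c (goodNhd hA i) f) {y : Fin n → ℂ} (hy : y ∈ goodNhd hA i) :
    localSec hA i x (f x.1) y = f y :=
  (isGood_goodNhd hA i).eqOn le_rfl (isGood_goodNhd hA i).convex (isHorizontal_localSec hA h _) hf
    h (localSec_self hA h _) hy

theorem localSec_localSec {i x : Conf n} (h : x.1 ∈ goodNhd hA i) (v : E) :
    localSec hA i x (localSec hA i i v x.1) i.1 = v := by
  have hi := mem_goodNhd hA i
  rw [localSec_eq hA h (isHorizontal_localSec hA hi _) hi, localSec_self hA hi]

theorem localSec_localSec' {i x : Conf n} (h : x.1 ∈ goodNhd hA i) (v : E) :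
    localSec hA i i (localSec hA i x v i.1) x.1 = v := by
  rw [localSec_eq hA (mem_goodNhd hA i) (isHorizontal_localSec hA h _) h, localSec_self hA h]

/-- The covering space of `X_n` whose sections are the horizontal sections of the connection, as a
fibre bundle with discrete fibre; over a good neighbourhood of `i` it is trivialised by the values
at `i`. -/
def coverCore : FiberBundleCore (Conf n) (Conf n) (Disc E) where
  baseSet i := Subtype.val ⁻¹' goodNhd hA i
  isOpen_baseSet i := (isGood_goodNhd hA i).isOpen.preimage continuous_subtype_val
  indexAt x := x
  mem_baseSet_at x := mem_goodNhd hA x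
  coordChange i j x v := localSec (E := E) hA j x (localSec (E := E) hA i i v x.1) j.1
  coordChange_self i x hx v := localSec_localSec hA hx v
  continuousOn_coordChange i j := by
    rcases Set.eq_empty_or_nonempty
      ((Subtype.val ⁻¹' goodNhd hA i : Set (Conf n)) ∩ Subtype.val ⁻¹' goodNhd hA j)
      with h | ⟨x, hx⟩
    · rw [h, Set.empty_prod]; exact continuousOn_empty _
    · have hg : Continuous (X := Disc E) (Y := Disc E) (fun v : Disc E =>
          (localSec (E := E) hA j x (localSec (E := E) hA i i v x.1) j.1 : Disc E)) :=
        continuous_of_discreteTopology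
      refine (hg.comp (continuous_snd (X := Conf n))).continuousOn.congr ?_
      -- the coordinate change at `y` agrees with that at `x`, as the intersection is convex
      rintro ⟨y, v⟩ ⟨hy, -⟩
      have hi := isHorizontal_localSec (E := E) hA (mem_goodNhd hA i) v
      have hj := isHorizontal_localSec hA hx.2 (localSec (E := E) hA i i v x.1)
      have hxy : localSec hA j x (localSec (E := E) hA i i v x.1) y.1 =
          localSec (E := E) hA i i v y.1 :=
        (isGood_goodNhd hA i).eqOn (V := goodNhd hA i ∩ goodNhd hA j) Set.inter_subset_left
          ((isGood_goodNhd hA i).convex.inter (isGood_goodNhd hA j).convex)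
          (hj.mono Set.inter_subset_right) (hi.mono Set.inter_subset_left) hx
          (localSec_self hA hx.2 _) hy
      change localSec hA j y (localSec (E := E) hA i i v y.1) j.1 = _
      rw [← hxy, localSec_eq hA hy.2 hj (mem_goodNhd hA j)]
      rfl
  coordChange_comp i j k x hx v := by
    exact congrArg (fun u => localSec hA k x u k.1) (localSec_localSec' hA hx.1.2 _)

theorem isCoveringMap_cover :
    IsCoveringMap (Bundle.TotalSpace.proj : (coverCore hA).TotalSpace → Conf n) :=
  FiberBundle.isCoveringMap (F := Disc E) (E := (coverCore hA).Fiber)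

/-- The value of the horizontal section represented by a point of the covering space. -/
def coverVal (p : (coverCore hA).TotalSpace) : E := p.2

/-- In the trivialisation at `i`, a point of the covering space is given by the value at `i` of the
horizontal section that it represents. -/
theorem localTriv_snd (i : Conf n) (p : (coverCore hA).TotalSpace) :
    (((coverCore hA).localTriv i) p).2 = localSec hA i p.proj (coverVal hA p) i.1 := by
  have h := localSec_self hA (mem_goodNhd hA p.proj) (coverVal hA p)
  rw [FiberBundleCore.localTriv_apply]
  change localSec hA i p.proj (localSec hA p.proj p.proj (coverVal hA p) p.proj.1) i.1 = _
  rw [h]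

/-- A continuous path in the covering space is a parallel section along its projection. -/
theorem isParallel_of_continuous {γ : unitInterval → Conf n}
    {Γ : unitInterval → (coverCore hA).TotalSpace}
    (hΓ : Continuous Γ) (hγ : ∀ τ, (Γ τ).proj = γ τ) :
    IsParallel A c γ (fun τ => coverVal hA (Γ τ)) := by
  intro τ
  let i := (Γ τ).proj
  have hsrc : Γ τ ∈ ((coverCore hA).localTriv i).source :=
    ((coverCore hA).mem_localTriv_source i _).2 (mem_goodNhd hA i)
  have hc : ContinuousAt (fun τ' => (((coverCore hA).localTriv i) (Γ τ')).2) τ :=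
    continuousAt_snd.comp
      ((((coverCore hA).localTriv i).continuousOn.continuousAt
        (((coverCore hA).localTriv i).open_source.mem_nhds hsrc)).comp hΓ.continuousAt)
  have hev : ∀ᶠ τ' in 𝓝 τ, (((coverCore hA).localTriv i) (Γ τ')).2 =
      (((coverCore hA).localTriv i) (Γ τ)).2 :=
    hc.eventually (p := fun v => v = (((coverCore hA).localTriv i) (Γ τ)).2)
      (by rw [nhds_discrete]; exact Filter.mem_pure.2 rfl)
  have hev2 : ∀ᶠ τ' in 𝓝 τ, Γ τ' ∈ ((coverCore hA).localTriv i).source :=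
    hΓ.continuousAt.eventually (((coverCore hA).localTriv i).open_source.mem_nhds hsrc)
  refine ⟨goodNhd hA i, localSec hA i i (coverVal hA (Γ τ)), (isGood_goodNhd hA i).isOpen, ?_,
    isHorizontal_localSec hA (mem_goodNhd hA i) _, ?_⟩
  · rw [← hγ]; exact mem_goodNhd hA i
  · filter_upwards [hev, hev2] with τ' h1 h2
    have h3 : (Γ τ').proj.1 ∈ goodNhd hA i := ((coverCore hA).mem_localTriv_source i _).1 h2
    have h4 := localSec_self hA (mem_goodNhd hA i) (coverVal hA (Γ τ))
    rw [localTriv_snd, localTriv_snd] at h1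
    rw [← h4.symm.trans h1.symm |>.symm, ← hγ]
    exact ((localSec_eq hA (mem_goodNhd hA i) (isHorizontal_localSec hA h3 _) h3).trans
      (localSec_self hA h3 _)).symm

end

/-- Parallel transport exists along every path, because paths lift to the covering space. -/
theorem exists_isParallel (hA : IsFlat A c) (γ : C(unitInterval, Conf n)) (v : E) :
    ∃ s, IsParallel A c γ s ∧ s 0 = v := by
  have h0 : γ 0 = Bundle.TotalSpace.proj (⟨γ 0, v⟩ : (coverCore hA).TotalSpace) := rfl
  let Γ := (isCoveringMap_cover hA).liftPath γ _ h0
  have hΓ := (isCoveringMap_cover hA).liftPath_lifts γ _ h0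
  refine ⟨fun τ => coverVal hA (Γ τ),
    isParallel_of_continuous hA Γ.continuous (fun τ => congrFun hΓ τ), ?_⟩
  have := (isCoveringMap_cover hA).liftPath_zero γ _ h0
  change coverVal hA (Γ 0) = v
  rw [show Γ 0 = _ from this]
  rfl

/-- Parallel transport depends only on the homotopy class of the path. -/
theorem IsParallel.eq_of_homotopicRel (hA : IsFlat A c) {γ γ' : C(unitInterval, Conf n)}
    (h : γ.HomotopicRel γ' {0, 1}) {s s' : unitInterval → E} (hs : IsParallel A c γ s)
    (hs' : IsParallel A c γ' s') (h0 : s 0 = s' 0) : s 1 = s' 1 := by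
  have h00 : γ 0 = γ' 0 := h.some.fst_eq_snd (by simp)
  have hγ : γ 0 = Bundle.TotalSpace.proj (⟨γ 0, s 0⟩ : (coverCore hA).TotalSpace) := rfl
  have hγ' : γ' 0 = Bundle.TotalSpace.proj (⟨γ 0, s 0⟩ : (coverCore hA).TotalSpace) := h00.symm
  have hend := (isCoveringMap_cover hA).liftPath_apply_one_eq_of_homotopicRel h _ hγ hγ'
  have h1 := isParallel_of_continuous hA ((isCoveringMap_cover hA).liftPath γ _ hγ).continuous
    (fun τ => congrFun ((isCoveringMap_cover hA).liftPath_lifts γ _ hγ) τ)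
  have h2 := isParallel_of_continuous hA ((isCoveringMap_cover hA).liftPath γ' _ hγ').continuous
    (fun τ => congrFun ((isCoveringMap_cover hA).liftPath_lifts γ' _ hγ') τ)
  have e1 := hs.eq_of_eq hA γ.continuous h1 (by
    have := (isCoveringMap_cover hA).liftPath_zero γ _ hγ
    rw [this]; rfl) 1
  have e2 := hs'.eq_of_eq hA γ'.continuous h2 (by
    have := (isCoveringMap_cover hA).liftPath_zero γ' _ hγ'
    rw [this, ← h0]; rfl) 1
  rw [e1, e2]
  rw [hend]

end Covering

/-! ### The infinitesimal braid relations and integrability -/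

section Arnold

variable {n : ℕ} {R : Type*} [Ring R] [Algebra ℂ R]

/-- The infinitesimal braid relations for a symmetric family of elements `B i j`. -/
structure IsInfinitesimalBraid (B : Fin n → Fin n → R) : Prop where
  symm : ∀ i j, i ≠ j → B i j = B j i
  disj : ∀ i j k l, i ≠ j → k ≠ l → i ≠ k → i ≠ l → j ≠ k → j ≠ l → B i j * B k l = B k l * B i j
  tri : ∀ i j k, i ≠ j → i ≠ k → j ≠ k → B i j * (B i k + B j k) = (B i k + B j k) * B i j

/-- By Arnold's relation between the forms `d log (z_i - z_j)`, the infinitesimal braid relations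
make the values of the form `∑_{i,j} d log (z_i - z_j) B_{ij}` commute. -/
theorem IsInfinitesimalBraid.commute {B : Fin n → Fin n → R} (hB : IsInfinitesimalBraid B)
    (hdiag : ∀ i, B i i = 0) {z : Fin n → ℂ} (hz : Function.Injective z) (u v : Fin n → ℂ) :
    (∑ i, ∑ j, ((u i - u j) / (z i - z j)) • B i j) *
        (∑ i, ∑ j, ((v i - v j) / (z i - z j)) • B i j) =
      (∑ i, ∑ j, ((v i - v j) / (z i - z j)) • B i j) *
        (∑ i, ∑ j, ((u i - u j) / (z i - z j)) • B i j) := by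
  have hsymm : ∀ i j, B i j = B j i := fun i j => by
    by_cases h : i = j
    · rw [h]
    · exact hB.symm i j h
  -- by the three-term relation, these commutators are antisymmetric in the three indices
  let D : Fin n → Fin n → Fin n → R := fun i k l => B i k * B k l - B k l * B i k
  have hD1 : ∀ i k l, D i l k = - D i k l := by
    intro i k l
    simp only [D]
    by_cases h1 : i = k
    · subst h1; rw [hdiag, hsymm l i]; simp
    by_cases h2 : i = l
    · subst h2; rw [hdiag, hsymm i k]; simp
    by_cases h3 : k = l
    · subst h3; simp [hdiag]
    have := hB.tri k l i h3 (Ne.symm h1) (Ne.symm h2)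
    rw [mul_add, add_mul, hsymm k i, hsymm l i] at this
    rw [hsymm l k]
    rw [eq_neg_iff_add_eq_zero, ← sub_eq_zero.2 this.symm]
    abel
  have hD2 : ∀ i k l, D l k i = - D i k l := by
    intro i k l
    simp only [D]
    rw [hsymm l k, hsymm k i]; abel
  have hD0 : ∀ i k l, i = k ∨ i = l ∨ k = l → D i k l = 0 := by
    intro i k l h
    simp only [D]
    rcases h with h | h | h
    · subst h; simp [hdiag]
    · subst h; rw [hsymm i k]; simp
    · subst h; simp [hdiag]
  set a : Fin n → Fin n → ℂ := fun i j => (u i - u j) / (z i - z j) with ha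
  set b : Fin n → Fin n → ℂ := fun i j => (v i - v j) / (z i - z j) with hb
  have ha' : ∀ i j, a i j = a j i := fun i j => by
    simp only [ha]; rw [← neg_sub (u j), ← neg_sub (z j), neg_div_neg_eq]
  -- the commutator of the first sum with a single generator
  have hcomm : ∀ k l, (∑ i, ∑ j, a i j • B i j) * B k l - B k l * (∑ i, ∑ j, a i j • B i j) =
      (2 : ℂ) • ∑ i, (a i k - a i l) • D i k l := by
    intro k l
    by_cases hkl : k = l
    · subst hkl; simp [hdiag]
    have hpt : ∀ i j, a i j • (B i j * B k l - B k l * B i j) =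
        (if j = k then (a i k) • D i k l else 0) + (if j = l then (- a i l) • D i k l else 0) +
        ((if i = k then (a j k) • D j k l else 0) +
          (if i = l then (- a j l) • D j k l else 0)) := by
      intro i j
      have e1 : ∀ i, B i l * B k l - B k l * B i l = - D i k l := fun i => by
        rw [← hD1 i k l]; simp only [D]; rw [hsymm l k]
      by_cases hij : i = j
      · subst hij
        rw [hdiag]
        split_ifs with h1 h2 h2
        · exact absurd (h1.symm.trans h2) hkl
        · subst h1; simp [hD0 i i l (Or.inl rfl)]
        · subst h2; simp [hD0 i k i (Or.inr (Or.inl rfl))]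
        · simp
      by_cases h1 : j = k
      · subst h1
        rw [if_pos rfl, if_neg hkl, if_neg hij]
        by_cases h2 : i = l
        · subst h2; simp [hD0, hsymm i j]
        · simp [h2, D]
      by_cases h2 : j = l
      · subst h2
        rw [if_neg h1, if_pos rfl, if_neg hij]
        by_cases h3 : i = k
        · subst h3; simp [hD0]
        · simp [h3, e1 i]
      rw [if_neg h1, if_neg h2]
      by_cases h3 : i = k
      · subst h3
        rw [if_pos rfl, if_neg hkl, ha' i j, hsymm i j]
        simp [D]
      by_cases h4 : i = l
      · subst h4
        rw [if_neg h3, if_pos rfl, ha' i j, hsymm i j, e1 j]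
        simp
      rw [if_neg h3, if_neg h4, hB.disj i j k l hij hkl h3 h4 h1 h2]
      simp
    rw [Finset.sum_mul, Finset.mul_sum, ← Finset.sum_sub_distrib]
    have : ∀ i, (∑ j, a i j • B i j) * B k l - B k l * ∑ j, a i j • B i j =
        ∑ j, a i j • (B i j * B k l - B k l * B i j) := by
      intro i
      rw [Finset.sum_mul, Finset.mul_sum, ← Finset.sum_sub_distrib]
      refine Finset.sum_congr rfl fun j _ => ?_
      rw [smul_sub, smul_mul_assoc, mul_smul_comm]
    simp_rw [this, hpt, Finset.sum_add_distrib]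
    simp only [Finset.sum_ite_eq', Finset.mem_univ, if_true]
    rw [Finset.sum_comm (f := fun i j => if i = k then a j k • D j k l else 0),
      Finset.sum_comm (f := fun i j => if i = l then (-a j l) • D j k l else 0)]
    simp only [Finset.sum_ite_eq', Finset.mem_univ, if_true]
    rw [← Finset.sum_add_distrib, two_smul]
    simp only [← add_smul, sub_eq_add_neg]
  -- summation over the generators; the total is antisymmetrised by cyclic permutations
  have hsum : ∑ k, ∑ l, ∑ i, (b k l * (a i k - a i l)) • D i k l = 0 := by
    set g : Fin n → Fin n → Fin n → R := fun k l i => (b k l * (a i k - a i l)) • D i k l with hg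
    have hc1 : ∑ k, ∑ l, ∑ i, g k l i = ∑ k, ∑ l, ∑ i, g l i k := by
      calc ∑ k, ∑ l, ∑ i, g k l i = ∑ l, ∑ i, ∑ k, g l i k := rfl
        _ = ∑ l, ∑ k, ∑ i, g l i k := Finset.sum_congr rfl fun l _ => Finset.sum_comm
        _ = _ := Finset.sum_comm
    have hc2 : ∑ k, ∑ l, ∑ i, g k l i = ∑ k, ∑ l, ∑ i, g i k l := by
      calc ∑ k, ∑ l, ∑ i, g k l i = ∑ i, ∑ k, ∑ l, g i k l := rfl
        _ = ∑ k, ∑ i, ∑ l, g i k l := Finset.sum_comm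
        _ = _ := Finset.sum_congr rfl fun k _ => Finset.sum_comm
    have hz3 : ∑ k, ∑ l, ∑ i, g k l i + ∑ k, ∑ l, ∑ i, g k l i + ∑ k, ∑ l, ∑ i, g k l i = 0 := by
      conv_lhs => enter [1, 2]; rw [hc1]
      conv_lhs => enter [2]; rw [hc2]
      simp_rw [← Finset.sum_add_distrib]
      refine Finset.sum_eq_zero fun k _ => Finset.sum_eq_zero fun l _ =>
        Finset.sum_eq_zero fun i _ => ?_
      by_cases h : i = k ∨ i = l ∨ k = l
      · simp only [hg]
        rw [hD0 i k l h, hD0 k l i (by tauto), hD0 l i k (by tauto)]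
        simp
      push Not at h
      simp only [hg]
      have e1 : D k l i = D i k l := by rw [hD2 i l k, hD1 i k l, neg_neg]
      have e2 : D l i k = D i k l := by rw [hD1 l k i, hD2 i k l, neg_neg]
      rw [e1, e2, ← add_smul, ← add_smul]
      convert zero_smul ℂ (D i k l) using 2
      -- the identity between scalars that remains is Arnold's relation
      simp only [ha, hb]
      have h1 : z i - z k ≠ 0 := sub_ne_zero.2 (hz.ne h.1)
      have h2 : z i - z l ≠ 0 := sub_ne_zero.2 (hz.ne h.2.1)
      have h3 : z k - z l ≠ 0 := sub_ne_zero.2 (hz.ne h.2.2)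
      rw [← neg_sub (z i) (z l), ← neg_sub (z i) (z k), ← neg_sub (z k) (z l)]
      field_simp
      ring
    have h3 : (3 : ℂ) • ∑ k, ∑ l, ∑ i, g k l i = 0 := by
      rw [← hz3, show (3 : ℂ) = 1 + 1 + 1 by norm_num, add_smul, add_smul, one_smul]
    exact (smul_eq_zero.1 h3).resolve_left (by norm_num)
  rw [← sub_eq_zero]
  have : (∑ i, ∑ j, a i j • B i j) * (∑ k, ∑ l, b k l • B k l) -
      (∑ k, ∑ l, b k l • B k l) * (∑ i, ∑ j, a i j • B i j) =
      (2 : ℂ) • ∑ k, ∑ l, ∑ i, (b k l * (a i k - a i l)) • D i k l := by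
    rw [Finset.mul_sum, Finset.sum_mul, ← Finset.sum_sub_distrib, Finset.smul_sum]
    refine Finset.sum_congr rfl fun k _ => ?_
    rw [Finset.mul_sum, Finset.sum_mul, ← Finset.sum_sub_distrib, Finset.smul_sum]
    refine Finset.sum_congr rfl fun l _ => ?_
    rw [mul_smul_comm, smul_mul_assoc, ← smul_sub, hcomm, smul_comm, Finset.smul_sum]
    simp only [smul_smul]
  rw [this, hsum, smul_zero]

/-- The sum over pairs `i < j` of a symmetric family is half of the full sum. -/
theorem sum_Ioi_add_sum_Ioi {M : Type*} [AddCommMonoid M] (f : Fin n → Fin n → M)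
    (hf : ∀ i j, f i j = f j i) (h0 : ∀ i, f i i = 0) :
    ∑ i, ∑ j ∈ Finset.Ioi i, f i j + ∑ i, ∑ j ∈ Finset.Ioi i, f i j = ∑ i, ∑ j, f i j := by
  have h1 : ∀ i, ∑ j ∈ Finset.Ioi i, f i j = ∑ j, if i < j then f i j else 0 := fun i => by
    rw [← Finset.sum_filter]; congr 1; ext; simp
  have h2 : ∑ i, ∑ j ∈ Finset.Ioi i, f i j = ∑ i, ∑ j, if j < i then f i j else 0 := by
    simp_rw [h1]
    rw [Finset.sum_comm]
    refine Finset.sum_congr rfl fun i _ => Finset.sum_congr rfl fun j _ => ?_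
    rw [hf]
  conv_lhs => enter [2]; rw [h2]
  simp_rw [h1, ← Finset.sum_add_distrib]
  refine Finset.sum_congr rfl fun i _ => Finset.sum_congr rfl fun j _ => ?_
  rcases lt_trichotomy i j with h | h | h
  · simp [h, h.not_gt]
  · subst h; simp [h0]
  · simp [h, h.not_gt]

/-- The form of `IsInfinitesimalBraid.commute` with sums over pairs `i < j`, where the diagonal
elements are irrelevant. -/
theorem IsInfinitesimalBraid.commute_Ioi {B : Fin n → Fin n → R} (hB : IsInfinitesimalBraid B)
    {z : Fin n → ℂ} (hz : Function.Injective z) (u v : Fin n → ℂ) :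
    (∑ i, ∑ j ∈ Finset.Ioi i, ((u i - u j) / (z i - z j)) • B i j) *
        (∑ i, ∑ j ∈ Finset.Ioi i, ((v i - v j) / (z i - z j)) • B i j)
      = (∑ i, ∑ j ∈ Finset.Ioi i, ((v i - v j) / (z i - z j)) • B i j) *
        (∑ i, ∑ j ∈ Finset.Ioi i, ((u i - u j) / (z i - z j)) • B i j) := by
  let B' : Fin n → Fin n → R := fun i j => if i = j then 0 else B i j
  have hB' : IsInfinitesimalBraid B' := by
    refine ⟨fun i j h => ?_, fun i j k l h1 h2 h3 h4 h5 h6 => ?_, fun i j k h1 h2 h3 => ?_⟩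
    · simp only [B']; rw [if_neg h, if_neg h.symm, hB.symm i j h]
    · simp only [B']; rw [if_neg h1, if_neg h2, hB.disj i j k l h1 h2 h3 h4 h5 h6]
    · simp only [B']; rw [if_neg h1, if_neg h2, if_neg h3, hB.tri i j k h1 h2 h3]
  have key : ∀ u : Fin n → ℂ, ∑ i, ∑ j, ((u i - u j) / (z i - z j)) • B' i j =
      (2 : ℂ) • ∑ i, ∑ j ∈ Finset.Ioi i, ((u i - u j) / (z i - z j)) • B i j := by
    intro u
    rw [← sum_Ioi_add_sum_Ioi (fun i j => ((u i - u j) / (z i - z j)) • B' i j), two_smul]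
    · have : ∀ i, ∑ j ∈ Finset.Ioi i, ((u i - u j) / (z i - z j)) • B' i j =
          ∑ j ∈ Finset.Ioi i, ((u i - u j) / (z i - z j)) • B i j := fun i =>
        Finset.sum_congr rfl fun j hj => by
          simp only [B']; rw [if_neg (Finset.mem_Ioi.1 hj).ne]
      simp_rw [this]
    · intro i j
      by_cases h : i = j
      · rw [h]
      · rw [hB'.symm i j h, ← neg_sub (u j), ← neg_sub (z j), neg_div_neg_eq]
    · intro i; simp
  have := hB'.commute (fun i => by simp [B']) hz u v
  rw [key, key, smul_mul_smul_comm, smul_mul_smul_comm] at this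
  exact smul_right_injective R (by norm_num : (2 * 2 : ℂ) ≠ 0) this

end Arnold

/-! ### Parallel sections with values in a subspace -/

section Transfer

variable {n : ℕ} {W : Type*} [AddCommGroup W] [Module ℂ W]

/-- `IsParallelAlong`, for a function into `X_n` that is not bundled as a path. -/
def IsParallelFun (A : Fin n → Fin n → Module.End ℂ W) (c : ℂ) (F : Submodule ℂ W)
    (γ : unitInterval → Conf n) (s : unitInterval → W) : Prop :=
  ∀ τ : unitInterval, ∃ (U : Set (Fin n → ℂ)) (f : (Fin n → ℂ) → W),
    IsOpen U ∧ U ⊆ {z | Function.Injective z} ∧ (γ τ).1 ∈ U ∧ IsHorizontalOn A c F U f ∧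
      ∀ᶠ τ' in 𝓝 τ, s τ' = f (γ τ').1

/-- The conditions under which `d - c ∑ d log (z_i - z_j) A_{ij}` is an integrable connection on the
trivial bundle with finite-dimensional fibre `F`. -/
structure IsFlatOn (A : Fin n → Fin n → Module.End ℂ W) (F : Submodule ℂ W) : Prop where
  finite : FiniteDimensional ℂ F
  mapsTo : ∀ i j, i ≠ j → ∀ v ∈ F, A i j v ∈ F
  symm : ∀ i j, i ≠ j → ∀ v ∈ F, A i j v = A j i v
  disj : ∀ i j k l, i ≠ j → k ≠ l → i ≠ k → i ≠ l → j ≠ k → j ≠ l → ∀ v ∈ F,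
    A i j (A k l v) = A k l (A i j v)
  tri : ∀ i j k, i ≠ j → i ≠ k → j ≠ k → ∀ v ∈ F,
    A i j (A i k v + A j k v) = A i k (A i j v) + A j k (A i j v)

variable {A : Fin n → Fin n → Module.End ℂ W} {c : ℂ} {F : Submodule ℂ W}

open Classical in
/-- The operator induced by `A i j` on `F`, set to `0` when `F` is not invariant. -/
def restrictOp (A : Fin n → Fin n → Module.End ℂ W) (F : Submodule ℂ W) (i j : Fin n) :
    Module.End ℂ F :=
  if h : ∀ v ∈ F, A i j v ∈ F then (A i j).restrict h else 0

theorem IsFlatOn.coe_restrictOp (hA : IsFlatOn A F) {i j : Fin n} (hij : i ≠ j) (v : F) :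
    (restrictOp A F i j v : W) = A i j v := by
  rw [restrictOp, dif_pos (hA.mapsTo i j hij), LinearMap.coe_restrict_apply]

theorem IsFlatOn.isInfinitesimalBraid (hA : IsFlatOn A F) :
    IsInfinitesimalBraid (restrictOp A F) := by
  refine ⟨fun i j h => ?_, fun i j k l h1 h2 h3 h4 h5 h6 => ?_, fun i j k h1 h2 h3 => ?_⟩
  · ext v
    rw [hA.coe_restrictOp h, hA.coe_restrictOp h.symm, hA.symm i j h v v.2]
  · ext v
    simp only [Module.End.mul_apply]
    rw [hA.coe_restrictOp h1, hA.coe_restrictOp h2, hA.coe_restrictOp h2, hA.coe_restrictOp h1,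
      hA.disj i j k l h1 h2 h3 h4 h5 h6 v v.2]
  · ext v
    simp only [Module.End.mul_apply, LinearMap.add_apply, Submodule.coe_add]
    rw [hA.coe_restrictOp h1, hA.coe_restrictOp h2, hA.coe_restrictOp h3, Submodule.coe_add,
      hA.coe_restrictOp h1, hA.coe_restrictOp h2, hA.coe_restrictOp h3, hA.tri i j k h1 h2 h3 v v.2]

/-- The operators on `F`, in coordinates. -/
def coordOp (A : Fin n → Fin n → Module.End ℂ W) {d : ℕ} (e : F ≃ₗ[ℂ] (Fin d → ℂ)) (i j : Fin n) :
    (Fin d → ℂ) →L[ℂ] (Fin d → ℂ) :=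
  LinearMap.toContinuousLinearMap (e.toLinearMap ∘ₗ restrictOp A F i j ∘ₗ e.symm.toLinearMap)

theorem coordOp_apply {d : ℕ} (e : F ≃ₗ[ℂ] (Fin d → ℂ)) (i j : Fin n) (v : Fin d → ℂ) :
    coordOp A e i j v = e (restrictOp A F i j (e.symm v)) := rfl

theorem IsFlatOn.isFlat (hA : IsFlatOn A F) {d : ℕ} (e : F ≃ₗ[ℂ] (Fin d → ℂ)) (c : ℂ) :
    IsFlat (coordOp A e) c := by
  intro z hz u v w
  have hform : ∀ (u : Fin n → ℂ) (w : Fin d → ℂ), logForm (coordOp A e) c z u w =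
      e ((c • ∑ i, ∑ j ∈ Finset.Ioi i, ((u i - u j) / (z i - z j)) • restrictOp A F i j)
        (e.symm w)) := by
    intro u w
    rw [logForm_apply]
    simp only [LinearMap.smul_apply, LinearMap.sum_apply, map_smul, map_sum, coordOp_apply,
      Finset.smul_sum, mul_smul]
  have h := hA.isInfinitesimalBraid.commute_Ioi hz u v
  rw [hform, hform, hform, hform, e.symm_apply_apply, e.symm_apply_apply, ← Module.End.mul_apply,
    ← Module.End.mul_apply, smul_mul_smul_comm, smul_mul_smul_comm, h]

/-- Horizontal sections in coordinates give horizontal sections with values in `F`, in the weak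
sense of `IsHorizontalOn`. -/
theorem IsFlatOn.isHorizontalOn (hA : IsFlatOn A F) {d : ℕ} (e : F ≃ₗ[ℂ] (Fin d → ℂ))
    {U : Set (Fin n → ℂ)} {g : (Fin n → ℂ) → Fin d → ℂ} (hg : IsHorizontal (coordOp A e) c U g) :
    IsHorizontalOn A c F U (fun z => (e.symm (g z) : W)) := by
  refine fun z hz => ⟨(e.symm (g z)).2, fun φ => ?_⟩
  let ψ : (Fin d → ℂ) →L[ℂ] ℂ :=
    LinearMap.toContinuousLinearMap (φ ∘ₗ F.subtype ∘ₗ e.symm.toLinearMap)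
  have h := ψ.hasFDerivAt.comp z (hg z hz)
  refine h.congr_fderiv ?_
  refine ContinuousLinearMap.ext fun u => ?_
  have h1 : ∀ v : Fin d → ℂ, ψ v = φ (e.symm v : F) := fun _ => rfl
  simp only [ContinuousLinearMap.comp_apply, ContinuousLinearMap.flip_apply, logForm_apply,
    map_sum, map_smul, sum_apply, smul_apply, smul_eq_mul, h1, coordOp_apply,
    LinearEquiv.symm_apply_apply, Submodule.coe_sum, Submodule.coe_smul]
  refine Finset.sum_congr rfl fun i _ => Finset.sum_congr rfl fun j hj => ?_
  rw [hA.coe_restrictOp (Finset.mem_Ioi.1 hj).ne]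
  change _ = _ * (u i - u j)
  ring

/-- Conversely, a weakly horizontal section with values in `F` is horizontal in coordinates. -/
theorem IsFlatOn.isHorizontal (hA : IsFlatOn A F) {d : ℕ} (e : F ≃ₗ[ℂ] (Fin d → ℂ))
    {L : W →ₗ[ℂ] (Fin d → ℂ)} (hL : ∀ v : F, L v = e v)
    {U : Set (Fin n → ℂ)} {f : (Fin n → ℂ) → W} (hf : IsHorizontalOn A c F U f) :
    IsHorizontal (coordOp A e) c U (fun z => L (f z)) := by
  intro z hz
  obtain ⟨hfF, hφ⟩ := hf z hz
  rw [hasFDerivAt_pi']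
  intro k
  refine (hφ (LinearMap.proj k ∘ₗ L)).congr_fderiv ?_
  refine ContinuousLinearMap.ext fun u => ?_
  have h2 : e.symm (L (f z)) = ⟨f z, hfF⟩ := by
    rw [show L (f z) = e ⟨f z, hfF⟩ from hL ⟨f z, hfF⟩, e.symm_apply_apply]
  simp only [ContinuousLinearMap.comp_apply, ContinuousLinearMap.flip_apply, logForm_apply,
    map_sum, map_smul, sum_apply, smul_apply, smul_eq_mul, coordOp_apply, h2,
    ContinuousLinearMap.proj_apply, LinearMap.comp_apply, LinearMap.proj_apply]
  refine Finset.sum_congr rfl fun i _ => Finset.sum_congr rfl fun j hj => ?_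
  rw [← hA.coe_restrictOp (Finset.mem_Ioi.1 hj).ne ⟨f z, hfF⟩, hL]
  change _ * (u i - u j) = _
  ring

theorem IsParallelFun.mem {γ : unitInterval → Conf n} {s : unitInterval → W}
    (hs : IsParallelFun A c F γ s) (τ : unitInterval) : s τ ∈ F := by
  obtain ⟨U, f, -, -, hτ, hf, hsf⟩ := hs τ
  rw [hsf.self_of_nhds]
  exact (hf _ hτ).1

theorem IsFlatOn.isParallel (hA : IsFlatOn A F) {d : ℕ} (e : F ≃ₗ[ℂ] (Fin d → ℂ))
    {L : W →ₗ[ℂ] (Fin d → ℂ)} (hL : ∀ v : F, L v = e v) {γ : unitInterval → Conf n}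
    {s : unitInterval → W} (hs : IsParallelFun A c F γ s) :
    IsParallel (coordOp A e) c γ (fun τ => L (s τ)) := by
  intro τ
  obtain ⟨U, f, hU, -, hτ, hf, hsf⟩ := hs τ
  exact ⟨U, _, hU, hτ, hA.isHorizontal e hL hf, hsf.mono fun τ' h => congrArg L h⟩

/-- Coordinates on `F`, extended to the ambient space. -/
theorem IsFlatOn.exists_coord (hA : IsFlatOn A F) : ∃ (d : ℕ) (e : F ≃ₗ[ℂ] (Fin d → ℂ))
    (L : W →ₗ[ℂ] (Fin d → ℂ)), ∀ v : F, L v = e v := by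
  have := hA.finite
  let e := (Module.finBasis ℂ F).equivFun
  obtain ⟨L, hL⟩ := LinearMap.exists_extend e.toLinearMap
  exact ⟨_, e, L, fun v => LinearMap.congr_fun hL v⟩

theorem IsFlatOn.exists_isParallelFun (hA : IsFlatOn A F) (c : ℂ) {γ : unitInterval → Conf n}
    (hγ : Continuous γ) {v : W} (hv : v ∈ F) : ∃ s, IsParallelFun A c F γ s ∧ s 0 = v := by
  obtain ⟨d, e, -, -⟩ := hA.exists_coord
  obtain ⟨s, hs, h0⟩ := exists_isParallel (hA.isFlat e c) ⟨γ, hγ⟩ (e ⟨v, hv⟩)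
  refine ⟨fun τ => e.symm (s τ), fun τ => ?_, by simp [h0]⟩
  obtain ⟨U, f, hU, hτ, hf, hsf⟩ := hs τ
  refine ⟨U ∩ {z | Function.Injective z}, _, hU.inter isOpen_injective, Set.inter_subset_right,
    ⟨hτ, (γ τ).2⟩, hA.isHorizontalOn e (hf.mono Set.inter_subset_left), ?_⟩
  exact hsf.mono fun τ' h => congrArg (fun v => (e.symm v : W)) h

theorem IsParallelFun.eq_of_eq (hA : IsFlatOn A F) {γ : unitInterval → Conf n} (hγ : Continuous γ)
    {s s' : unitInterval → W} (hs : IsParallelFun A c F γ s) (hs' : IsParallelFun A c F γ s')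
    (h0 : s 0 = s' 0) (τ : unitInterval) : s τ = s' τ := by
  obtain ⟨d, e, L, hL⟩ := hA.exists_coord
  have h := (hA.isParallel e hL hs).eq_of_eq (hA.isFlat e c) hγ (hA.isParallel e hL hs')
    (congrArg L h0) τ
  have h1 := hL ⟨s τ, hs.mem τ⟩
  have h2 := hL ⟨s' τ, hs'.mem τ⟩
  exact congrArg Subtype.val (e.injective (h1.symm.trans (h.trans h2)))

theorem IsParallelFun.eq_of_homotopicRel (hA : IsFlatOn A F) {γ γ' : C(unitInterval, Conf n)}
    (h : γ.HomotopicRel γ' {0, 1}) {s s' : unitInterval → W} (hs : IsParallelFun A c F γ s)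
    (hs' : IsParallelFun A c F γ' s') (h0 : s 0 = s' 0) : s 1 = s' 1 := by
  obtain ⟨d, e, L, hL⟩ := hA.exists_coord
  have h := (hA.isParallel e hL hs).eq_of_homotopicRel (hA.isFlat e c) h (hA.isParallel e hL hs')
    (congrArg L h0)
  have h1 := hL ⟨s 1, hs.mem 1⟩
  have h2 := hL ⟨s' 1, hs'.mem 1⟩
  exact congrArg Subtype.val (e.injective (h1.symm.trans (h.trans h2)))

/-- Parallel sections can be reparametrised. -/
theorem IsParallelFun.comp {γ : unitInterval → Conf n} {s : unitInterval → W}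
    (hs : IsParallelFun A c F γ s) {φ : unitInterval → unitInterval} (hφ : Continuous φ) :
    IsParallelFun A c F (γ ∘ φ) (s ∘ φ) := by
  intro τ
  obtain ⟨U, f, hU, hUi, hτ, hf, hsf⟩ := hs (φ τ)
  exact ⟨U, f, hU, hUi, hτ, hf, hφ.continuousAt.eventually hsf⟩

theorem IsParallelFun.const {z : Conf n} (hA : IsFlatOn A F) {s : unitInterval → W}
    (hs : IsParallelFun A c F (fun _ => z) s) (τ : unitInterval) : s τ = s 0 :=
  hs.eq_of_eq hA continuous_const (hs.comp (φ := fun _ => 0) continuous_const) rfl τ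

theorem IsParallelFun.add {γ : unitInterval → Conf n} {s s' : unitInterval → W}
    (hs : IsParallelFun A c F γ s) (hs' : IsParallelFun A c F γ s') :
    IsParallelFun A c F γ (fun τ => s τ + s' τ) := by
  intro τ
  obtain ⟨U, f, hU, hUi, hτ, hf, hsf⟩ := hs τ
  obtain ⟨U', f', hU', -, hτ', hf', hsf'⟩ := hs' τ
  refine ⟨U ∩ U', fun z => f z + f' z, hU.inter hU', Set.inter_subset_left.trans hUi, ⟨hτ, hτ'⟩,
    fun z hz => ⟨F.add_mem (hf z hz.1).1 (hf' z hz.2).1, fun φ => ?_⟩, ?_⟩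
  · have h := ((hf z hz.1).2 φ).add ((hf' z hz.2).2 φ)
    simp only [map_add]
    refine h.congr_fderiv ?_
    simp only [← Finset.sum_add_distrib, ← add_smul, mul_add, add_div]
  · filter_upwards [hsf, hsf'] with τ' h1 h2
    rw [h1, h2]

theorem IsParallelFun.smul {γ : unitInterval → Conf n} {s : unitInterval → W}
    (hs : IsParallelFun A c F γ s) (a : ℂ) : IsParallelFun A c F γ (fun τ => a • s τ) := by
  intro τ
  obtain ⟨U, f, hU, hUi, hτ, hf, hsf⟩ := hs τ
  refine ⟨U, fun z => a • f z, hU, hUi, hτ, fun z hz =>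
    ⟨F.smul_mem _ (hf z hz).1, fun φ => ?_⟩, hsf.mono fun τ' h => congrArg (a • ·) h⟩
  have h := ((hf z hz).2 φ).const_mul a
  simp only [map_smul, smul_eq_mul]
  refine h.congr_fderiv ?_
  simp only [Finset.smul_sum, smul_smul]
  refine Finset.sum_congr rfl fun i _ => Finset.sum_congr rfl fun j hj => ?_
  congr 1
  ring

/-- A sum over pairs `i < j` of a symmetric function is invariant under permutations. -/
theorem sum_Ioi_comp_perm (w : Equiv.Perm (Fin n)) (g : Fin n → Fin n → ℂ)
    (hg : ∀ i j, g i j = g j i) (h0 : ∀ i, g i i = 0) :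
    ∑ i, ∑ j ∈ Finset.Ioi i, g (w i) (w j) = ∑ i, ∑ j ∈ Finset.Ioi i, g i j := by
  have h1 : ∑ i, ∑ j, g (w i) (w j) = ∑ i, ∑ j, g i j := by
    rw [← Equiv.sum_comp w (fun i => ∑ j, g i j)]
    exact Finset.sum_congr rfl fun i _ => Equiv.sum_comp w (fun j => g (w i) j)
  have h2 := sum_Ioi_add_sum_Ioi (fun i j => g (w i) (w j)) (fun i j => hg _ _) (fun i => h0 _)
  rw [h1, ← sum_Ioi_add_sum_Ioi g hg h0, ← two_mul, ← two_mul] at h2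
  exact mul_left_cancel₀ two_ne_zero h2

/-- Naturality of parallel transport: a linear map `T` that intertwines the operators `A i j` and
`A' (w i) (w j)` takes parallel sections along `γ` to parallel sections along `w • γ`. -/
theorem IsParallelFun.map {W' : Type*} [AddCommGroup W'] [Module ℂ W']
    {A' : Fin n → Fin n → Module.End ℂ W'} {F' : Submodule ℂ W'}
    {γ : unitInterval → Conf n} {s : unitInterval → W} (hs : IsParallelFun A c F γ s)
    (w : Equiv.Perm (Fin n)) (T : W →ₗ[ℂ] W') (hTF : ∀ v ∈ F, T v ∈ F')
    (hT : ∀ i j, i ≠ j → ∀ v ∈ F, T (A i j v) = A' (w i) (w j) (T v))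
    (hsymm : ∀ i j, i ≠ j → ∀ v ∈ F', A' i j v = A' j i v) :
    IsParallelFun A' c F' (fun τ => w • γ τ) (fun τ => T (s τ)) := by
  intro τ
  obtain ⟨U, f, hU, hUi, hτ, hf, hsf⟩ := hs τ
  let p : (Fin n → ℂ) →L[ℂ] (Fin n → ℂ) := ContinuousLinearMap.pi fun i =>
    ContinuousLinearMap.proj (w i)
  have hp : ∀ z i, p z i = z (w i) := fun _ _ => rfl
  have hpw : ∀ z : Conf n, p (w • z).1 = z.1 := fun z => funext fun i => by
    rw [hp]
    exact congrArg z.1 (w.symm_apply_apply i)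
  refine ⟨p ⁻¹' U, fun z => T (f (p z)), hU.preimage p.continuous, fun z hz => ?_, ?_,
    fun z hz => ⟨hTF _ (hf _ hz).1, fun φ => ?_⟩, hsf.mono fun τ' h => (congrArg T h).trans
      (congrArg (fun y => T (f y)) (hpw _).symm)⟩
  · have : Function.Injective (p z) := hUi hz
    intro a b hab
    have := @this (w.symm a) (w.symm b) (by
      rw [hp, hp, w.apply_symm_apply, w.apply_symm_apply, hab])
    exact w.symm.injective this
  · rw [Set.mem_preimage, hpw]; exact hτ
  · obtain ⟨hF, hd⟩ := hf _ hz
    have h := (hd (φ ∘ₗ T)).comp z p.hasFDerivAt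
    refine h.congr_fderiv ?_
    refine ContinuousLinearMap.ext fun u => ?_
    simp only [ContinuousLinearMap.comp_apply, sum_apply, smul_apply, smul_eq_mul,
      LinearMap.comp_apply]
    change ∑ i, ∑ j ∈ Finset.Ioi i, _ / (z (w i) - z (w j)) * (u (w i) - u (w j)) =
      ∑ i, ∑ j ∈ Finset.Ioi i, _ * (u i - u j)
    -- both sums are symmetrised, and then reindexed by `w`
    set g : Fin n → Fin n → ℂ := fun i j => if i = j then 0 else
      c * φ (A' i j (T (f (p z)))) / (z i - z j) * (u i - u j) with hg
    have hgs : ∀ i j, g i j = g j i := by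
      intro i j
      by_cases hij : i = j
      · rw [hij]
      simp only [hg]
      rw [if_neg hij, if_neg (Ne.symm hij), hsymm i j hij _ (hTF _ hF), ← neg_sub (u j),
        ← neg_sub (z j), div_neg, neg_mul_neg]
    have h0 : ∀ i, g i i = 0 := fun i => if_pos rfl
    have e1 : ∑ i, ∑ j ∈ Finset.Ioi i, c * φ (T (A i j (f (p z)))) / (z (w i) - z (w j)) *
        (u (w i) - u (w j)) = ∑ i, ∑ j ∈ Finset.Ioi i, g (w i) (w j) := by
      refine Finset.sum_congr rfl fun i _ => Finset.sum_congr rfl fun j hj => ?_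
      have hij := (Finset.mem_Ioi.1 hj).ne
      simp only [hg]
      rw [if_neg (w.injective.ne hij), hT i j hij _ hF]
    have e2 : ∑ i, ∑ j ∈ Finset.Ioi i, c * φ (A' i j (T (f (p z)))) / (z i - z j) *
        (u i - u j) = ∑ i, ∑ j ∈ Finset.Ioi i, g i j := by
      refine Finset.sum_congr rfl fun i _ => Finset.sum_congr rfl fun j hj => ?_
      simp only [hg]
      rw [if_neg (Finset.mem_Ioi.1 hj).ne]
    exact e1.trans ((sum_Ioi_comp_perm w g hgs h0).trans e2.symm)

end Transfer

/-! ### The braid group -/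

section Braid

variable {n : ℕ}

theorem Conf.smul_val (w : Equiv.Perm (Fin n)) (z : Conf n) (i : Fin n) :
    (w • z).1 i = z.1 (w⁻¹ i) := rfl

instance : T2Space (Conf n) := inferInstanceAs (T2Space {z : Fin n → ℂ // Function.Injective z})

instance : LocallyCompactSpace (Conf n) :=
  (isOpen_injective (n := n)).isOpenEmbedding_subtypeVal.locallyCompactSpace

instance : ContinuousConstSMul (Equiv.Perm (Fin n)) (Conf n) :=
  ⟨fun w => by
    have h : Continuous fun z : {z : Fin n → ℂ // Function.Injective z} => fun i => z.1 (w⁻¹ i) :=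
      continuous_pi fun i => (continuous_apply (w⁻¹ i)).comp continuous_subtype_val
    exact h.subtype_mk fun z => z.2.comp (w⁻¹).injective⟩

instance : IsCancelSMul (Equiv.Perm (Fin n)) (Conf n) where
  left_cancel' w z z' h := smul_left_cancel w h
  right_cancel' w w' z h := by
    have : ∀ i, w⁻¹ i = w'⁻¹ i := fun i =>
      z.2 (congrFun (congrArg (Subtype.val (p := Function.Injective)) h) i)
    exact inv_injective (Equiv.ext this)

theorem isCoveringMap_toUConf : IsCoveringMap (toUConf (n := n)) :=
  (isQuotientCoveringMap_quotientMk_of_properlyDiscontinuousSMul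
    (G := Equiv.Perm (Fin n)) (E := Conf n)).isCoveringMap

theorem exists_smul_of_toUConf_eq {z z' : Conf n} (h : toUConf z = toUConf z') :
    ∃ w : Equiv.Perm (Fin n), w • z' = z :=
  MulAction.orbitRel_apply.1 (Quotient.exact h)

/-- Every braid lifts to a path in `X_n`. -/
theorem exists_braidOf {z : Conf n} (b : BraidGroup z) :
    ∃ (w : Equiv.Perm (Fin n)) (γ : Path z (w⁻¹ • z)), b = braidOf w γ := by
  obtain ⟨p, rfl⟩ : ∃ p : Path (toUConf z) (toUConf z), FundamentalGroup.fromPath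
    (Path.Homotopic.Quotient.mk p) = b := ⟨Quotient.out b, Quotient.out_eq b⟩
  have h0 : (p : C(unitInterval, UConf n)) 0 = toUConf z := p.source
  let Γ := isCoveringMap_toUConf.liftPath (p : C(unitInterval, UConf n)) z h0
  have hΓ : ∀ τ, toUConf (Γ τ) = p τ := fun τ =>
    congrFun (isCoveringMap_toUConf.liftPath_lifts (p : C(unitInterval, UConf n)) z h0) τ
  obtain ⟨w, hw⟩ := exists_smul_of_toUConf_eq ((hΓ 1).trans p.target)
  refine ⟨w⁻¹, ⟨Γ, isCoveringMap_toUConf.liftPath_zero _ _ h0, by rw [inv_inv]; exact hw.symm⟩, ?_⟩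
  refine congrArg (fun q => FundamentalGroup.fromPath (Path.Homotopic.Quotient.mk q)) ?_
  exact Path.ext (funext fun τ => (hΓ τ).symm)

/-- The permutation of a braid, and its lift to a path in `X_n` that starts at `z` up to homotopy,
are uniquely determined. -/
theorem eq_and_homotopicRel_of_braidOf_eq {z : Conf n} {w w' : Equiv.Perm (Fin n)}
    {γ : Path z (w⁻¹ • z)} {γ' : Path z (w'⁻¹ • z)} (h : braidOf w γ = braidOf w' γ') :
    w = w' ∧ (γ : C(unitInterval, Conf n)).HomotopicRel (γ' : C(unitInterval, Conf n)) {0, 1} := by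
  have h1 := Path.Homotopic.Quotient.exact h
  have h0 : ∀ {w : Equiv.Perm (Fin n)} (γ : Path z (w⁻¹ • z)), (ContinuousMap.comp
      ⟨toUConf, continuous_toUConf⟩ (γ : C(unitInterval, Conf n))) 0 = toUConf z := fun γ => by
    simp
  have h2 : (ContinuousMap.comp ⟨toUConf, continuous_toUConf⟩
      (γ : C(unitInterval, Conf n))).HomotopicRel (ContinuousMap.comp ⟨toUConf, continuous_toUConf⟩
        (γ' : C(unitInterval, Conf n))) {0, 1} := h1
  constructor
  · have h3 := isCoveringMap_toUConf.liftPath_apply_one_eq_of_homotopicRel h2 z (h0 γ) (h0 γ')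
    have e1 : ∀ {w : Equiv.Perm (Fin n)} (γ : Path z (w⁻¹ • z)),
        (γ : C(unitInterval, Conf n)) = isCoveringMap_toUConf.liftPath _ z (h0 γ) := fun γ =>
      (isCoveringMap_toUConf.eq_liftPath_iff' (h0 γ)).2 ⟨rfl, γ.source⟩
    rw [← e1 γ, ← e1 γ'] at h3
    have h4 : w⁻¹ • z = w'⁻¹ • z := by
      rw [← γ.target, ← γ'.target]; exact h3
    exact inv_injective (IsCancelSMul.right_cancel _ _ _ h4)
  · exact (isCoveringMap_toUConf.homotopicRel_iff_comp
      ⟨0, by simp, by simp⟩).2 h2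

/-- The lift of a product of two loops: the second lift, followed by the translate of the first one.
The product of braids is composition from right to left. -/
def mulPath {z : Conf n} {w w' : Equiv.Perm (Fin n)} (γ : Path z (w⁻¹ • z))
    (γ' : Path z (w'⁻¹ • z)) : Path z ((w * w')⁻¹ • z) :=
  (γ'.trans (γ.map (continuous_const_smul w'⁻¹))).cast rfl (by rw [mul_inv_rev, mul_smul])

theorem braidOf_mul_braidOf {z : Conf n} {w w' : Equiv.Perm (Fin n)} (γ : Path z (w⁻¹ • z))
    (γ' : Path z (w'⁻¹ • z)) : braidOf w γ * braidOf w' γ' = braidOf (w * w') (mulPath γ γ') := by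
  rw [FundamentalGroup.mul_def]
  refine congrArg Path.Homotopic.Quotient.mk (Path.ext (funext fun τ => ?_))
  simp only [mulPath, Path.cast_coe, Path.map_coe, Function.comp_apply, Path.trans_apply]
  split_ifs
  · rfl
  · simp [toUConf_smul]

/-- The constant path represents the unit of the braid group. -/
def onePath (z : Conf n) : Path z ((1 : Equiv.Perm (Fin n))⁻¹ • z) :=
  (Path.refl z).cast rfl (by rw [inv_one, one_smul])

theorem braidOf_one (z : Conf n) : braidOf 1 (onePath z) = 1 := by
  rw [FundamentalGroup.one_def]
  exact congrArg Path.Homotopic.Quotient.mk (Path.ext (funext fun τ => rfl))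

end Braid

/-! ### Monodromy representations -/

section Monodromy

variable {n : ℕ} {W : Type*} [AddCommGroup W] [Module ℂ W]
  {A : Fin n → Fin n → Module.End ℂ W} {F : Submodule ℂ W} {z : Conf n}

/-- Existence and uniqueness of the monodromy representation of an integrable connection that is
equivariant with respect to the action `θ` on the fibre. The action may depend on the braid and on
its permutation, as it does through the lift to the normaliser of the torus. -/
theorem exists_forall_isMonodromy_iff (hA : IsFlatOn A F) (c : ℂ)
    (θ : BraidGroup z × Equiv.Perm (Fin n) →* Module.End ℂ W)
    (hθF : ∀ p, ∀ v ∈ F, θ p v ∈ F)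
    (hθ : ∀ (w : Equiv.Perm (Fin n)) (γ : Path z (w⁻¹ • z)) (i j : Fin n), i ≠ j → ∀ v ∈ F,
      θ (braidOf w γ, w) (A i j v) = A (w i) (w j) (θ (braidOf w γ, w) v)) :
    ∃ π₀ : BraidGroup z →* (F ≃ₗ[ℂ] F), ∀ π,
      IsMonodromy A c F (fun b w v => θ (b, w) v) π ↔ π = π₀ := by
  -- transport along a lift of `b` does not depend on the lift
  have key : ∀ b : BraidGroup z, ∃ T : Module.End ℂ F, ∀ (w : Equiv.Perm (Fin n))
      (γ : Path z (w⁻¹ • z)) (s : unitInterval → W), b = braidOf w γ →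
      ∀ hs : IsParallelFun A c F γ s, (T ⟨s 0, hs.mem 0⟩ : W) = θ (b, w) (s 1) := by
    intro b
    obtain ⟨w₀, γ₀, hb⟩ := exists_braidOf b
    choose s hs hs0 using fun v : F => hA.exists_isParallelFun c γ₀.continuous v.2
    let T : Module.End ℂ F :=
      { toFun := fun v => ⟨θ (b, w₀) (s v 1), hθF _ _ ((hs v).mem 1)⟩
        map_add' := fun u v => by
          have := (hs (u + v)).eq_of_eq hA γ₀.continuous ((hs u).add (hs v))
            (by rw [hs0, hs0, hs0]; rfl) 1
          ext1
          simp [this]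
        map_smul' := fun a v => by
          have := (hs (a • v)).eq_of_eq hA γ₀.continuous ((hs v).smul a)
            (by rw [hs0, hs0]; rfl) 1
          ext1
          simp [this] }
    refine ⟨T, fun w γ s' hb' hs' => ?_⟩
    obtain ⟨rfl, hh⟩ := eq_and_homotopicRel_of_braidOf_eq (hb.symm.trans hb')
    change θ (b, w₀) (s _ 1) = _
    rw [IsParallelFun.eq_of_homotopicRel hA hh (hs ⟨s' 0, hs'.mem 0⟩) hs' (hs0 _)]
  choose T hT using key
  have hT' : ∀ (w : Equiv.Perm (Fin n)) (γ : Path z (w⁻¹ • z)) (s : unitInterval → W)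
      (v : F), IsParallelFun A c F γ s → s 0 = v →
      (T (braidOf w γ) v : W) = θ (braidOf w γ, w) (s 1) := by
    intro w γ s v hs h0
    rw [← hT (braidOf w γ) w γ s rfl hs]
    congr 2
    exact Subtype.ext h0.symm
  have hT1 : T 1 = 1 := by
    ext v
    obtain ⟨s, hs, h0⟩ := hA.exists_isParallelFun c (onePath z).continuous v.2
    rw [← braidOf_one, hT' 1 (onePath z) s v hs h0, braidOf_one]
    have : s 1 = s 0 := IsParallelFun.const hA (z := z) hs 1
    rw [this, h0, show ((1 : BraidGroup z), (1 : Equiv.Perm (Fin n))) = 1 from rfl, map_one]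
    rfl
  have hTmul : ∀ b b', T (b * b') = T b * T b' := by
    intro b b'
    obtain ⟨w, γ, rfl⟩ := exists_braidOf b
    obtain ⟨w', γ', rfl⟩ := exists_braidOf b'
    ext v
    obtain ⟨S, hS, h0⟩ := hA.exists_isParallelFun c (mulPath γ γ').continuous v.2
    -- the two halves of a parallel section along the lift of a product are parallel sections along
    -- the lift of the second factor and along a translate of the lift of the first factor
    let φ₁ : unitInterval → unitInterval := fun τ => ⟨τ / 2, by
      constructor <;> linarith [τ.2.1, τ.2.2]⟩
    let φ₂ : unitInterval → unitInterval := fun τ => ⟨(1 + τ) / 2, by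
      constructor <;> linarith [τ.2.1, τ.2.2]⟩
    have hφ₁ : Continuous φ₁ := by fun_prop
    have hφ₂ : Continuous φ₂ := by fun_prop
    have e1 : mulPath γ γ' ∘ φ₁ = γ' := by
      funext τ
      have : (τ / 2 : ℝ) ≤ 1 / 2 := by linarith [τ.2.2]
      simp only [mulPath, Function.comp_apply, Path.cast_coe, Path.trans_apply, φ₁, this, dif_pos]
      congr 1
      exact Subtype.ext (by simp; ring)
    have e2 : mulPath γ γ' ∘ φ₂ = fun τ => w'⁻¹ • γ τ := by
      funext τ
      simp only [mulPath, Function.comp_apply, Path.cast_coe, Path.trans_apply, φ₂]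
      split_ifs with h
      · have h3 : (τ : ℝ) = 0 := le_antisymm (by linarith) τ.2.1
        have h4 : τ = 0 := Subtype.ext h3
        subst h4
        rw [γ.source]
        convert! γ'.target
        simp
      · simp only [Path.map_coe, Function.comp_apply]
        congr 2
        exact Subtype.ext (by simp; ring)
    have h1 := hS.comp hφ₁
    rw [e1] at h1
    have h2 := hS.comp hφ₂
    rw [e2] at h2
    have h3 := h2.map (F' := F) (A' := A) w' (θ (braidOf w' γ', w')) (hθF _) (hθ w' γ') hA.symm
    have e3 : (fun τ => w' • w'⁻¹ • γ τ) = γ := funext fun τ => smul_inv_smul _ _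
    rw [e3] at h3
    have f0 : φ₁ 0 = 0 := Subtype.ext (by simp [φ₁])
    have f1 : φ₁ 1 = φ₂ 0 := Subtype.ext (by simp [φ₁, φ₂])
    have f2 : φ₂ 1 = 1 := Subtype.ext (by simp [φ₂])
    have r1 := hT' w' γ' _ v h1 (by rw [Function.comp_apply, f0, h0])
    have r2 := hT' w γ _ (T (braidOf w' γ') v) h3 (by
      rw [r1, Function.comp_apply, Function.comp_apply, f1])
    have r3 := hT' (w * w') (mulPath γ γ') S v hS h0
    rw [braidOf_mul_braidOf, r3, Module.End.mul_apply, r2, Function.comp_apply, f2,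
      ← Module.End.mul_apply, ← map_mul, Prod.mk_mul_mk, braidOf_mul_braidOf]
  let Φ : BraidGroup z →* Module.End ℂ F :=
    { toFun := T, map_one' := hT1, map_mul' := hTmul }
  let π₀ : BraidGroup z →* (F ≃ₗ[ℂ] F) :=
    (LinearMap.GeneralLinearGroup.generalLinearEquiv ℂ F).toMonoidHom.comp Φ.toHomUnits
  have hπ₀ : ∀ b v, π₀ b v = T b v := fun b v => rfl
  refine ⟨π₀, fun π => ⟨fun hπ => ?_, ?_⟩⟩
  · ext b v
    obtain ⟨w, γ, rfl⟩ := exists_braidOf b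
    obtain ⟨s, hs, h0, h1⟩ := hπ w γ v
    rw [h1, hπ₀, hT' w γ s v hs h0]
  · rintro rfl w γ v
    obtain ⟨s, hs, h0⟩ := hA.exists_isParallelFun c γ.continuous v.2
    exact ⟨s, hs, h0, by rw [hπ₀, hT' w γ s v hs h0]⟩

end Monodromy

/-! ### The relations of `𝔤𝔩_n` and the truncated Casimir operators -/

section GlRelations

variable {n : ℕ} {R : Type*} [Ring R]

/-- The elements `E i j` satisfy the commutation relations of the elementary matrices. -/
def IsGlAction (E : Fin n → Fin n → R) : Prop :=
  ∀ i j k l, E i j * E k l - E k l * E i j =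
    (if j = k then E i l else 0) - (if l = i then E k j else 0)

variable {E : Fin n → Fin n → R}

theorem commute_add_of_bracket {x a b a' b' : R} (ha : x * a - a * x = a')
    (hb : x * b - b * x = b') : x * (a * b) - (a * b) * x = a' * b + a * b' := by
  rw [← ha, ← hb]; noncomm_ring

/-- The truncated Casimir element `E i j * E j i + E j i * E i j`. -/
def casimir (E : Fin n → Fin n → R) (i j : Fin n) : R := E i j * E j i + E j i * E i j

theorem casimir_symm (i j : Fin n) : casimir E i j = casimir E j i := add_comm _ _

namespace IsGlAction

variable (hE : IsGlAction E)
include hE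

theorem diag_comm (i j : Fin n) : E i i * E j j = E j j * E i i := by
  have := hE i i j j
  by_cases h : i = j
  · rw [h]
  · rw [if_neg h, if_neg (Ne.symm h), sub_zero] at this
    exact sub_eq_zero.1 this

theorem commute_of_ne {i j k l : Fin n} (h1 : j ≠ k) (h2 : l ≠ i) : Commute (E i j) (E k l) := by
  have := hE i j k l
  rw [if_neg h1, if_neg h2, sub_zero] at this
  exact sub_eq_zero.1 this

theorem diag_casimir_comm (a : Fin n) {i j : Fin n} (hij : i ≠ j) :
    Commute (E a a) (casimir E i j) := by
  have h1 := commute_add_of_bracket (hE a a i j) (hE a a j i)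
  have h2 := commute_add_of_bracket (hE a a j i) (hE a a i j)
  have : E a a * casimir E i j - casimir E i j * E a a = 0 := by
    unfold casimir
    rw [mul_add, add_mul, add_sub_add_comm, h1, h2]
    by_cases h3 : a = i
    · subst h3; simp [hij, hij.symm]
    by_cases h4 : a = j
    · subst h4; simp [hij, hij.symm]
    simp [h3, h4, Ne.symm h3, Ne.symm h4]
  exact sub_eq_zero.1 this

theorem casimir_disj {i j k l : Fin n} (h1 : i ≠ k) (h2 : i ≠ l) (h3 : j ≠ k) (h4 : j ≠ l) :
    Commute (casimir E i j) (casimir E k l) := by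
  have c1 : Commute (E i j) (casimir E k l) :=
    ((hE.commute_of_ne h3 h2.symm).mul_right (hE.commute_of_ne h4 h1.symm)).add_right
      ((hE.commute_of_ne h4 h1.symm).mul_right (hE.commute_of_ne h3 h2.symm))
  have c2 : Commute (E j i) (casimir E k l) :=
    ((hE.commute_of_ne h1 h4.symm).mul_right (hE.commute_of_ne h2 h3.symm)).add_right
      ((hE.commute_of_ne h2 h3.symm).mul_right (hE.commute_of_ne h1 h4.symm))
  exact (c1.mul_left c2).add_left (c2.mul_left c1)

/-- `E i j` commutes with the Casimir element of the copy of `𝔤𝔩_3` with indices `i`, `j`, `k`. -/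
theorem commute_casimir_three {i j k : Fin n} (hij : i ≠ j) (hik : i ≠ k) (hjk : j ≠ k) :
    Commute (E i j) (casimir E i j + (casimir E i k + casimir E j k) +
      (E i i * E i i + E j j * E j j + E k k * E k k)) := by
  have hji := hij.symm
  have hki := hik.symm
  have b1 := commute_add_of_bracket (hE i j i j) (hE i j j i)
  have b2 := commute_add_of_bracket (hE i j j i) (hE i j i j)
  have b3 := commute_add_of_bracket (hE i j i k) (hE i j k i)
  have b4 := commute_add_of_bracket (hE i j k i) (hE i j i k)
  have b5 := commute_add_of_bracket (hE i j j k) (hE i j k j)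
  have b6 := commute_add_of_bracket (hE i j k j) (hE i j j k)
  have b7 := commute_add_of_bracket (hE i j i i) (hE i j i i)
  have b8 := commute_add_of_bracket (hE i j j j) (hE i j j j)
  have b9 := commute_add_of_bracket (hE i j k k) (hE i j k k)
  simp only [hjk, hji, hki, if_true, if_false, sub_zero, zero_sub, sub_self,
    zero_mul, mul_zero, zero_add, add_zero, neg_mul, mul_neg] at b1 b2 b3 b4 b5 b6 b7 b8 b9
  have : E i j * (casimir E i j + (casimir E i k + casimir E j k) +
      (E i i * E i i + E j j * E j j + E k k * E k k)) -
      (casimir E i j + (casimir E i k + casimir E j k) +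
      (E i i * E i i + E j j * E j j + E k k * E k k)) * E i j =
      (E i j * (E i j * E j i) - (E i j * E j i) * E i j) +
      (E i j * (E j i * E i j) - (E j i * E i j) * E i j) +
      (E i j * (E i k * E k i) - (E i k * E k i) * E i j) +
      (E i j * (E k i * E i k) - (E k i * E i k) * E i j) +
      (E i j * (E j k * E k j) - (E j k * E k j) * E i j) +
      (E i j * (E k j * E j k) - (E k j * E j k) * E i j) +
      (E i j * (E i i * E i i) - (E i i * E i i) * E i j) +
      (E i j * (E j j * E j j) - (E j j * E j j) * E i j) +
      (E i j * (E k k * E k k) - (E k k * E k k) * E i j) := by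
    unfold casimir; noncomm_ring
  refine sub_eq_zero.1 (this.trans ?_)
  rw [b1, b2, b3, b4, b5, b6, b7, b8, b9]
  noncomm_ring

/-- The three-term relation holds because the Casimir element of `𝔤𝔩_3` is central. -/
theorem casimir_tri {i j k : Fin n} (hij : i ≠ j) (hik : i ≠ k) (hjk : j ≠ k) :
    Commute (casimir E i j) (casimir E i k + casimir E j k) := by
  set S := casimir E i j + (casimir E i k + casimir E j k) +
    (E i i * E i i + E j j * E j j + E k k * E k k) with hS
  have h1 : Commute (E i j) S := hE.commute_casimir_three hij hik hjk
  have h2 : Commute (E j i) S := by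
    have := hE.commute_casimir_three hij.symm hjk hik
    rw [casimir_symm j i, add_comm (casimir E j k), add_comm (E j j * E j j)] at this
    exact this
  have h3 : Commute (casimir E i j) S := (h1.mul_left h2).add_left (h2.mul_left h1)
  have h4 : ∀ a, Commute (casimir E i j) (E a a) := fun a => (hE.diag_casimir_comm a hij).symm
  have h5 : casimir E i k + casimir E j k =
      S - casimir E i j - (E i i * E i i + E j j * E j j + E k k * E k k) := by
    rw [hS]; abel
  rw [h5]
  exact (h3.sub_right (Commute.refl _)).sub_right
    ((((h4 i).mul_right (h4 i)).add_right ((h4 j).mul_right (h4 j))).add_right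
      ((h4 k).mul_right (h4 k)))

/-- The truncated Casimir elements satisfy the infinitesimal braid relations. -/
theorem isInfinitesimalBraid_casimir [Algebra ℂ R] : IsInfinitesimalBraid (casimir E) :=
  ⟨fun i j _ => casimir_symm i j, fun _ _ _ _ _ _ h3 h4 h5 h6 => hE.casimir_disj h3 h4 h5 h6,
    fun _ _ _ h1 h2 h3 => hE.casimir_tri h1 h2 h3⟩

/-- The infinitesimal braid relations persist when the truncated Casimir elements are shifted by
polynomials in the diagonal elements. -/
theorem isInfinitesimalBraid_sub [Algebra ℂ R] {D : Fin n → Fin n → R}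
    (hDs : ∀ i j, i ≠ j → D i j = D j i)
    (hD : ∀ i j x, (∀ a, Commute (E a a) x) → Commute (D i j) x) :
    IsInfinitesimalBraid (fun i j => casimir E i j - D i j) := by
  have hDD : ∀ i j k l, Commute (D i j) (D k l) := fun i j k l =>
    hD i j _ fun a => (hD k l _ fun b => hE.diag_comm b a).symm
  have hDC : ∀ i j k l, k ≠ l → Commute (D i j) (casimir E k l) := fun i j k l h =>
    hD i j _ fun a => hE.diag_casimir_comm a h
  refine ⟨fun i j h => by rw [casimir_symm, hDs i j h], fun i j k l h1 h2 h3 h4 h5 h6 => ?_,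
    fun i j k h1 h2 h3 => ?_⟩
  · exact ((hE.casimir_disj h3 h4 h5 h6).sub_right (hDC k l i j h1).symm).sub_left
      ((hDC i j k l h2).sub_right (hDD i j k l))
  · have : casimir E i k - D i k + (casimir E j k - D j k) =
      casimir E i k + casimir E j k - (D i k + D j k) := by abel
    change Commute (casimir E i j - D i j) (casimir E i k - D i k + (casimir E j k - D j k))
    rw [this]
    exact ((hE.casimir_tri h1 h2 h3).sub_right
      ((hDC i k i j h1).symm.add_right (hDC j k i j h1).symm)).sub_left
      (((hDC i j i k h2).add_right (hDC i j j k h3)).sub_right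
        ((hDD i j i k).add_right (hDD i j j k)))

end IsGlAction

end GlRelations

/-! ### The dual pair of actions on polynomials -/

section Poly

variable {k n : ℕ}

theorem mulDeriv_apply (p q : Fin k × Fin n) (f : Poly k n) :
    mulDeriv p q f = MvPolynomial.X p * MvPolynomial.pderiv q f := rfl

theorem pderiv_pderiv_comm {σ : Type*} (q s : σ) (f : MvPolynomial σ ℂ) :
    MvPolynomial.pderiv q (MvPolynomial.pderiv s f) =
      MvPolynomial.pderiv s (MvPolynomial.pderiv q f) := by
  classical
  have : ⁅MvPolynomial.pderiv (R := ℂ) q, MvPolynomial.pderiv (R := ℂ) s⁆ =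
      (0 : Derivation ℂ (MvPolynomial σ ℂ) (MvPolynomial σ ℂ)) := by
    apply MvPolynomial.derivation_ext
    intro i
    rw [Derivation.commutator_apply, MvPolynomial.pderiv_X, MvPolynomial.pderiv_X]
    simp only [Pi.single_apply]
    split_ifs <;> simp
  have h := congrArg (fun D => D f) this
  exact sub_eq_zero.1 (by simpa [Derivation.commutator_apply] using h)

theorem mulDeriv_mul_mulDeriv (p q r s : Fin k × Fin n) (f : Poly k n) :
    mulDeriv p q (mulDeriv r s f) = MvPolynomial.X p * MvPolynomial.X r *
      MvPolynomial.pderiv q (MvPolynomial.pderiv s f) + if r = q then mulDeriv p s f else 0 := by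
  classical
  simp only [mulDeriv_apply, MvPolynomial.pderiv_mul, MvPolynomial.pderiv_X, Pi.single_apply]
  split_ifs <;> ring

theorem mulDeriv_comm (p q r s : Fin k × Fin n) : mulDeriv p q * mulDeriv r s -
    mulDeriv r s * mulDeriv p q =
    (if q = r then mulDeriv p s else 0) - (if s = p then mulDeriv r q else 0) := by
  refine LinearMap.ext fun f => ?_
  simp only [LinearMap.sub_apply, Module.End.mul_apply, mulDeriv_mul_mulDeriv]
  rw [pderiv_pderiv_comm s q]
  have e1 : (r = q) = (q = r) := propext eq_comm
  have e2 : (p = s) = (s = p) := propext eq_comm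
  simp only [e1, e2]
  split_ifs <;> (try simp only [LinearMap.zero_apply]) <;> ring

/-- The operator `∑_a x_{ai} ∂_{aj}`, the action of the elementary matrix `E_{ij}` of `𝔤𝔩_n`. -/
def colOp (i j : Fin n) : Module.End ℂ (Poly k n) := ∑ a, mulDeriv (a, i) (a, j)

/-- The operator `∑_j x_{aj} ∂_{bj}`, the action of the elementary matrix `E_{ab}` of `𝔤𝔩_k`. -/
def rowOp (a b : Fin k) : Module.End ℂ (Poly k n) := ∑ j, mulDeriv (a, j) (b, j)

theorem glnAct_eq (Y : Matrix (Fin n) (Fin n) ℂ) :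
    glnAct (k := k) Y = ∑ i, ∑ j, Y i j • colOp i j := rfl

theorem sum_single_smul {m : ℕ} {M : Type*} [AddCommGroup M] [Module ℂ M]
    (f : Fin m → Fin m → M) (i j : Fin m) :
    ∑ a, ∑ b, (Matrix.single i j (1 : ℂ)) a b • f a b = f i j := by
  rw [Finset.sum_eq_single i, Finset.sum_eq_single j]
  · simp
  · intro b _ hb; simp [hb.symm]
  · simp
  · intro a _ ha
    exact Finset.sum_eq_zero fun b _ => by simp [ha.symm]
  · simp

theorem colAct_single (j : Fin n) (a b : Fin k) :
    colAct j (Matrix.single a b 1) = mulDeriv (a, j) (b, j) := sum_single_smul _ a b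

theorem glkAct_single (a b : Fin k) : glkAct (n := n) (Matrix.single a b 1) = rowOp a b :=
  Finset.sum_congr rfl fun j _ => colAct_single j a b

theorem sum_mul_sum_sub {ι ι' : Type*} [Fintype ι] [Fintype ι'] {R : Type*} [Ring R] (f : ι → R)
    (g : ι' → R) : (∑ a, f a) * (∑ b, g b) - (∑ b, g b) * (∑ a, f a) =
      ∑ a, ∑ b, (f a * g b - g b * f a) := by
  rw [Finset.sum_mul_sum, Finset.sum_mul_sum, Finset.sum_comm (s := Finset.univ (α := ι'))]
  simp only [Finset.sum_sub_distrib]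

theorem isGlAction_colOp : IsGlAction (colOp (k := k) (n := n)) := by
  intro i j l m
  unfold colOp
  rw [sum_mul_sum_sub]
  simp only [mulDeriv_comm, Prod.mk.injEq, Finset.sum_sub_distrib]
  congr 1
  · by_cases h : j = l
    · simp [h]
    · simp [h]
  · by_cases h : m = i
    · simp [h]
    · simp [h]

theorem rowOp_comm_colOp (a b : Fin k) (i j : Fin n) :
    Commute (rowOp (n := n) a b) (colOp i j) := by
  have : rowOp (n := n) a b * colOp i j - colOp i j * rowOp a b = 0 := by
    unfold colOp rowOp
    rw [sum_mul_sum_sub]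
    simp only [mulDeriv_comm, Prod.mk.injEq, Finset.sum_sub_distrib]
    rw [sub_eq_zero]
    rw [Finset.sum_eq_single i, Finset.sum_eq_single j]
    · rw [Finset.sum_eq_single b, Finset.sum_eq_single a]
      · simp
      · intro c _ hc; simp [hc]
      · simp
      · intro c _ hc; simp [hc.symm]
      · simp
    · intro c _ hc; simp [hc.symm]
    · simp
    · intro c _ hc; simp [hc]
    · simp
  exact sub_eq_zero.1 this

/-! ### Comparison of the Knizhnik-Zamolodchikov and Casimir operators -/

/-- The trace form tensor of `𝔤𝔩_k`, acting on the columns `i` and `j`, in terms of `𝔤𝔩_n`. -/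
theorem sum_mulDeriv_mul_mulDeriv {i j : Fin n} (hij : i ≠ j) :
    ∑ a : Fin k, ∑ b : Fin k, mulDeriv (a, i) (b, i) * mulDeriv (b, j) (a, j) =
      colOp i j * colOp j i - colOp i i := by
  unfold colOp
  rw [Finset.sum_mul_sum, eq_sub_iff_add_eq]
  have : ∀ a : Fin k, ∑ b : Fin k, mulDeriv (a, i) (a, j) * mulDeriv (b, j) (b, i) =
      ∑ b : Fin k, mulDeriv (a, i) (b, i) * mulDeriv (b, j) (a, j) + mulDeriv (a, i) (a, i) := by
    intro a
    have h1 : ∀ b : Fin k, mulDeriv (a, i) (a, j) * mulDeriv (b, j) (b, i) =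
        mulDeriv (a, i) (b, i) * mulDeriv (b, j) (a, j) +
          if b = a then mulDeriv (a, i) (b, i) else 0 := by
      intro b
      refine LinearMap.ext fun f => ?_
      simp only [LinearMap.add_apply, Module.End.mul_apply, mulDeriv_mul_mulDeriv, Prod.mk.injEq,
        hij.symm, and_false, and_true, if_false, add_zero]
      rw [pderiv_pderiv_comm (a, j)]
      split_ifs <;> rfl
    simp only [h1, Finset.sum_add_distrib, Finset.sum_ite_eq', Finset.mem_univ, if_true]
  simp only [this, Finset.sum_add_distrib]

variable {B : Type*} [Fintype B] [DecidableEq B]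

theorem colAct_one (j : Fin n) : colAct (k := k) j 1 = colOp j j := by
  unfold colAct colOp
  refine Finset.sum_congr rfl fun a _ => ?_
  rw [Finset.sum_eq_single a]
  · simp
  · intro b _ hb; simp [hb.symm]
  · simp

/-- `colAct` as a linear map. -/
def colActₗ (j : Fin n) : Matrix (Fin k) (Fin k) ℂ →ₗ[ℂ] Module.End ℂ (Poly k n) where
  toFun := colAct j
  map_add' X Y := by
    simp only [colAct, Matrix.add_apply, add_smul, Finset.sum_add_distrib]
  map_smul' c X := by
    simp only [colAct, Matrix.smul_apply, smul_eq_mul, mul_smul, Finset.smul_sum, RingHom.id_apply]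

/-- The Casimir tensor of `𝔰𝔩_k`, computed from any pair of dual bases. -/
theorem omega_eq (hk : 1 ≤ k) (X X' : Module.Basis B ℂ (LieAlgebra.SpecialLinear.sl (Fin k) ℂ))
    (hX : ∀ a b : B, Matrix.trace ((X a : Matrix (Fin k) (Fin k) ℂ) *
      (X' b : Matrix (Fin k) (Fin k) ℂ)) = if a = b then 1 else 0) (i j : Fin n) :
    omega X X' i j = ∑ a : Fin k, ∑ b : Fin k, mulDeriv (a, i) (b, i) * mulDeriv (b, j) (a, j) -
      (1 / k : ℂ) • (colOp i i * colOp j j) := by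
  have hk0 : (k : ℂ) ≠ 0 := by exact_mod_cast (by omega : k ≠ 0)
  -- expansion of a traceless matrix in the basis `X`
  have hexp : ∀ Y : LieAlgebra.SpecialLinear.sl (Fin k) ℂ, (Y : Matrix (Fin k) (Fin k) ℂ) =
      ∑ c, Matrix.trace ((Y : Matrix (Fin k) (Fin k) ℂ) * (X' c : Matrix (Fin k) (Fin k) ℂ)) •
        (X c : Matrix (Fin k) (Fin k) ℂ) := by
    intro Y
    have h1 : (Y : Matrix (Fin k) (Fin k) ℂ) =
        ∑ c, X.repr Y c • (X c : Matrix (Fin k) (Fin k) ℂ) := by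
      have h := congrArg Subtype.val (X.sum_repr Y).symm
      rw [AddSubmonoidClass.coe_finsetSum] at h
      exact h
    have h2 : ∀ c, Matrix.trace ((Y : Matrix (Fin k) (Fin k) ℂ) *
        (X' c : Matrix (Fin k) (Fin k) ℂ)) = X.repr Y c := by
      intro c
      rw [h1, Finset.sum_mul, Matrix.trace_sum]
      simp [Matrix.trace_smul, hX]
    simp only [h2]
    exact h1
  have htr : ∀ a b : Fin k, Matrix.trace (Matrix.single a b (1 : ℂ) -
      (if a = b then (1 / k : ℂ) else 0) • (1 : Matrix (Fin k) (Fin k) ℂ)) = 0 := by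
    intro a b
    rw [Matrix.trace_sub, Matrix.trace_smul, Matrix.trace_one]
    by_cases h : a = b
    · subst h; simp [hk0]
    · simp [h, Matrix.trace_single_eq_of_ne _ _ _ h]
  have hX'tr : ∀ c, Matrix.trace (X' c : Matrix (Fin k) (Fin k) ℂ) = 0 := fun c => (X' c).2
  -- the expansion of the traceless part of an elementary matrix
  have hE : ∀ a b : Fin k, colAct (n := n) i (Matrix.single a b 1) -
      (if a = b then (1 / k : ℂ) else 0) • colOp i i =
      ∑ c, (X' c : Matrix (Fin k) (Fin k) ℂ) b a • colAct i (X c : Matrix (Fin k) (Fin k) ℂ) := by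
    intro a b
    have h := congrArg (colActₗ (n := n) i) (hexp ⟨_, htr a b⟩)
    simp only [map_sum, map_smul, map_sub] at h
    have h3 : ∀ M, colActₗ (k := k) (n := n) i M = colAct i M := fun _ => rfl
    simp only [h3, colAct_one] at h
    rw [h]
    refine Finset.sum_congr rfl fun c _ => ?_
    congr 1
    rw [Matrix.sub_mul, Matrix.trace_sub, Matrix.smul_mul, Matrix.one_mul, Matrix.trace_smul,
      hX'tr, smul_zero, sub_zero, Matrix.trace_mul_comm]
    simp [Matrix.trace, Matrix.mul_apply, Matrix.single_apply, Finset.sum_ite_eq,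
      ite_and]
  have hsum : ∑ a, ∑ b, (colAct (n := n) i (Matrix.single a b 1) -
      (if a = b then (1 / k : ℂ) else 0) • colOp i i) * colAct j (Matrix.single b a 1) =
      omega X X' i j := by
    simp only [hE, Finset.sum_mul, omega]
    calc ∑ a, ∑ b, ∑ c, (X' c : Matrix (Fin k) (Fin k) ℂ) b a •
          colAct i (X c : Matrix (Fin k) (Fin k) ℂ) * colAct j (Matrix.single b a 1)
        = ∑ a, ∑ c, ∑ b, (X' c : Matrix (Fin k) (Fin k) ℂ) b a •
          colAct i (X c : Matrix (Fin k) (Fin k) ℂ) * colAct j (Matrix.single b a 1) :=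
          Finset.sum_congr rfl fun a _ => Finset.sum_comm
      _ = ∑ c, ∑ a, ∑ b, (X' c : Matrix (Fin k) (Fin k) ℂ) b a •
          colAct i (X c : Matrix (Fin k) (Fin k) ℂ) * colAct j (Matrix.single b a 1) :=
          Finset.sum_comm
      _ = _ := by
        refine Finset.sum_congr rfl fun c _ => ?_
        conv_rhs => rw [colAct.eq_def j]
        rw [Finset.sum_comm, Finset.mul_sum]
        refine Finset.sum_congr rfl fun b _ => ?_
        rw [Finset.mul_sum]
        refine Finset.sum_congr rfl fun a _ => ?_
        rw [colAct_single, smul_mul_assoc, mul_smul_comm]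
  rw [← hsum]
  simp only [sub_mul, colAct_single, Finset.sum_sub_distrib]
  congr 1
  simp only [ite_smul, zero_smul, ite_mul, zero_mul, Finset.sum_ite_eq, Finset.mem_univ, if_true]
  rw [← Finset.mul_sum, smul_mul_assoc]
  rfl

/-- The operator `E_{ii} + E_{jj} + 2 E_{ii} E_{jj} / k` on polynomials. -/
def polyTwist (i j : Fin n) : Module.End ℂ (Poly k n) :=
  colOp i i + colOp j j + (2 / k : ℂ) • (colOp i i * colOp j j)

/-- On polynomials, the KZ operator `2 Ω_{ij}` is the truncated Casimir operator of `𝔤𝔩_n` up to a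
function of the weight. -/
theorem two_smul_omega (hk : 1 ≤ k)
    (X X' : Module.Basis B ℂ (LieAlgebra.SpecialLinear.sl (Fin k) ℂ))
    (hX : ∀ a b : B, Matrix.trace ((X a : Matrix (Fin k) (Fin k) ℂ) *
      (X' b : Matrix (Fin k) (Fin k) ℂ)) = if a = b then 1 else 0) {i j : Fin n} (hij : i ≠ j) :
    (2 : ℂ) • omega X X' i j = casimir colOp i j - polyTwist i j := by
  have h1 := isGlAction_colOp (k := k) i j j i
  rw [if_pos rfl, if_pos rfl] at h1
  rw [omega_eq hk X X' hX, sum_mulDeriv_mul_mulDeriv hij, casimir, polyTwist, two_smul,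
    show (2 / k : ℂ) = 1 / k + 1 / k by ring, add_smul]
  rw [sub_eq_iff_eq_add] at h1
  have h2 : colOp i j * colOp j i + colOp j i * colOp i j =
      colOp i j * colOp j i + colOp i j * colOp j i - colOp (k := k) i i + colOp j j := by
    conv_rhs => enter [1, 1, 2]; rw [h1]
    abel
  rw [h2]
  abel

end Poly

/-! ### Cyclic modules generated by a highest weight vector -/

section HighestWeight

variable {n : ℕ} {W : Type*} [AddCommGroup W] [Module ℂ W]
  {E : Fin n → Fin n → Module.End ℂ W}

/-- The span of the vectors obtained from `w` by applying at most `m` lowering operators. -/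
def lowerSpan (E : Fin n → Fin n → Module.End ℂ W) (w : W) : ℕ → Submodule ℂ W
  | 0 => Submodule.span ℂ {w}
  | m + 1 => lowerSpan E w m ⊔
      ⨆ (i : Fin n) (j : Fin n) (_ : j < i), (lowerSpan E w m).map (E i j)

theorem map_lower_mem (w : W) {i j : Fin n} (h : j < i) (m : ℕ) {x : W}
    (hx : x ∈ lowerSpan E w m) : E i j x ∈ lowerSpan E w (m + 1) := by
  refine (le_sup_right : _ ≤ lowerSpan E w (m + 1)) ?_
  exact Submodule.mem_iSup_of_mem i (Submodule.mem_iSup_of_mem j (Submodule.mem_iSup_of_mem h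
    (Submodule.mem_map_of_mem hx)))

theorem lowerSpan_le_succ (w : W) (m : ℕ) : lowerSpan E w m ≤ lowerSpan E w (m + 1) :=
  le_sup_left

/-- By the commutation relations, raising operators and diagonal operators can be moved past
lowering operators. -/
theorem IsGlAction.upper_mem (hE : IsGlAction E) {w : W} (hup : ∀ i j, i < j → E i j w = 0)
    {lam : Fin n → ℂ} (hdiag : ∀ i, E i i w = lam i • w) (m : ℕ) :
    ∀ i j, i ≤ j → lowerSpan E w m ≤ (lowerSpan E w m).comap (E i j) := by
  induction m with
  | zero =>
    intro i j hij
    refine Submodule.span_le.2 (Set.singleton_subset_iff.2 ?_)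
    change E i j w ∈ Submodule.span ℂ {w}
    rcases hij.eq_or_lt with h | h
    · subst h
      rw [hdiag]
      exact Submodule.smul_mem _ _ (Submodule.mem_span_singleton_self w)
    · rw [hup i j h]; exact Submodule.zero_mem _
  | succ m ih =>
    intro i j hij
    have hall : ∀ a b, ∀ y ∈ lowerSpan E w m, E a b y ∈ lowerSpan E w (m + 1) := by
      intro a b y hy
      rcases le_or_gt a b with h | h
      · exact lowerSpan_le_succ w m (ih a b h hy)
      · exact map_lower_mem w h m hy
    refine sup_le (fun x hx => hall i j x hx) ?_
    refine iSup_le fun a => iSup_le fun b => iSup_le fun hab => ?_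
    rw [Submodule.map_le_iff_le_comap]
    intro y hy
    change E i j (E a b y) ∈ lowerSpan E w (m + 1)
    have h := LinearMap.congr_fun (hE i j a b) y
    rw [LinearMap.sub_apply, Module.End.mul_apply, Module.End.mul_apply, sub_eq_iff_eq_add] at h
    rw [h]
    refine Submodule.add_mem _ ?_ (map_lower_mem w hab m (ih i j hij hy))
    rw [LinearMap.sub_apply]
    refine Submodule.sub_mem _ ?_ ?_
    · split_ifs
      · exact hall _ _ y hy
      · exact Submodule.zero_mem _
    · split_ifs
      · exact hall _ _ y hy
      · exact Submodule.zero_mem _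

/-- The operator `-∑ i E_{ii}`; the lowering operators lower its eigenvalues by positive
integers. -/
def heightOp (E : Fin n → Fin n → Module.End ℂ W) : Module.End ℂ W :=
  -∑ i : Fin n, (i : ℂ) • E i i

theorem IsGlAction.heightOp_comm (hE : IsGlAction E) (i j : Fin n) :
    heightOp E * E i j = E i j * heightOp E + ((j : ℂ) - i) • E i j := by
  have h : ∀ a : Fin n, E a a * E i j = E i j * E a a +
      ((if a = i then E a j else 0) - (if j = a then E i a else 0)) := fun a => by
    rw [← hE a a i j]; abel
  unfold heightOp
  rw [neg_mul, mul_neg, Finset.sum_mul, Finset.mul_sum]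
  have h2 : ∀ a : Fin n, ((a : ℂ) • E a a) * E i j = E i j * ((a : ℂ) • E a a) +
      ((if a = i then (a : ℂ) • E a j else 0) - (if j = a then (a : ℂ) • E i a else 0)) := by
    intro a
    rw [smul_mul_assoc, mul_smul_comm, h, smul_add, smul_sub]
    split_ifs <;> simp
  simp only [h2, Finset.sum_add_distrib, Finset.sum_sub_distrib, Finset.sum_ite_eq',
    Finset.sum_ite_eq, Finset.mem_univ, if_true, sub_smul]
  abel

theorem IsGlAction.map_eigenspace (hE : IsGlAction E) {i j : Fin n} {c : ℂ} {x : W}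
    (hx : x ∈ (heightOp E).eigenspace c) :
    E i j x ∈ (heightOp E).eigenspace (c + ((j : ℂ) - i)) := by
  rw [Module.End.mem_eigenspace_iff] at hx ⊢
  rw [← Module.End.mul_apply, hE.heightOp_comm, LinearMap.add_apply, Module.End.mul_apply, hx,
    map_smul, LinearMap.smul_apply, add_smul]

/-- In the cyclic module generated by a highest weight vector, the space of vectors with the highest
weight is one-dimensional. -/
theorem IsGlAction.exists_cyclic (hE : IsGlAction E) {w : W} (hup : ∀ i j, i < j → E i j w = 0)
    {lam : Fin n → ℂ} (hdiag : ∀ i, E i i w = lam i • w) :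
    ∃ N : Submodule ℂ W, w ∈ N ∧ (∀ i j, ∀ x ∈ N, E i j x ∈ N) ∧
      ∀ x ∈ N, (∀ i, E i i x = lam i • x) → x ∈ Submodule.span ℂ {w} := by
  have hmono : Monotone (lowerSpan E w) := monotone_nat_of_le_succ (lowerSpan_le_succ w)
  have hmem : ∀ x, x ∈ ⨆ m, lowerSpan E w m ↔ ∃ m, x ∈ lowerSpan E w m := fun x =>
    Submodule.mem_iSup_of_directed _ hmono.directed_le
  set h₀ : ℂ := -∑ i : Fin n, (i : ℂ) * lam i with hh₀
  have hheight : ∀ x, (∀ i, E i i x = lam i • x) → x ∈ (heightOp E).eigenspace h₀ := by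
    intro x hx
    rw [Module.End.mem_eigenspace_iff, heightOp, LinearMap.neg_apply, LinearMap.sum_apply, hh₀,
      neg_smul, Finset.sum_smul]
    congr 1
    refine Finset.sum_congr rfl fun i _ => ?_
    rw [LinearMap.smul_apply, hx, smul_smul]
  -- everything but the multiples of `w` lies in eigenspaces below that of `w`
  set K : Submodule ℂ W := ⨆ r : ℕ, (heightOp E).eigenspace (h₀ - (r + 1)) with hK
  have hsub : ∀ m, lowerSpan E w m ≤ Submodule.span ℂ {w} ⊔ K := by
    intro m
    induction m with
    | zero => exact le_sup_left
    | succ m ih =>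
      refine sup_le ih (iSup_le fun i => iSup_le fun j => iSup_le fun hij => ?_)
      have hlt : (j : ℕ) < i := hij
      obtain ⟨d, hd⟩ := Nat.exists_eq_add_of_lt hlt
      have hd' : ((j : ℕ) : ℂ) - (i : ℕ) = -(d + 1) := by rw [hd]; push_cast; ring
      rw [Submodule.map_le_iff_le_comap]
      refine ih.trans (sup_le (Submodule.span_le.2 (Set.singleton_subset_iff.2 ?_)) ?_)
      · refine (le_sup_right : K ≤ _) (Submodule.mem_iSup_of_mem d ?_)
        have := hE.map_eigenspace (i := i) (j := j) (hheight w hdiag)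
        rw [hd'] at this
        exact this
      · refine iSup_le fun r x hx => ?_
        refine (le_sup_right : K ≤ _) (Submodule.mem_iSup_of_mem (r + d + 1) ?_)
        have := hE.map_eigenspace (i := i) (j := j) hx
        rw [hd'] at this
        convert! this using 2
        push_cast; ring
  have hdisj : Disjoint ((heightOp E).eigenspace h₀) K := by
    refine ((heightOp E).eigenspaces_iSupIndep h₀).mono_right (iSup_le fun r => ?_)
    refine le_iSup₂_of_le (h₀ - (r + 1)) ?_ le_rfl
    intro h
    have h1 : ((r + 1 : ℕ) : ℂ) = 0 := by push_cast; linear_combination -h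
    exact Nat.succ_ne_zero r (Nat.cast_eq_zero.1 h1)
  refine ⟨⨆ m, lowerSpan E w m, (hmem w).2 ⟨0, Submodule.mem_span_singleton_self w⟩,
    fun i j x hx => ?_, fun x hx hxw => ?_⟩
  · obtain ⟨m, hm⟩ := (hmem x).1 hx
    rcases le_or_gt i j with h | h
    · exact (hmem _).2 ⟨m, hE.upper_mem hup hdiag m i j h hm⟩
    · exact (hmem _).2 ⟨m + 1, map_lower_mem w h m hm⟩
  · obtain ⟨m, hm⟩ := (hmem x).1 hx
    obtain ⟨y, hy, u, hu, rfl⟩ := Submodule.mem_sup.1 (hsub m hm)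
    obtain ⟨a, rfl⟩ := Submodule.mem_span_singleton.1 hy
    have h1 : u ∈ (heightOp E).eigenspace h₀ := by
      have h2 := Submodule.sub_mem _ (hheight _ hxw)
        (Submodule.smul_mem _ a (hheight w hdiag))
      rwa [add_sub_cancel_left] at h2
    rw [Submodule.disjoint_def.1 hdisj u h1 hu, add_zero]
    exact hy

end HighestWeight

/-! ### Polynomials that are singular for both actions -/

section Singular

variable {k n : ℕ}

theorem coeff_mulDeriv_self (p : Fin k × Fin n) (f : Poly k n) (α : Fin k × Fin n →₀ ℕ) :
    MvPolynomial.coeff α (mulDeriv p p f) = α p * MvPolynomial.coeff α f := by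
  classical
  rw [mulDeriv_apply, MvPolynomial.coeff_X_mul', MvPolynomial.coeff_pderiv]
  split_ifs with h
  · have h1 : 1 ≤ α p := Nat.one_le_iff_ne_zero.2 (Finsupp.mem_support_iff.1 h)
    have h2 : α - Finsupp.single p 1 + Finsupp.single p 1 = α :=
      tsub_add_cancel_of_le (Finsupp.single_le_iff.2 h1)
    rw [h2, Finsupp.tsub_apply, Finsupp.single_eq_same, Nat.cast_sub h1]
    push_cast; ring
  · rw [Finsupp.notMem_support_iff.1 h]; simp

/-- A monomial in `x_p ∂_q f` comes from a monomial of `f` by replacing one `x_q` by `x_p`. -/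
theorem coeff_mulDeriv_ne_zero {p q : Fin k × Fin n} {f : Poly k n} {α : Fin k × Fin n →₀ ℕ}
    (h : MvPolynomial.coeff α (mulDeriv p q f) ≠ 0) : ∃ β : Fin k × Fin n →₀ ℕ,
      α = β + Finsupp.single p 1 ∧ MvPolynomial.coeff (β + Finsupp.single q 1) f ≠ 0 := by
  classical
  rw [mulDeriv_apply, MvPolynomial.coeff_X_mul', MvPolynomial.coeff_pderiv] at h
  split_ifs at h with h1
  · refine ⟨α - Finsupp.single p 1, ?_, left_ne_zero_of_mul h⟩
    rw [tsub_add_cancel_of_le (Finsupp.single_le_iff.2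
      (Nat.one_le_iff_ne_zero.2 (Finsupp.mem_support_iff.1 h1)))]
  · exact absurd rfl h

theorem mem_singular_iff {lam : ℕ → ℕ} {f : Poly k n} : f ∈ singular k n lam ↔
    (∀ a b : Fin k, a < b → rowOp a b f = 0) ∧ ∀ a : Fin k, rowOp a a f = (lam a : ℂ) • f := by
  simp only [singular, Submodule.mem_inf, Submodule.mem_iInf, LinearMap.mem_ker, glkAct_single,
    LinearMap.sub_apply, sub_eq_zero, LinearMap.smul_apply, LinearMap.id_apply]

theorem colOp_mem_singular {lam : ℕ → ℕ} {f : Poly k n} (hf : f ∈ singular k n lam) (i j : Fin n) :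
    colOp i j f ∈ singular k n lam := by
  rw [mem_singular_iff] at hf ⊢
  have h : ∀ a b, rowOp a b (colOp i j f) = colOp i j (rowOp a b f) := fun a b =>
    LinearMap.congr_fun (rowOp_comm_colOp a b i j).eq f
  refine ⟨fun a b hab => by rw [h, hf.1 a b hab, map_zero], fun a => ?_⟩
  rw [h, hf.2, map_smul]

theorem coeff_rowOp_self (a : Fin k) (f : Poly k n) (α : Fin k × Fin n →₀ ℕ) :
    MvPolynomial.coeff α (rowOp a a f) = ((∑ j, α (a, j) : ℕ) : ℂ) * MvPolynomial.coeff α f := by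
  rw [rowOp, LinearMap.sum_apply, MvPolynomial.coeff_sum]
  simp only [coeff_mulDeriv_self]
  rw [← Finset.sum_mul]
  push_cast
  rfl

theorem coeff_colOp_self (j : Fin n) (f : Poly k n) (α : Fin k × Fin n →₀ ℕ) :
    MvPolynomial.coeff α (colOp j j f) = ((∑ a, α (a, j) : ℕ) : ℂ) * MvPolynomial.coeff α f := by
  rw [colOp, LinearMap.sum_apply, MvPolynomial.coeff_sum]
  simp only [coeff_mulDeriv_self]
  rw [← Finset.sum_mul]
  push_cast
  rfl

theorem row_sum_of_mem_singular {lam : ℕ → ℕ} {f : Poly k n} (hf : f ∈ singular k n lam)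
    {α : Fin k × Fin n →₀ ℕ} (hα : MvPolynomial.coeff α f ≠ 0) (a : Fin k) :
    ∑ j, α (a, j) = lam a := by
  have h := congrArg (MvPolynomial.coeff α) ((mem_singular_iff.1 hf).2 a)
  rw [coeff_rowOp_self, MvPolynomial.coeff_smul, smul_eq_mul] at h
  exact_mod_cast mul_right_cancel₀ hα h

/-- A nonzero space of polynomials of bounded degree that is stable under the operators of `𝔤𝔩_n`
contains a nonzero polynomial killed by all of them: apply raising operators as long as the
result does not vanish; each of them moves all monomials to larger weights. -/
theorem exists_singular {lam : ℕ → ℕ} {K : Submodule ℂ (Poly k n)} (hK : K ≤ singular k n lam)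
    (hinv : ∀ i j, ∀ f ∈ K, colOp i j f ∈ K) (hne : K ≠ ⊥) :
    ∃ f ∈ K, f ≠ 0 ∧ ∀ i j : Fin n, i < j → colOp i j f = 0 := by
  classical
  by_contra! hcon
  -- each variable moved from column `j` to column `i < j` increases this weight, which is bounded
  -- because the degree in each row is fixed
  let wt : (Fin k × Fin n →₀ ℕ) → ℕ := fun α => ∑ p, α p * (n - p.2)
  have hwt_add : ∀ α β, wt (α + β) = wt α + wt β := fun α β => by
    simp only [wt, Finsupp.add_apply, add_mul, Finset.sum_add_distrib]
  have hwt_single : ∀ p : Fin k × Fin n, wt (Finsupp.single p 1) = n - p.2 := fun p => by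
    simp only [wt]
    rw [Finset.sum_eq_single p]
    · simp
    · intro q _ hq; simp [hq]
    · simp
  have key : ∀ m : ℕ, ∃ f ∈ K, f ≠ 0 ∧ ∀ α, MvPolynomial.coeff α f ≠ 0 → m ≤ wt α := by
    intro m
    induction m with
    | zero =>
      obtain ⟨f, hf, h0⟩ := Submodule.exists_mem_ne_zero_of_ne_bot hne
      exact ⟨f, hf, h0, fun _ _ => Nat.zero_le _⟩
    | succ m ih =>
      obtain ⟨f, hf, h0, hm⟩ := ih
      obtain ⟨i, j, hij, hne⟩ := hcon f hf h0
      refine ⟨colOp i j f, hinv i j f hf, hne, fun α hα => ?_⟩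
      rw [colOp, LinearMap.sum_apply, MvPolynomial.coeff_sum] at hα
      obtain ⟨a, -, ha⟩ := Finset.exists_ne_zero_of_sum_ne_zero hα
      obtain ⟨β, rfl, hβ⟩ := coeff_mulDeriv_ne_zero ha
      have h1 := hm _ hβ
      rw [hwt_add, hwt_single] at h1 ⊢
      have h2 : (i : ℕ) < j := hij
      have h3 := j.2
      dsimp only at h1 ⊢
      omega
  obtain ⟨f, hf, h0, hm⟩ := key ((∑ a : Fin k, lam a) * n + 1)
  obtain ⟨α, hα⟩ := MvPolynomial.ne_zero_iff.1 h0
  have h1 := hm α hα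
  have h2 : wt α ≤ (∑ a : Fin k, lam a) * n := by
    calc wt α ≤ ∑ p : Fin k × Fin n, α p * n :=
          Finset.sum_le_sum fun p _ => Nat.mul_le_mul_left _ (Nat.sub_le _ _)
      _ = _ := by
        rw [← Finset.sum_mul, Fintype.sum_prod_type]
        simp only [row_sum_of_mem_singular (hK hf) hα]
  omega

/-- The matrix `1_{k × n}`, at which polynomials singular for both actions are evaluated. -/
def idPt : Fin k × Fin n → ℂ := fun p => if (p.1 : ℕ) = p.2 then 1 else 0

/-- The translation of polynomials that takes `1_{k × n}` to the origin. -/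
def shift : Poly k n →ₐ[ℂ] Poly k n :=
  MvPolynomial.aeval fun p => MvPolynomial.X p + MvPolynomial.C (idPt p)

theorem eval_shift (x : Fin k × Fin n → ℂ) (f : Poly k n) :
    MvPolynomial.eval x (shift f) = MvPolynomial.eval (fun p => x p + idPt p) f := by
  induction f using MvPolynomial.induction_on with
  | C a => simp [shift]
  | add f g hf hg => rw [map_add, map_add, map_add, hf, hg]
  | mul_X f p hf => rw [map_mul, map_mul, map_mul, hf]; simp [shift]

theorem pderiv_shift (q : Fin k × Fin n) (f : Poly k n) :
    MvPolynomial.pderiv q (shift f) = shift (MvPolynomial.pderiv q f) := by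
  classical
  induction f using MvPolynomial.induction_on with
  | C a => simp [shift]
  | add f g hf hg => simp only [map_add, hf, hg]
  | mul_X f p hf =>
    rw [map_mul, MvPolynomial.pderiv_mul, hf, MvPolynomial.pderiv_mul, map_add, map_mul, map_mul]
    congr 2
    simp only [shift, MvPolynomial.aeval_X, map_add, MvPolynomial.pderiv_C, add_zero,
      MvPolynomial.pderiv_X, Pi.single_apply]
    split_ifs <;> simp

theorem shift_mulDeriv (p q : Fin k × Fin n) (f : Poly k n) : shift (mulDeriv p q f) =
    mulDeriv p q (shift f) + idPt p • MvPolynomial.pderiv q (shift f) := by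
  rw [mulDeriv_apply, mulDeriv_apply, map_mul, pderiv_shift, MvPolynomial.smul_eq_C_mul, ← add_mul]
  simp [shift]

/-- The linear operators that do not lower the order of vanishing at the origin. -/
def orderPreserving (k n : ℕ) : Submodule ℂ (Module.End ℂ (Poly k n)) where
  carrier := {T | ∀ (d : ℕ) (f : Poly k n), (∀ α, α.degree ≤ d → MvPolynomial.coeff α f = 0) →
    ∀ α, α.degree ≤ d → MvPolynomial.coeff α (T f) = 0}
  add_mem' hS hT d f hf α hα := by
    rw [LinearMap.add_apply, MvPolynomial.coeff_add, hS d f hf α hα, hT d f hf α hα, add_zero]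
  zero_mem' d f hf α hα := by simp
  smul_mem' c T hT d f hf α hα := by
    rw [LinearMap.smul_apply, MvPolynomial.coeff_smul, hT d f hf α hα, smul_zero]

theorem mulDeriv_mem_orderPreserving (p q : Fin k × Fin n) :
    mulDeriv p q ∈ orderPreserving k n := by
  intro d f hf α hα
  by_contra h
  obtain ⟨β, rfl, hβ⟩ := coeff_mulDeriv_ne_zero h
  refine hβ (hf _ ?_)
  simpa using hα

theorem id_mem_orderPreserving : LinearMap.id ∈ orderPreserving k n := fun _ _ hf => hf

/-- A polynomial that satisfies a system of equations `∂_s f = T_s f`, one for each variable, with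
operators `T_s` that do not lower the order at the origin, is determined by its constant term. -/
theorem eq_zero_of_pderiv_eq {f : Poly k n} (h0 : MvPolynomial.coeff 0 f = 0)
    (h : ∀ s, ∃ T ∈ orderPreserving k n, MvPolynomial.pderiv s f = T f) : f = 0 := by
  have key : ∀ (d : ℕ) (α : Fin k × Fin n →₀ ℕ), α.degree ≤ d → MvPolynomial.coeff α f = 0 := by
    intro d
    induction d with
    | zero =>
      intro α hα
      have : α = 0 := (Finsupp.degree_eq_zero_iff α).1 (Nat.le_zero.1 hα)
      rw [this, h0]
    | succ d ih =>
      intro α hα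
      by_cases hα0 : α = 0
      · rw [hα0, h0]
      obtain ⟨s, hs⟩ := Finsupp.ne_iff.1 hα0
      have h1 : Finsupp.single s 1 ≤ α :=
        Finsupp.single_le_iff.2 (Nat.one_le_iff_ne_zero.2 hs)
      obtain ⟨β, rfl⟩ := exists_add_of_le h1
      have hβ : β.degree ≤ d := by
        rw [map_add, Finsupp.degree_single] at hα
        omega
      obtain ⟨T, hT, hTf⟩ := h s
      have h2 := congrArg (MvPolynomial.coeff β) hTf
      rw [hT d f ih β hβ, MvPolynomial.coeff_pderiv, add_comm β] at h2
      exact (mul_eq_zero.1 h2).resolve_right (Nat.cast_add_one_ne_zero _)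
  exact MvPolynomial.ext _ _ fun α => by rw [key _ α le_rfl, MvPolynomial.coeff_zero]

/-- A polynomial that is singular for both actions vanishes if it vanishes at `1_{k × n}`: the
equations express all its partial derivatives there by lower order terms. -/
theorem eq_zero_of_eval_idPt {lam : ℕ → ℕ} {f : Poly k n} (hf : f ∈ singular k n lam)
    (hcol : ∀ i j : Fin n, i < j → colOp i j f = 0) (h0 : MvPolynomial.eval idPt f = 0) :
    f = 0 := by
  rw [mem_singular_iff] at hf
  have hshift : shift f = 0 := by
    refine eq_zero_of_pderiv_eq ?_ ?_
    · rw [← MvPolynomial.constantCoeff_eq, ← MvPolynomial.eval_zero, eval_shift]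
      simpa using h0
    have hrowmem : ∀ a b, rowOp a b ∈ orderPreserving k n := fun a b =>
      Submodule.sum_mem _ fun j _ => mulDeriv_mem_orderPreserving _ _
    have hcolmem : ∀ i j, colOp i j ∈ orderPreserving k n := fun i j =>
      Submodule.sum_mem _ fun a _ => mulDeriv_mem_orderPreserving _ _
    have hrow : ∀ (a b : Fin k) (j : Fin n), (a : ℕ) = j → shift (rowOp a b f) =
        rowOp a b (shift f) + MvPolynomial.pderiv (b, j) (shift f) := by
      intro a b j haj
      simp only [rowOp, LinearMap.sum_apply, map_sum, shift_mulDeriv, Finset.sum_add_distrib]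
      congr 1
      rw [Finset.sum_eq_single j]
      · simp [idPt, haj]
      · intro l _ hl
        have : (a : ℕ) ≠ l := fun h => hl (Fin.ext (h.symm.trans haj))
        simp [idPt, this]
      · simp
    have hcolsh : ∀ (i j : Fin n) (a : Fin k), (a : ℕ) = i → shift (colOp i j f) =
        colOp i j (shift f) + MvPolynomial.pderiv (a, j) (shift f) := by
      intro i j a hai
      simp only [colOp, LinearMap.sum_apply, map_sum, shift_mulDeriv, Finset.sum_add_distrib]
      congr 1
      rw [Finset.sum_eq_single a]
      · simp [idPt, hai]
      · intro l _ hl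
        have : (l : ℕ) ≠ i := fun h => hl (Fin.ext (h.trans hai.symm))
        simp [idPt, this]
      · simp
    rintro ⟨a, j⟩
    rcases lt_trichotomy (a : ℕ) j with h | h | h
    · have ha : (a : ℕ) < n := h.trans j.2
      refine ⟨-colOp ⟨a, ha⟩ j, Submodule.neg_mem _ (hcolmem _ _), ?_⟩
      have h1 := hcolsh ⟨a, ha⟩ j a rfl
      rw [hcol ⟨a, ha⟩ j h, map_zero] at h1
      rw [LinearMap.neg_apply, eq_neg_iff_add_eq_zero, add_comm, ← h1]
    · refine ⟨(lam a : ℂ) • LinearMap.id - rowOp a a, Submodule.sub_mem _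
        (Submodule.smul_mem _ _ id_mem_orderPreserving) (hrowmem _ _), ?_⟩
      have h1 := hrow a a j h
      rw [hf.2, map_smul] at h1
      rw [LinearMap.sub_apply, LinearMap.smul_apply, LinearMap.id_apply, h1, add_sub_cancel_left]
    · have hj : (j : ℕ) < k := h.trans a.2
      refine ⟨-rowOp ⟨j, hj⟩ a, Submodule.neg_mem _ (hrowmem _ _), ?_⟩
      have h1 := hrow ⟨j, hj⟩ a j rfl
      rw [hf.1 ⟨j, hj⟩ a h, map_zero] at h1
      rw [LinearMap.neg_apply, eq_neg_iff_add_eq_zero, add_comm, ← h1]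
  refine MvPolynomial.funext fun x => ?_
  have h := eval_shift (fun p => x p - idPt p) f
  rw [hshift, map_zero] at h
  simpa using h.symm

end Singular

/-! ### The highest weight polynomial -/

section HighestWeightPolynomial

variable {k n : ℕ}

/-- A derivation as an algebra homomorphism to the dual numbers, `f ↦ f + ε D f`. -/
def derivToDual {R : Type*} [CommRing R] [Algebra ℂ R] (D : Derivation ℂ R R) :
    R →+* DualNumber R where
  toFun f := TrivSqZeroExt.inl f + TrivSqZeroExt.inr (D f)
  map_one' := by simp
  map_zero' := by simp
  map_add' f g := by ext <;> simp
  map_mul' f g := by ext <;> simp [mul_comm]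

/-- Jacobi's formula for a derivation that acts on the entries as an infinitesimal column
operation. -/
theorem derivation_det_of_mul {R : Type*} [CommRing R] [Algebra ℂ R] (D : Derivation ℂ R R)
    {m : Type*} [Fintype m] [DecidableEq m] {M N : Matrix m m R} (h : M.map D = M * N) :
    D M.det = N.trace * M.det := by
  have h1 : (derivToDual D).mapMatrix M = M.map TrivSqZeroExt.inl *
      (1 + (TrivSqZeroExt.inr 1 : DualNumber R) • N.map TrivSqZeroExt.inl) := by
    have h2 : M.map (TrivSqZeroExt.inl (M := R)) * N.map TrivSqZeroExt.inl =
        (M.map D).map (TrivSqZeroExt.inl (M := R)) := by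
      rw [h]
      exact (Matrix.map_mul (f := TrivSqZeroExt.inlHom R R)).symm
    rw [Matrix.mul_add, Matrix.mul_one, Matrix.mul_smul, h2]
    refine Matrix.ext fun i j => ?_
    refine TrivSqZeroExt.ext ?_ ?_ <;> simp [derivToDual, -DualNumber.inr_eq_smul_eps]
  have h3 := congrArg Matrix.det h1
  rw [← RingHom.map_det, Matrix.det_mul, Matrix.det_one_add_smul] at h3
  have h4 : (M.map (TrivSqZeroExt.inl (M := R))).det = TrivSqZeroExt.inl M.det :=
    ((TrivSqZeroExt.inlHom R R).map_det M).symm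
  have h5 : (N.map (TrivSqZeroExt.inl (M := R))).trace = TrivSqZeroExt.inl N.trace :=
    (AddMonoidHom.map_trace (TrivSqZeroExt.inlHom R R).toAddMonoidHom N).symm
  have h0 : (TrivSqZeroExt.inr 1 : DualNumber R) ^ 2 = 0 := by
    rw [pow_two, TrivSqZeroExt.inr_mul_inr]
  rw [h4, h5, h0, mul_zero, add_zero] at h3
  have h6 := congrArg TrivSqZeroExt.snd h3
  simpa [derivToDual, mul_comm, -DualNumber.inr_eq_smul_eps] using h6

theorem derivation_det_of_mul_left {R : Type*} [CommRing R] [Algebra ℂ R] (D : Derivation ℂ R R)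
    {m : Type*} [Fintype m] [DecidableEq m] {M N : Matrix m m R} (h : M.map D = N * M) :
    D M.det = N.trace * M.det := by
  rw [← Matrix.det_transpose, ← Matrix.trace_transpose N]
  refine derivation_det_of_mul D ?_
  rw [← Matrix.transpose_mul, ← h, Matrix.transpose_map]

/-- `E_{ij} ∈ 𝔤𝔩_n` acts as a derivation. -/
def colDer (i j : Fin n) : Derivation ℂ (Poly k n) (Poly k n) :=
  ∑ a, (MvPolynomial.X (a, i) : Poly k n) • MvPolynomial.pderiv (a, j)

/-- `E_{ab} ∈ 𝔤𝔩_k` acts as a derivation. -/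
def rowDer (a b : Fin k) : Derivation ℂ (Poly k n) (Poly k n) :=
  ∑ j, (MvPolynomial.X (a, j) : Poly k n) • MvPolynomial.pderiv (b, j)

theorem derivation_sum_apply {ι R : Type*} [CommRing R] [Algebra ℂ R] (s : Finset ι)
    (D : ι → Derivation ℂ R R) (f : R) : (∑ i ∈ s, D i) f = ∑ i ∈ s, D i f := by
  classical
  induction s using Finset.induction_on with
  | empty => simp
  | insert a s ha ih => rw [Finset.sum_insert ha, Finset.sum_insert ha, Derivation.add_apply, ih]

theorem colDer_apply (i j : Fin n) (f : Poly k n) : colDer i j f = colOp i j f := by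
  rw [colDer, derivation_sum_apply, colOp, LinearMap.sum_apply]
  rfl

theorem rowDer_apply (a b : Fin k) (f : Poly k n) : rowDer a b f = rowOp a b f := by
  rw [rowDer, derivation_sum_apply, rowOp, LinearMap.sum_apply]
  rfl

theorem colDer_X (i j : Fin n) (a : Fin k) (l : Fin n) :
    colDer i j (MvPolynomial.X (a, l) : Poly k n) = if l = j then MvPolynomial.X (a, i) else 0 := by
  classical
  rw [colDer, derivation_sum_apply, Finset.sum_eq_single a]
  · by_cases h : l = j
    · simp [h]
    · simp [h]
  · intro b _ hb
    rw [Derivation.smul_apply, MvPolynomial.pderiv_X_of_ne (fun h => hb (congrArg Prod.fst h).symm),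
      smul_zero]
  · simp

theorem rowDer_X (a b : Fin k) (c : Fin k) (j : Fin n) :
    rowDer a b (MvPolynomial.X (c, j) : Poly k n) = if c = b then MvPolynomial.X (a, j) else 0 := by
  classical
  rw [rowDer, derivation_sum_apply, Finset.sum_eq_single j]
  · by_cases h : c = b
    · simp [h]
    · simp [h]
  · intro l _ hl
    rw [Derivation.smul_apply, MvPolynomial.pderiv_X_of_ne (fun h => hl (congrArg Prod.snd h).symm),
      smul_zero]
  · simp

/-- The leading `r × r` submatrix of the matrix of variables. -/
def leadingBlock (R : Type*) [CommRing R] (k n : ℕ) (r : ℕ) (hk : r ≤ k) (hn : r ≤ n) :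
    Matrix (Fin r) (Fin r) (MvPolynomial (Fin k × Fin n) R) :=
  Matrix.of fun a c => MvPolynomial.X (Fin.castLE hk a, Fin.castLE hn c)

/-- The polynomial `∏_r m_r ^ (lam_r - lam_{r+1})`, where `m_1, m_2, …` are the leading principal
minors; the entries of `lam` are numbered from `0`. -/
def hwPoly (R : Type*) [CommRing R] (k n : ℕ) (lam : ℕ → ℕ) : MvPolynomial (Fin k × Fin n) R :=
  ∏ r : Fin (min k n), (leadingBlock R k n (r + 1) (by omega) (by omega)).det ^
    (lam r - lam (r + 1))

theorem colDer_det_leadingBlock (r : ℕ) (hk : r ≤ k) (hn : r ≤ n) {i j : Fin n} (hij : i ≤ j) :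
    colDer i j (leadingBlock ℂ k n r hk hn).det =
      (if i = j ∧ (i : ℕ) < r then 1 else 0) * (leadingBlock ℂ k n r hk hn).det := by
  classical
  by_cases hj : (j : ℕ) < r
  · have hi : (i : ℕ) < r := lt_of_le_of_lt hij hj
    rw [derivation_det_of_mul (N := Matrix.single ⟨i, hi⟩ ⟨j, hj⟩ 1)]
    · congr 1
      by_cases h : i = j
      · subst h; simp [hi, Matrix.trace_single_eq_same]
      · rw [Matrix.trace_single_eq_of_ne _ _ _ (fun h' => h (Fin.ext (Fin.mk.inj_iff.1 h')))]
        simp [h]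
    · refine Matrix.ext fun a c => ?_
      rw [Matrix.map_apply, leadingBlock, Matrix.of_apply, colDer_X]
      by_cases h : Fin.castLE hn c = j
      · have h' : c = ⟨j, hj⟩ := Fin.ext (by simpa using congrArg Fin.val h)
        rw [if_pos h, h', Matrix.mul_single_apply_same, mul_one]
        rfl
      · have h' : c ≠ ⟨j, hj⟩ := fun h' => h (by rw [h']; rfl)
        rw [if_neg h, Matrix.mul_single_apply_of_ne _ _ _ _ _ h']
  · rw [derivation_det_of_mul (N := 0)]
    · have : ¬ (i = j ∧ (i : ℕ) < r) := fun h => hj (h.1 ▸ h.2)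
      rw [if_neg this, Matrix.trace_zero]
    · refine Matrix.ext fun a c => ?_
      rw [Matrix.map_apply, leadingBlock, Matrix.of_apply, colDer_X, Matrix.mul_zero,
        Matrix.zero_apply, if_neg]
      intro h
      exact hj (h ▸ c.2)

theorem rowDer_det_leadingBlock (r : ℕ) (hk : r ≤ k) (hn : r ≤ n) {a b : Fin k} (hab : a ≤ b) :
    rowDer a b (leadingBlock ℂ k n r hk hn).det =
      (if a = b ∧ (a : ℕ) < r then 1 else 0) * (leadingBlock ℂ k n r hk hn).det := by
  classical
  by_cases hb : (b : ℕ) < r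
  · have ha : (a : ℕ) < r := lt_of_le_of_lt hab hb
    rw [derivation_det_of_mul_left (N := Matrix.single ⟨b, hb⟩ ⟨a, ha⟩ 1)]
    · congr 1
      by_cases h : a = b
      · subst h; simp [ha, Matrix.trace_single_eq_same]
      · rw [Matrix.trace_single_eq_of_ne _ _ _ (fun h' => h (Fin.ext (Fin.mk.inj_iff.1 h').symm))]
        simp [h]
    · refine Matrix.ext fun c l => ?_
      rw [Matrix.map_apply, leadingBlock, Matrix.of_apply, rowDer_X]
      by_cases h : Fin.castLE hk c = b
      · have h' : c = ⟨b, hb⟩ := Fin.ext (by simpa using congrArg Fin.val h)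
        rw [if_pos h, h', Matrix.single_mul_apply_same, one_mul]
        rfl
      · have h' : c ≠ ⟨b, hb⟩ := fun h' => h (by rw [h']; rfl)
        rw [if_neg h, Matrix.single_mul_apply_of_ne _ _ _ _ _ h']
  · rw [derivation_det_of_mul (N := 0)]
    · have : ¬ (a = b ∧ (a : ℕ) < r) := fun h => hb (h.1 ▸ h.2)
      rw [if_neg this, Matrix.trace_zero]
    · refine Matrix.ext fun c l => ?_
      rw [Matrix.map_apply, leadingBlock, Matrix.of_apply, rowDer_X, Matrix.mul_zero,
        Matrix.zero_apply, if_neg]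
      intro h
      exact hb (h ▸ c.2)

theorem derivation_prod_pow {R : Type*} [CommRing R] [Algebra ℂ R] (D : Derivation ℂ R R)
    {ι : Type*} (s : Finset ι) (f : ι → R) (c : ι → R) (e : ι → ℕ) (h : ∀ i, D (f i) = c i * f i) :
    D (∏ i ∈ s, f i ^ e i) = (∑ i ∈ s, e i * c i) * ∏ i ∈ s, f i ^ e i := by
  classical
  induction s using Finset.induction_on with
  | empty => simp
  | insert a s ha ih =>
    rw [Finset.prod_insert ha, Finset.sum_insert ha, Derivation.leibniz, ih, Derivation.leibniz_pow,
      h]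
    simp only [smul_eq_mul, nsmul_eq_mul]
    rcases Nat.eq_zero_or_pos (e a) with h0 | h0
    · rw [h0]; simp
    · obtain ⟨d, hd⟩ := Nat.exists_eq_add_of_lt h0
      rw [hd]
      simp only [zero_add, Nat.add_sub_cancel]
      ring

theorem sum_sub_eq {m : ℕ} {lam : ℕ → ℕ} (hlam : Antitone lam) (h0 : ∀ i, m ≤ i → lam i = 0)
    (i : ℕ) : ∑ r : Fin m, (lam r - lam (r + 1)) * (if i < r + 1 then 1 else 0) = lam i := by
  rw [Fin.sum_univ_eq_sum_range (fun r => (lam r - lam (r + 1)) * (if i < r + 1 then 1 else 0)) m]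
  have key : ∀ m, ∑ r ∈ Finset.range m, (lam r - lam (r + 1)) * (if i < r + 1 then 1 else 0) =
      lam i - lam (max i m) := by
    intro m
    induction m with
    | zero => simp
    | succ m ih =>
      rw [Finset.sum_range_succ, ih]
      have h1 : lam (m + 1) ≤ lam m := hlam (Nat.le_succ m)
      split_ifs with h
      · have h2 : lam m ≤ lam i := hlam (by omega)
        rw [max_eq_right (by omega), max_eq_right (by omega)]
        omega
      · rw [max_eq_left (by omega), max_eq_left (by omega)]
        omega
  rw [key, h0 (max i m) (le_max_right _ _), Nat.sub_zero]

theorem colOp_hwPoly {lam : ℕ → ℕ} (hlam : Antitone lam) (hrows : ∀ i, min k n ≤ i → lam i = 0)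
    {i j : Fin n} (hij : i ≤ j) :
    colOp i j (hwPoly ℂ k n lam) = if i = j then (lam i : ℂ) • hwPoly ℂ k n lam else 0 := by
  rw [← colDer_apply, hwPoly, derivation_prod_pow (colDer i j) _ _ _ _ fun r : Fin (min k n) =>
    colDer_det_leadingBlock (r + 1) (by omega) (by omega) hij]
  split_ifs with h
  · rw [MvPolynomial.smul_eq_C_mul]
    congr 1
    have h1 := congrArg (Nat.cast (R := Poly k n)) (sum_sub_eq hlam hrows i)
    simpa [h] using h1
  · simp [h]

theorem rowOp_hwPoly {lam : ℕ → ℕ} (hlam : Antitone lam) (hrows : ∀ i, min k n ≤ i → lam i = 0)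
    {a b : Fin k} (hab : a ≤ b) :
    rowOp a b (hwPoly ℂ k n lam) = if a = b then (lam a : ℂ) • hwPoly ℂ k n lam else 0 := by
  rw [← rowDer_apply, hwPoly, derivation_prod_pow (rowDer a b) _ _ _ _ fun r : Fin (min k n) =>
    rowDer_det_leadingBlock (r + 1) (by omega) (by omega) hab]
  split_ifs with h
  · rw [MvPolynomial.smul_eq_C_mul]
    congr 1
    have h1 := congrArg (Nat.cast (R := Poly k n)) (sum_sub_eq hlam hrows a)
    simpa [h] using h1
  · simp [h]

theorem hwPoly_mem_singular {lam : ℕ → ℕ} (hlam : Antitone lam)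
    (hrows : ∀ i, min k n ≤ i → lam i = 0) : hwPoly ℂ k n lam ∈ singular k n lam := by
  rw [mem_singular_iff]
  refine ⟨fun a b hab => ?_, fun a => ?_⟩
  · rw [rowOp_hwPoly hlam hrows hab.le, if_neg hab.ne]
  · rw [rowOp_hwPoly hlam hrows le_rfl, if_pos rfl]

theorem eval_idPt_hwPoly (lam : ℕ → ℕ) : MvPolynomial.eval idPt (hwPoly ℂ k n lam) = 1 := by
  rw [hwPoly, map_prod]
  refine Finset.prod_eq_one fun r _ => ?_
  rw [map_pow, RingHom.map_det]
  have : (MvPolynomial.eval idPt).mapMatrix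
      (leadingBlock ℂ k n (r + 1) (by omega) (by omega)) = 1 := by
    refine Matrix.ext fun a c => ?_
    simp [leadingBlock, idPt, Matrix.one_apply, Fin.ext_iff]
  rw [this, Matrix.det_one, one_pow]

theorem hwPoly_ne_zero (lam : ℕ → ℕ) : hwPoly ℂ k n lam ≠ 0 := by
  intro h
  have h1 := eval_idPt_hwPoly (k := k) (n := n) lam
  rw [h, map_zero] at h1
  exact zero_ne_one h1

/-- The highest weight polynomial has integer coefficients, which makes its norm positive for the
apolar form. -/
theorem map_hwPoly (lam : ℕ → ℕ) :
    MvPolynomial.map (Int.castRingHom ℂ) (hwPoly ℤ k n lam) = hwPoly ℂ k n lam := by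
  rw [hwPoly, map_prod, hwPoly]
  refine Finset.prod_congr rfl fun r _ => ?_
  rw [map_pow, RingHom.map_det]
  congr 2
  refine Matrix.ext fun a c => ?_
  simp [leadingBlock]

/-- The highest weight polynomial lies in every nonzero `𝔤𝔩_n`-stable space of singular
polynomials. -/
theorem hwPoly_mem {lam : ℕ → ℕ} (hlam : Antitone lam) (hrows : ∀ i, min k n ≤ i → lam i = 0)
    {K : Submodule ℂ (Poly k n)} (hK : K ≤ singular k n lam)
    (hinv : ∀ i j, ∀ f ∈ K, colOp i j f ∈ K) (hne : K ≠ ⊥) : hwPoly ℂ k n lam ∈ K := by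
  obtain ⟨f, hf, h0, hcol⟩ := exists_singular hK hinv hne
  set c : ℂ := MvPolynomial.eval idPt f with hc
  have h1 : f - c • hwPoly ℂ k n lam = 0 := by
    refine eq_zero_of_eval_idPt (Submodule.sub_mem _ (hK hf)
      (Submodule.smul_mem _ c (hwPoly_mem_singular hlam hrows))) (fun i j hij => ?_) ?_
    · rw [map_sub, map_smul, hcol i j hij, colOp_hwPoly hlam hrows hij.le, if_neg hij.ne, smul_zero,
        sub_zero]
    · rw [map_sub, MvPolynomial.smul_eval, eval_idPt_hwPoly, mul_one, hc, sub_self]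
  rw [sub_eq_zero] at h1
  have hc0 : c ≠ 0 := by
    rintro h
    rw [h, zero_smul] at h1
    exact h0 h1
  have h2 : hwPoly ℂ k n lam = c⁻¹ • f := by rw [h1, smul_smul, inv_mul_cancel₀ hc0, one_smul]
  rw [h2]
  exact Submodule.smul_mem _ _ hf

end HighestWeightPolynomial

/-! ### The apolar bilinear form -/

section Fischer

variable {k n : ℕ}

/-- The bilinear form on polynomials for which the monomials `x^α` are orthogonal, with
`⟨x^α, x^α⟩ = α!`. -/
def fischer (k n : ℕ) : Poly k n →ₗ[ℂ] Poly k n →ₗ[ℂ] ℂ :=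
  (MvPolynomial.basisMonomials (Fin k × Fin n) ℂ).constr ℂ fun α =>
    ((∏ p, (α p).factorial : ℕ) : ℂ) • MvPolynomial.lcoeff ℂ α

theorem fischer_monomial (α : Fin k × Fin n →₀ ℕ) (g : Poly k n) :
    fischer k n (MvPolynomial.monomial α 1) g =
      ((∏ p, (α p).factorial : ℕ) : ℂ) * MvPolynomial.coeff α g := by
  have h := (MvPolynomial.basisMonomials (Fin k × Fin n) ℂ).constr_basis ℂ (fun α =>
    ((∏ p, (α p).factorial : ℕ) : ℂ) • MvPolynomial.lcoeff ℂ α) α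
  rw [MvPolynomial.coe_basisMonomials] at h
  rw [fischer, h]
  rfl

theorem fischer_ext {S T : Poly k n →ₗ[ℂ] Poly k n →ₗ[ℂ] ℂ}
    (h : ∀ α g, S (MvPolynomial.monomial α 1) g = T (MvPolynomial.monomial α 1) g) : S = T := by
  refine (MvPolynomial.basisMonomials (Fin k × Fin n) ℂ).ext fun α => LinearMap.ext fun g => ?_
  rw [MvPolynomial.coe_basisMonomials]
  exact h α g

theorem fischer_symm (f g : Poly k n) : fischer k n f g = fischer k n g f := by
  classical
  have h : fischer k n = (fischer k n).flip := by
    refine fischer_ext fun α g => ?_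
    rw [LinearMap.flip_apply]
    have h2 : fischer k n (MvPolynomial.monomial α 1) =
        (fischer k n).flip (MvPolynomial.monomial α 1) := by
      refine (MvPolynomial.basisMonomials (Fin k × Fin n) ℂ).ext fun β => ?_
      rw [MvPolynomial.coe_basisMonomials]
      change _ = fischer k n (MvPolynomial.monomial β 1) (MvPolynomial.monomial α 1)
      rw [fischer_monomial, fischer_monomial, MvPolynomial.coeff_monomial,
        MvPolynomial.coeff_monomial]
      by_cases hab : α = β
      · rw [hab]
      · rw [if_neg hab, if_neg (Ne.symm hab), mul_zero, mul_zero]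
    exact LinearMap.congr_fun h2 g
  exact LinearMap.congr_fun (LinearMap.congr_fun h f) g

theorem fischer_X_mul (p : Fin k × Fin n) (f g : Poly k n) :
    fischer k n (MvPolynomial.X p * f) g = fischer k n f (MvPolynomial.pderiv p g) := by
  classical
  have h : (fischer k n) ∘ₗ LinearMap.mulLeft ℂ (MvPolynomial.X p) =
      (fischer k n).compl₂ (MvPolynomial.pderiv p).toLinearMap := by
    refine fischer_ext fun α g => ?_
    have h0 : MvPolynomial.X p * MvPolynomial.monomial α (1 : ℂ) =
        MvPolynomial.monomial (α + Finsupp.single p 1) 1 := by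
      rw [MvPolynomial.X, MvPolynomial.monomial_mul, add_comm, one_mul]
    rw [LinearMap.comp_apply, LinearMap.mulLeft_apply, LinearMap.compl₂_apply, h0,
      fischer_monomial, fischer_monomial]
    change _ = _ * MvPolynomial.coeff α (MvPolynomial.pderiv p g)
    rw [MvPolynomial.coeff_pderiv, ← Finset.mul_prod_erase _ _ (Finset.mem_univ p),
      ← Finset.mul_prod_erase (a := p) _ (fun q => (α q).factorial) (Finset.mem_univ p)]
    have h1 : ∏ q ∈ Finset.univ.erase p,
        ((α + Finsupp.single p 1 : Fin k × Fin n →₀ ℕ) q).factorial =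
        ∏ q ∈ Finset.univ.erase p, (α q).factorial :=
      Finset.prod_congr rfl fun q hq => by
        rw [Finsupp.add_apply, Finsupp.single_eq_of_ne (Finset.ne_of_mem_erase hq), add_zero]
    rw [h1, Finsupp.add_apply, Finsupp.single_eq_same, Nat.factorial_succ]
    push_cast
    ring
  exact LinearMap.congr_fun (LinearMap.congr_fun h f) g

theorem fischer_mulDeriv (p q : Fin k × Fin n) (f g : Poly k n) :
    fischer k n (mulDeriv p q f) g = fischer k n f (mulDeriv q p g) := by
  rw [mulDeriv_apply, mulDeriv_apply, fischer_X_mul, fischer_symm f, fischer_X_mul, fischer_symm]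

/-- The adjoint of `E_{ij}` is `E_{ji}`. -/
theorem fischer_colOp (i j : Fin n) (f g : Poly k n) :
    fischer k n (colOp i j f) g = fischer k n f (colOp j i g) := by
  simp only [colOp, LinearMap.sum_apply, map_sum, fischer_mulDeriv]

/-- The form is positive on polynomials with integer coefficients. -/
theorem fischer_map_int_ne_zero {f : MvPolynomial (Fin k × Fin n) ℤ} (hf : f ≠ 0) :
    fischer k n (MvPolynomial.map (Int.castRingHom ℂ) f)
      (MvPolynomial.map (Int.castRingHom ℂ) f) ≠ 0 := by
  have h : fischer k n (MvPolynomial.map (Int.castRingHom ℂ) f)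
      (MvPolynomial.map (Int.castRingHom ℂ) f) =
      ((∑ α ∈ f.support, (∏ p, (α p).factorial : ℕ) * MvPolynomial.coeff α f ^ 2 : ℤ) : ℂ) := by
    have h1 : MvPolynomial.map (Int.castRingHom ℂ) f =
        ∑ α ∈ f.support, ((MvPolynomial.coeff α f : ℤ) : ℂ) • MvPolynomial.monomial α (1 : ℂ) := by
      conv_lhs => rw [f.as_sum, map_sum]
      simp [MvPolynomial.smul_monomial]
    have h2 : ∀ g, fischer k n (MvPolynomial.map (Int.castRingHom ℂ) f) g =
        ∑ α ∈ f.support, fischer k n (((MvPolynomial.coeff α f : ℤ) : ℂ) •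
          MvPolynomial.monomial α (1 : ℂ)) g := fun g => by
      rw [h1, map_sum, LinearMap.sum_apply]
    rw [h2]
    push_cast
    refine Finset.sum_congr rfl fun α _ => ?_
    rw [map_smul, LinearMap.smul_apply, fischer_monomial, MvPolynomial.coeff_map]
    simp
    ring
  rw [h, Int.cast_ne_zero]
  refine (Finset.sum_pos (fun α hα => ?_) (MvPolynomial.support_nonempty.2 hf)).ne'
  have h1 : 0 < ∏ p, (α p).factorial := Finset.prod_pos fun p _ => Nat.factorial_pos _
  have h2 := MvPolynomial.mem_support_iff.1 hα
  positivity

theorem fischer_hwPoly_ne_zero (lam : ℕ → ℕ) :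
    fischer k n (hwPoly ℂ k n lam) (hwPoly ℂ k n lam) ≠ 0 := by
  rw [← map_hwPoly]
  refine fischer_map_int_ne_zero fun h => hwPoly_ne_zero (k := k) (n := n) lam ?_
  rw [← map_hwPoly, h, map_zero]

/-- A nonzero finite-dimensional `𝔤𝔩_n`-stable space of singular polynomials is the whole space:
it contains the highest weight polynomial `Δ`, so its orthogonal complement, in which `Δ` does not
lie because `⟨Δ, Δ⟩ ≠ 0`, is zero. -/
theorem eq_singular_of_invariant {lam : ℕ → ℕ} (hlam : Antitone lam)
    (hrows : ∀ i, min k n ≤ i → lam i = 0) {K : Submodule ℂ (Poly k n)} [FiniteDimensional ℂ K]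
    (hK : K ≤ singular k n lam) (hinv : ∀ i j, ∀ f ∈ K, colOp i j f ∈ K) (hne : K ≠ ⊥) :
    K = singular k n lam := by
  have hΔ := hwPoly_mem hlam hrows hK hinv hne
  -- the orthogonal complement of `K` among the singular polynomials
  have horth : ∀ f ∈ singular k n lam, (∀ g ∈ K, fischer k n f g = 0) → f = 0 := by
    let L : Submodule ℂ (Poly k n) := singular k n lam ⊓
      ⨅ g : K, LinearMap.ker ((fischer k n).flip (g : Poly k n))
    have hL : ∀ f, f ∈ L ↔ f ∈ singular k n lam ∧ ∀ g ∈ K, fischer k n f g = 0 := fun f => by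
      simp [L, Submodule.mem_iInf]
    have hbot : L = ⊥ := by
      by_contra hne'
      have h1 := hwPoly_mem hlam hrows (K := L) inf_le_left (fun i j f hf => ?_) hne'
      · exact fischer_hwPoly_ne_zero lam (((hL _).1 h1).2 _ hΔ)
      · rw [hL] at hf ⊢
        refine ⟨colOp_mem_singular hf.1 i j, fun g hg => ?_⟩
        rw [fischer_colOp]
        exact hf.2 _ (hinv j i g hg)
    intro f hf h
    have : f ∈ L := (hL f).2 ⟨hf, h⟩
    rwa [hbot] at this
  -- the form is nondegenerate on `K`
  let T : K →ₗ[ℂ] Module.Dual ℂ K := (fischer k n).domRestrict₁₂ K K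
  have hTinj : Function.Injective T := by
    rw [← LinearMap.ker_eq_bot, LinearMap.ker_eq_bot']
    intro f hf
    exact Subtype.ext (horth f (hK f.2) fun g hg => LinearMap.congr_fun hf ⟨g, hg⟩)
  have hTsurj : Function.Surjective T :=
    (LinearMap.injective_iff_surjective_of_finrank_eq_finrank
      (Subspace.dual_finrank_eq (K := ℂ) (V := K)).symm).1 hTinj
  refine le_antisymm hK fun f hf => ?_
  obtain ⟨u, hu⟩ := hTsurj ((fischer k n f).domRestrict K)
  have h1 : f - u = 0 := by
    refine horth _ (Submodule.sub_mem _ hf (hK u.2)) fun g hg => ?_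
    have h2 := LinearMap.congr_fun hu ⟨g, hg⟩
    rw [map_sub, LinearMap.sub_apply, sub_eq_zero]
    exact h2.symm
  rw [sub_eq_zero.1 h1]
  exact u.2

end Fischer

/-! ### Exponentials -/

/-- A family of functions of `s` that behaves like `v ↦ φ (exp (s T) v)` is determined by its value
at `s = 0`, because the functions are entire and their derivatives at `0` are given by the powers
of `T`. -/
theorem eq_zero_of_hasDerivAt_apply {V : Type*} [AddCommGroup V] [Module ℂ V]
    (T : Module.End ℂ V) {f : ℂ → V → ℂ} (hf : ∀ v s, HasDerivAt (fun s => f s v) (f s (T v)) s)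
    (h0 : ∀ v, f 0 v = 0) (s : ℂ) (v : V) : f s v = 0 := by
  have hiter : ∀ (m : ℕ) (v : V), iteratedDeriv m (fun s => f s v) = fun s => f s ((T ^ m) v) := by
    intro m
    induction m with
    | zero => intro v; simp
    | succ m ih =>
      intro v
      rw [iteratedDeriv_succ, ih v]
      funext s
      rw [(hf ((T ^ m) v) s).deriv, pow_succ', Module.End.mul_apply]
  have hd : Differentiable ℂ fun s => f s v := fun s => (hf v s).differentiableAt
  have h := Complex.taylorSeries_eq_of_entire' (f := fun s => f s v) (c := 0) (z := s) hd
  simp only [hiter, h0, mul_zero, zero_mul, tsum_zero] at h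
  exact h.symm

theorem endExp_apply_of_eigen {V : Type*} [AddCommGroup V] [Module ℂ V] [FiniteDimensional ℂ V]
    {T : Module.End ℂ V} {c : ℂ} {v : V} (h : T v = c • v) : endExp T v = Complex.exp c • v := by
  set b := Module.finBasis ℂ V with hb
  set M := LinearMap.toMatrix b b T with hM
  set x : Fin (Module.finrank ℂ V) → ℂ := ⇑(b.repr v) with hx
  have hMx : M.mulVec x = c • x := by
    rw [hM, hx, LinearMap.toMatrix_mulVec_repr, h, map_smul]
    rfl
  have hpow : ∀ m : ℕ, (M ^ m).mulVec x = c ^ m • x := by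
    intro m
    induction m with
    | zero => simp
    | succ m ih => rw [pow_succ', ← Matrix.mulVec_mulVec, ih, Matrix.mulVec_smul, hMx, smul_smul,
        pow_succ]
  have hexp : (NormedSpace.exp M).mulVec x = Complex.exp c • x := by
    let _ : NormedRing (Matrix (Fin (Module.finrank ℂ V)) (Fin (Module.finrank ℂ V)) ℂ) :=
      Matrix.linftyOpNormedRing
    let _ : NormedAlgebra ℂ (Matrix (Fin (Module.finrank ℂ V)) (Fin (Module.finrank ℂ V)) ℂ) :=
      Matrix.linftyOpNormedAlgebra
    have h1 := NormedSpace.exp_series_hasSum_exp' (𝕂 := ℂ) M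
    let L : Matrix (Fin (Module.finrank ℂ V)) (Fin (Module.finrank ℂ V)) ℂ →+
        (Fin (Module.finrank ℂ V) → ℂ) :=
      { toFun := fun N => N.mulVec x
        map_zero' := Matrix.zero_mulVec x
        map_add' := fun N N' => Matrix.add_mulVec N N' x }
    have h2 := h1.map L (by
      change Continuous fun N : Matrix _ _ ℂ => N.mulVec x
      fun_prop)
    have h3 := (NormedSpace.exp_series_hasSum_exp' (𝕂 := ℂ) c).smul_const x
    rw [← Complex.exp_eq_exp_ℂ] at h3
    refine h2.unique ?_
    convert! h3 using 1
    funext m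
    change ((m.factorial⁻¹ : ℂ) • M ^ m).mulVec x = _
    rw [Matrix.smul_mulVec, hpow, smul_assoc]
  refine b.repr.injective (Finsupp.ext fun i => ?_)
  have h4 := congrFun hexp i
  rw [endExp, ← hb, ← hM, Matrix.repr_toLin, map_smul]
  exact h4

section ExpGL

variable {n : ℕ}

theorem coe_expGL (X : Matrix (Fin n) (Fin n) ℂ) :
    (expGL X : Matrix (Fin n) (Fin n) ℂ) = NormedSpace.exp X := rfl

theorem expGL_add_smul (X : Matrix (Fin n) (Fin n) ℂ) (s u : ℂ) :
    expGL ((s + u) • X) = expGL (s • X) * expGL (u • X) := by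
  refine Units.ext ?_
  rw [Units.val_mul, coe_expGL, coe_expGL, coe_expGL, add_smul]
  exact Matrix.exp_add_of_commute _ _ (((Commute.refl X).smul_left s).smul_right u)

theorem expGL_zero : expGL (0 : Matrix (Fin n) (Fin n) ℂ) = 1 := by
  refine Units.ext ?_
  rw [coe_expGL, NormedSpace.exp_zero, Units.val_one]

theorem expGL_smul_conj (g : GL (Fin n) ℂ) (X : Matrix (Fin n) (Fin n) ℂ) (s : ℂ) :
    expGL (s • ((g : Matrix (Fin n) (Fin n) ℂ) * X * (↑g⁻¹ : Matrix (Fin n) (Fin n) ℂ))) =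
      g * expGL (s • X) * g⁻¹ := by
  refine Units.ext ?_
  rw [Units.val_mul, Units.val_mul, coe_expGL, coe_expGL, ← Matrix.exp_units_conj, Matrix.mul_smul,
    Matrix.smul_mul]

theorem exp_of_mul_self_eq_zero {X : Matrix (Fin n) (Fin n) ℂ} (h : X * X = 0) :
    NormedSpace.exp X = 1 + X := by
  let _ : NormedRing (Matrix (Fin n) (Fin n) ℂ) := Matrix.linftyOpNormedRing
  let _ : NormedAlgebra ℂ (Matrix (Fin n) (Fin n) ℂ) := Matrix.linftyOpNormedAlgebra
  have h1 := NormedSpace.exp_series_hasSum_exp' (𝕂 := ℂ) X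
  have h2 := hasSum_sum_of_ne_finset_zero (L := SummationFilter.unconditional ℕ)
    (f := fun m : ℕ => (m.factorial⁻¹ : ℂ) • X ^ m) (s := Finset.range 2) (fun m hm => by
      obtain ⟨d, rfl⟩ := Nat.exists_eq_add_of_le (not_lt.1 fun h => hm (Finset.mem_range.2 h))
      rw [pow_add, pow_two, h, zero_mul, smul_zero])
  refine (h1.unique h2).trans ?_
  rw [Finset.sum_range_succ, Finset.sum_range_one]
  simp

theorem exp_smul_single {i j : Fin n} (hij : i ≠ j) (c : ℂ) :
    NormedSpace.exp (c • Matrix.single i j (1 : ℂ)) = 1 + c • Matrix.single i j (1 : ℂ) := by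
  refine exp_of_mul_self_eq_zero ?_
  rw [Matrix.smul_mul, Matrix.mul_smul, Matrix.single_mul_single_of_ne _ _ _ _ hij.symm, smul_zero,
    smul_zero]

/-- `GL_n(ℂ)` is generated by exponentials: transvections and invertible diagonal matrices are
exponentials. -/
theorem GL_induction {P : GL (Fin n) ℂ → Prop} (hexp : ∀ X, P (expGL X))
    (hmul : ∀ g g', P g → P g' → P (g * g')) (g : GL (Fin n) ℂ) : P g := by
  have key := Matrix.diagonal_transvection_induction_of_det_ne_zero
    (fun M : Matrix (Fin n) (Fin n) ℂ =>
      ∃ g : GL (Fin n) ℂ, (g : Matrix (Fin n) (Fin n) ℂ) = M ∧ P g)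
    (g : Matrix (Fin n) (Fin n) ℂ) (((Matrix.isUnit_iff_isUnit_det _).1 g.isUnit).ne_zero)
    (fun D hD => ?_) (fun t => ?_) ?_
  · obtain ⟨g', h1, h2⟩ := key
    rwa [← Units.ext h1]
  · have hD' : ∀ i, D i ≠ 0 := fun i h => hD (by
      rw [Matrix.det_diagonal]; exact Finset.prod_eq_zero (Finset.mem_univ i) h)
    refine ⟨expGL (Matrix.diagonal fun i => Complex.log (D i)), ?_, hexp _⟩
    rw [coe_expGL, Matrix.exp_diagonal]
    congr 1
    funext i
    rw [Pi.coe_exp, ← Complex.exp_eq_exp_ℂ, Complex.exp_log (hD' i)]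
  · obtain ⟨i, j, hij, c⟩ := t
    refine ⟨expGL (c • Matrix.single i j 1), ?_, hexp _⟩
    rw [coe_expGL, exp_smul_single hij, Matrix.TransvectionStruct.toMatrix_mk, Matrix.transvection,
      Matrix.smul_single, smul_eq_mul, mul_one]
  · rintro _ _ - - ⟨g, rfl, hg⟩ ⟨g', rfl, hg'⟩
    exact ⟨g * g', rfl, hmul g g' hg hg'⟩

end ExpGL

/-! ### Representations of `GL_n(ℂ)` -/

section GLRep

variable {n : ℕ} {V : Type*} [AddCommGroup V] [Module ℂ V] (R : GLRep n V)

theorem GLRep.hasDerivAt_act (X : Matrix (Fin n) (Fin n) ℂ) (φ : Module.Dual ℂ V) (v : V) (s : ℂ) :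
    HasDerivAt (fun s : ℂ => φ (R.act (expGL (s • X)) v))
      (φ (R.act (expGL (s • X)) (R.diff X v))) s := by
  have h := R.hasDerivAt X v (φ ∘ₗ R.act (expGL (s • X)))
  rw [← sub_self s] at h
  have h1 := h.comp_sub_const s s
  refine h1.congr_of_eventuallyEq (Filter.Eventually.of_forall fun u => ?_)
  change _ = φ (R.act (expGL (s • X)) (R.act (expGL ((u - s) • X)) v))
  rw [← Module.End.mul_apply, ← map_mul, ← expGL_add_smul, add_sub_cancel]

/-- The differential of the representation is equivariant for the adjoint action. -/
theorem GLRep.act_diff (g : GL (Fin n) ℂ) (X : Matrix (Fin n) (Fin n) ℂ) (v : V) :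
    R.act g (R.diff X v) =
      R.diff ((g : Matrix (Fin n) (Fin n) ℂ) * X * (↑g⁻¹ : Matrix (Fin n) (Fin n) ℂ))
        (R.act g v) := by
  rw [← sub_eq_zero, ← Module.forall_dual_apply_eq_zero_iff ℂ]
  intro φ
  rw [map_sub, sub_eq_zero]
  have h1 := R.hasDerivAt X v (φ ∘ₗ R.act g)
  have h2 := R.hasDerivAt ((g : Matrix (Fin n) (Fin n) ℂ) * X * (↑g⁻¹ : Matrix (Fin n) (Fin n) ℂ))
    (R.act g v) φ
  refine h1.unique (h2.congr_of_eventuallyEq (Filter.Eventually.of_forall fun s => ?_))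
  change φ (R.act g (R.act (expGL (s • X)) v)) = φ (R.act _ (R.act g v))
  rw [← Module.End.mul_apply, ← map_mul, ← Module.End.mul_apply, ← map_mul, expGL_smul_conj,
    inv_mul_cancel_right]

theorem GLRep.isGlAction : IsGlAction fun i j => R.diff (Matrix.single i j 1) := by
  intro i j k l
  rw [← R.map_lie, map_sub]
  congr 1
  · split_ifs with h
    · rw [h, Matrix.single_mul_single_same, one_mul]
    · rw [Matrix.single_mul_single_of_ne _ _ _ _ h, map_zero]
  · split_ifs with h
    · rw [h, Matrix.single_mul_single_same, one_mul]
    · rw [Matrix.single_mul_single_of_ne _ _ _ _ h, map_zero]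

theorem GLRep.diff_eq (Y : Matrix (Fin n) (Fin n) ℂ) :
    R.diff Y = ∑ i, ∑ j, Y i j • R.diff (Matrix.single i j 1) := by
  conv_lhs => rw [Matrix.matrix_eq_sum_single Y]
  simp only [map_sum, ← map_smul, Matrix.smul_single, smul_eq_mul, mul_one]

/-- A subspace stable under the Lie algebra is stable under the group: a functional that vanishes on
it vanishes on `exp (s X) v` for all `s`, by `eq_zero_of_hasDerivAt_apply`. -/
theorem GLRep.act_mem {U : Submodule ℂ V}
    (hU : ∀ i j, ∀ v ∈ U, R.diff (Matrix.single i j 1) v ∈ U) (g : GL (Fin n) ℂ) :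
    ∀ v ∈ U, R.act g v ∈ U := by
  have hdiff : ∀ Y, ∀ v ∈ U, R.diff Y v ∈ U := fun Y v hv => by
    rw [R.diff_eq]
    simp only [LinearMap.sum_apply, LinearMap.smul_apply]
    exact Submodule.sum_mem _ fun i _ => Submodule.sum_mem _ fun j _ =>
      Submodule.smul_mem _ _ (hU i j v hv)
  refine GL_induction (P := fun g => ∀ v ∈ U, R.act g v ∈ U) (fun X v hv => ?_)
    (fun g g' hg hg' v hv => by rw [map_mul]; exact hg _ (hg' v hv)) g
  by_contra hcon
  obtain ⟨φ, hφ, hφU⟩ := Submodule.exists_dual_map_eq_bot_of_notMem hcon inferInstance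
  have hφU' : ∀ u ∈ U, φ u = 0 := fun u hu => by
    have : φ u ∈ U.map φ := Submodule.mem_map_of_mem hu
    rwa [hφU] at this
  refine hφ ?_
  have h := eq_zero_of_hasDerivAt_apply ((R.diff X).restrict (hdiff X))
    (f := fun s u => φ (R.act (expGL (s • X)) u)) (fun u s => R.hasDerivAt_act X φ u s)
    (fun u => by rw [zero_smul, expGL_zero, map_one]; exact hφU' _ u.2) 1 ⟨v, hv⟩
  rwa [one_smul] at h

theorem GLRep.eq_top_of_invariant (hR : R.act.IsIrreducible) {U : Submodule ℂ V}
    (hU : ∀ i j, ∀ v ∈ U, R.diff (Matrix.single i j 1) v ∈ U) (hne : U ≠ ⊥) : U = ⊤ := by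
  let S : Subrepresentation R.act := ⟨U, fun g v hv => R.act_mem hU g v hv⟩
  rcases hR.eq_bot_or_eq_top S with h | h
  · exact absurd (congrArg Subrepresentation.toSubmodule h) hne
  · exact congrArg Subrepresentation.toSubmodule h

end GLRep

/-! ### The isomorphism with the space of singular polynomials -/

section Iso

variable {k n : ℕ} {V : Type*} [AddCommGroup V] [Module ℂ V] [FiniteDimensional ℂ V]
  {R : GLRep n V} {lam : ℕ → ℕ}

/-- The irreducible representation is isomorphic to the space of singular polynomials: the
submodule of the direct sum of the two that is generated by the pair of highest weight vectors is
the graph of an isomorphism. -/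
theorem exists_equiv_singular (hlam : Antitone lam) (hrows : ∀ i, min k n ≤ i → lam i = 0)
    (hR : R.IsIrreducibleOfHighestWeight lam) : ∃ ι : V ≃ₗ[ℂ] singular k n lam,
      ∀ i j v, (ι (R.diff (Matrix.single i j 1) v) : Poly k n) = colOp i j (ι v) := by
  obtain ⟨hirr, v, hv0, hvup, hvdiag⟩ := hR
  set D : Fin n → Fin n → Module.End ℂ V := fun i j => R.diff (Matrix.single i j 1) with hD
  set Δ : Poly k n := hwPoly ℂ k n lam with hΔ
  -- the diagonal action on the direct sum
  let E : Fin n → Fin n → Module.End ℂ (V × Poly k n) := fun i j => (D i j).prodMap (colOp i j)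
  have hEgl : IsGlAction E := by
    intro i j a b
    refine LinearMap.ext fun x => Prod.ext ?_ ?_
    · have h := LinearMap.congr_fun (R.isGlAction i j a b) x.1
      simp only [LinearMap.sub_apply, Module.End.mul_apply] at h ⊢
      convert! h using 2 <;> split_ifs <;> rfl
    · have h := LinearMap.congr_fun (isGlAction_colOp i j a b) x.2
      simp only [LinearMap.sub_apply, Module.End.mul_apply] at h ⊢
      convert! h using 2 <;> split_ifs <;> rfl
  obtain ⟨N, hwN, hNinv, hNw⟩ := hEgl.exists_cyclic (w := (v, Δ)) (lam := fun i => (lam i : ℂ))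
    (fun i j hij => Prod.ext (hvup i j hij)
      ((colOp_hwPoly hlam hrows hij.le).trans (if_neg hij.ne)))
    (fun i => Prod.ext (hvdiag i) ((colOp_hwPoly hlam hrows le_rfl).trans (if_pos rfl)))
  set M := singular k n lam with hM
  set N₀ : Submodule ℂ (V × Poly k n) := N ⊓ M.comap (LinearMap.snd ℂ V (Poly k n)) with hN₀
  have hw₀ : (v, Δ) ∈ N₀ := ⟨hwN, hwPoly_mem_singular hlam hrows⟩
  have hinv₀ : ∀ i j, ∀ x ∈ N₀, E i j x ∈ N₀ := fun i j x hx =>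
    ⟨hNinv i j x hx.1, colOp_mem_singular hx.2 i j⟩
  -- the kernels of the two projections vanish, since otherwise `(0, Δ)` or `(v, 0)` would be a
  -- vector of highest weight in the submodule that is not a multiple of `(v, Δ)`
  have hfst : ∀ f, ((0 : V), f) ∈ N₀ → f = 0 := by
    let K : Submodule ℂ (Poly k n) := N₀.comap (LinearMap.inr ℂ V (Poly k n))
    have hK : K = ⊥ := by
      by_contra hne
      have h1 : Δ ∈ K := hwPoly_mem hlam hrows (fun f hf => hf.2)
        (fun i j f hf => by
          have h := hinv₀ i j _ hf
          change ((0 : V), colOp i j f) ∈ N₀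
          convert! h using 1
          exact Prod.ext (map_zero (D i j)).symm rfl) hne
      obtain ⟨c, hc⟩ := Submodule.mem_span_singleton.1 (hNw ((0 : V), Δ) h1.1 fun i =>
        Prod.ext ((map_zero (D i i)).trans (smul_zero (lam i : ℂ)).symm)
          ((colOp_hwPoly hlam hrows le_rfl).trans (if_pos rfl)))
      have hc1 : c • v = 0 := congrArg Prod.fst hc
      have hc2 : c • Δ = Δ := congrArg Prod.snd hc
      rw [(smul_eq_zero.1 hc1).resolve_right hv0, zero_smul] at hc2
      exact hwPoly_ne_zero lam hc2.symm
    intro f hf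
    have : f ∈ K := hf
    rwa [hK] at this
  have hsnd : ∀ u, (u, (0 : Poly k n)) ∈ N₀ → u = 0 := by
    let K : Submodule ℂ V := N₀.comap (LinearMap.inl ℂ V (Poly k n))
    have hK : K = ⊥ := by
      by_contra hne
      have h1 : K = ⊤ := R.eq_top_of_invariant hirr (fun i j u hu => by
          have h := hinv₀ i j _ hu
          change (D i j u, (0 : Poly k n)) ∈ N₀
          convert! h using 1
          exact Prod.ext rfl (map_zero (colOp i j)).symm) hne
      have h2 : v ∈ K := h1 ▸ Submodule.mem_top
      obtain ⟨c, hc⟩ := Submodule.mem_span_singleton.1 (hNw (v, (0 : Poly k n)) h2.1 fun i =>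
        Prod.ext (hvdiag i) ((map_zero (colOp i i)).trans (smul_zero (lam i : ℂ)).symm))
      have hc1 : c • v = v := congrArg Prod.fst hc
      have hc2 : c • Δ = 0 := congrArg Prod.snd hc
      rw [(smul_eq_zero.1 hc2).resolve_right (hwPoly_ne_zero lam), zero_smul] at hc1
      exact hv0 hc1.symm
    intro u hu
    have : u ∈ K := hu
    rwa [hK] at this
  let p₁ : N₀ →ₗ[ℂ] V := (LinearMap.fst ℂ V (Poly k n)).domRestrict N₀
  let p₂ : N₀ →ₗ[ℂ] Poly k n := (LinearMap.snd ℂ V (Poly k n)).domRestrict N₀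
  have hp₁ : Function.Bijective p₁ := by
    refine ⟨?_, ?_⟩
    · rw [← LinearMap.ker_eq_bot, LinearMap.ker_eq_bot']
      rintro ⟨⟨u, f⟩, hx⟩ (rfl : u = 0)
      exact Subtype.ext (Prod.ext rfl (hfst f hx))
    · rw [← LinearMap.range_eq_top]
      refine R.eq_top_of_invariant hirr ?_ ?_
      · rintro i j _ ⟨x, rfl⟩
        exact ⟨⟨E i j x, hinv₀ i j x x.2⟩, rfl⟩
      · intro h
        have h1 : v ∈ LinearMap.range p₁ := ⟨⟨(v, Δ), hw₀⟩, rfl⟩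
        rw [h] at h1
        exact hv0 h1
  let e₁ : N₀ ≃ₗ[ℂ] V := LinearEquiv.ofBijective p₁ hp₁
  have hp₂ : Function.Injective p₂ := by
    rw [← LinearMap.ker_eq_bot, LinearMap.ker_eq_bot']
    rintro ⟨⟨u, f⟩, hx⟩ (rfl : f = 0)
    exact Subtype.ext (Prod.ext (hsnd u hx) rfl)
  have : FiniteDimensional ℂ N₀ := e₁.symm.finiteDimensional
  have hrange : LinearMap.range p₂ = M := by
    refine eq_singular_of_invariant hlam hrows ?_ ?_ ?_
    · rintro _ ⟨x, rfl⟩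
      exact x.2.2
    · rintro i j _ ⟨x, rfl⟩
      exact ⟨⟨E i j x, hinv₀ i j x x.2⟩, rfl⟩
    · intro h
      have h1 : Δ ∈ LinearMap.range p₂ := ⟨⟨(v, Δ), hw₀⟩, rfl⟩
      rw [h] at h1
      exact hwPoly_ne_zero lam h1
  refine ⟨e₁.symm.trans ((LinearEquiv.ofInjective p₂ hp₂).trans (LinearEquiv.ofEq _ _ hrange)),
    fun i j u => ?_⟩
  obtain ⟨x, rfl⟩ := e₁.surjective u
  have h1 : D i j (e₁ x) = e₁ ⟨E i j x, hinv₀ i j x x.2⟩ := rfl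
  change (p₂ (e₁.symm (D i j (e₁ x))) : Poly k n) = colOp i j (p₂ (e₁.symm (e₁ x)))
  rw [h1, LinearEquiv.symm_apply_apply, LinearEquiv.symm_apply_apply]
  rfl

end Iso

/-! ### The group action on polynomials -/

section GroupAction

variable {k n : ℕ}

/-- The chain rule for a polynomial along a curve. -/
theorem hasDerivAt_eval {τ : Type*} [Fintype τ] {y : ℂ → τ → ℂ} {y' : τ → ℂ} {s : ℂ}
    (hy : ∀ q, HasDerivAt (fun s => y s q) (y' q) s) (p : MvPolynomial τ ℂ) :
    HasDerivAt (fun s => MvPolynomial.eval (y s) p)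
      (∑ q, y' q * MvPolynomial.eval (y s) (MvPolynomial.pderiv q p)) s := by
  classical
  induction p using MvPolynomial.induction_on with
  | C a => simpa using hasDerivAt_const s a
  | add f g hf hg =>
    simp only [map_add, mul_add, Finset.sum_add_distrib]
    exact hf.add hg
  | mul_X f r hf =>
    have h := hf.mul (hy r)
    simp only [map_mul, MvPolynomial.eval_X]
    convert! h using 1
    simp only [MvPolynomial.pderiv_mul, MvPolynomial.pderiv_X, map_add, map_mul,
      MvPolynomial.eval_X, mul_add, Finset.sum_add_distrib, Finset.sum_mul, mul_assoc]
    congr 1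
    rw [Finset.sum_eq_single r]
    · simp [mul_comm]
    · intro q _ hq
      simp [Ne.symm hq]
    · simp

/-- Right multiplication of a `k × n` matrix by an `n × n` matrix. -/
def mulPt (x : Fin k × Fin n → ℂ) (g : Matrix (Fin n) (Fin n) ℂ) : Fin k × Fin n → ℂ :=
  fun q => ∑ c, x (q.1, c) * g c q.2

theorem mulPt_mul (x : Fin k × Fin n → ℂ) (g g' : Matrix (Fin n) (Fin n) ℂ) :
    mulPt x (g * g') = mulPt (mulPt x g) g' := by
  funext q
  simp only [mulPt, Matrix.mul_apply, Finset.mul_sum, Finset.sum_mul, mul_assoc]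
  exact Finset.sum_comm

theorem mulPt_one (x : Fin k × Fin n → ℂ) : mulPt x 1 = x := by
  funext q
  simp [mulPt, Matrix.one_apply]

theorem hasDerivAt_mulPt_exp (x : Fin k × Fin n → ℂ) (X : Matrix (Fin n) (Fin n) ℂ) (s : ℂ)
    (q : Fin k × Fin n) : HasDerivAt (fun s : ℂ => mulPt x (NormedSpace.exp (s • X)) q)
      (mulPt (mulPt x (NormedSpace.exp (s • X))) X q) s := by
  let _ : NormedRing (Matrix (Fin n) (Fin n) ℂ) := Matrix.linftyOpNormedRing
  let _ : NormedAlgebra ℂ (Matrix (Fin n) (Fin n) ℂ) := Matrix.linftyOpNormedAlgebra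
  have h := hasDerivAt_exp_smul_const (𝕂 := ℂ) X s
  rw [← mulPt_mul]
  let L : Matrix (Fin n) (Fin n) ℂ →ₗ[ℂ] ℂ :=
    { toFun := fun g => mulPt x g q
      map_add' := fun g g' => by simp [mulPt, mul_add, Finset.sum_add_distrib]
      map_smul' := fun c g => by
        simp only [mulPt, Matrix.smul_apply, smul_eq_mul, RingHom.id_apply, Finset.mul_sum]
        exact Finset.sum_congr rfl fun _ _ => by ring }
  exact (LinearMap.toContinuousLinearMap L).hasFDerivAt.comp_hasDerivAt s h

/-- `glnAct X` is the derivative along the vector field `x ↦ x X`. -/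
theorem eval_glnAct (x : Fin k × Fin n → ℂ) (X : Matrix (Fin n) (Fin n) ℂ) (p : Poly k n) :
    MvPolynomial.eval x (glnAct X p) =
      ∑ q, mulPt x X q * MvPolynomial.eval x (MvPolynomial.pderiv q p) := by
  simp only [glnAct, LinearMap.sum_apply, LinearMap.smul_apply, map_sum, MvPolynomial.smul_eval,
    mulDeriv_apply, map_mul, MvPolynomial.eval_X, mulPt, Finset.mul_sum, Finset.sum_mul,
    Fintype.sum_prod_type]
  rw [Finset.sum_comm' (t' := Finset.univ) (s' := fun _ => Finset.univ) (by simp)]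
  conv_rhs => rw [Finset.sum_comm]
  refine Finset.sum_congr rfl fun j _ => ?_
  rw [Finset.sum_comm]
  exact Finset.sum_congr rfl fun a _ => Finset.sum_congr rfl fun i _ => by ring

theorem hasDerivAt_eval_exp (x : Fin k × Fin n → ℂ) (X : Matrix (Fin n) (Fin n) ℂ) (p : Poly k n)
    (s : ℂ) : HasDerivAt (fun s : ℂ => MvPolynomial.eval (mulPt x (NormedSpace.exp (s • X))) p)
      (MvPolynomial.eval (mulPt x (NormedSpace.exp (s • X))) (glnAct X p)) s := by
  rw [eval_glnAct]
  exact hasDerivAt_eval (hasDerivAt_mulPt_exp x X s) p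

variable {V : Type*} [AddCommGroup V] [Module ℂ V] {R : GLRep n V} {lam : ℕ → ℕ}
  {ι : V ≃ₗ[ℂ] singular k n lam}

theorem equivariant_diff
    (hι : ∀ i j v, (ι (R.diff (Matrix.single i j 1) v) : Poly k n) = colOp i j (ι v))
    (Y : Matrix (Fin n) (Fin n) ℂ) (v : V) : (ι (R.diff Y v) : Poly k n) = glnAct Y (ι v) := by
  rw [R.diff_eq, glnAct_eq]
  simp only [LinearMap.sum_apply, LinearMap.smul_apply, map_sum, map_smul,
    AddSubmonoidClass.coe_finsetSum, Submodule.coe_smul, hι]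

/-- An isomorphism that intertwines the actions of the Lie algebra intertwines the action of the
group with the action on polynomials by right translations. -/
theorem eval_equiv_act
    (hι : ∀ i j v, (ι (R.diff (Matrix.single i j 1) v) : Poly k n) = colOp i j (ι v))
    (g : GL (Fin n) ℂ) : ∀ (x : Fin k × Fin n → ℂ) (v : V),
      MvPolynomial.eval x (ι (R.act g v) : Poly k n) =
        MvPolynomial.eval (mulPt x (g : Matrix (Fin n) (Fin n) ℂ)) (ι v : Poly k n) := by
  refine GL_induction (P := fun g => ∀ (x : Fin k × Fin n → ℂ) (v : V),
      MvPolynomial.eval x (ι (R.act g v) : Poly k n) =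
        MvPolynomial.eval (mulPt x (g : Matrix (Fin n) (Fin n) ℂ)) (ι v : Poly k n))
    (fun X x v => ?_) (fun g g' hg hg' x v => ?_) g
  · let φ : Module.Dual ℂ V := (MvPolynomial.aeval (R := ℂ) x).toLinearMap ∘ₗ
      (singular k n lam).subtype ∘ₗ ι.toLinearMap
    have hφ : ∀ v, φ v = MvPolynomial.eval x (ι v : Poly k n) := fun v => by
      exact DFunLike.congr_fun (MvPolynomial.coe_aeval_eq_eval x) (ι v : Poly k n)
    have h := eq_zero_of_hasDerivAt_apply (R.diff X)
      (f := fun s v => φ (R.act (expGL (s • X)) v) -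
        MvPolynomial.eval (mulPt x (NormedSpace.exp (s • X))) (ι v : Poly k n))
      (fun v s => by
        rw [equivariant_diff hι]
        exact (R.hasDerivAt_act X φ v s).sub (hasDerivAt_eval_exp x X _ s))
      (fun v => by
        rw [zero_smul, expGL_zero, map_one, NormedSpace.exp_zero, mulPt_one, hφ]
        exact sub_self _) 1 v
    rw [one_smul, hφ, sub_eq_zero] at h
    exact h
  · rw [map_mul, Module.End.mul_apply, hg, hg', Units.val_mul, mulPt_mul]

end GroupAction

/-! ### Weight spaces -/

section Weights

variable {k n : ℕ} {V : Type*} [AddCommGroup V] [Module ℂ V] {R : GLRep n V} {lam : ℕ → ℕ}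
  {ι : V ≃ₗ[ℂ] singular k n lam}

theorem GLRep.mem_weightSpace_iff {ν : Fin n → ℕ} {v : V} :
    v ∈ R.weightSpace ν ↔ ∀ i, R.diff (Matrix.single i i 1) v = (ν i : ℂ) • v := by
  simp only [GLRep.weightSpace, Submodule.mem_iInf, LinearMap.mem_ker, LinearMap.sub_apply,
    sub_eq_zero, LinearMap.smul_apply, LinearMap.id_apply]

theorem weight_single_apply (α : Fin k × Fin n →₀ ℕ) (j : Fin n) :
    Finsupp.weight (fun p : Fin k × Fin n => (Pi.single p.2 1 : Fin n → ℕ)) α j =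
      ∑ a, α (a, j) := by
  rw [Finsupp.weight_apply, Finsupp.sum_fintype α (fun i c => c • (Pi.single i.2 1 : Fin n → ℕ))
    (fun _ => zero_smul ℕ _), Finset.sum_apply, Fintype.sum_prod_type]
  refine Finset.sum_congr rfl fun a _ => ?_
  rw [Finset.sum_eq_single j]
  · simp
  · intro l _ hl
    simp [Pi.single_eq_of_ne (Ne.symm hl)]
  · simp

/-- By Euler's identity, the multidegree is the weight for `𝔤𝔩_n`. -/
theorem mem_colHomogeneous_iff {ν : Fin n → ℕ} {p : Poly k n} :
    p ∈ colHomogeneous k ν ↔ ∀ j, colOp j j p = (ν j : ℂ) • p := by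
  rw [colHomogeneous, MvPolynomial.mem_weightedHomogeneousSubmodule]
  constructor
  · intro h j
    refine MvPolynomial.ext _ _ fun α => ?_
    rw [coeff_colOp_self, MvPolynomial.coeff_smul, smul_eq_mul]
    by_cases hα : MvPolynomial.coeff α p = 0
    · rw [hα, mul_zero, mul_zero]
    · rw [← weight_single_apply, h hα]
  · intro h α hα
    funext j
    have h1 := congrArg (MvPolynomial.coeff α) (h j)
    rw [coeff_colOp_self, MvPolynomial.coeff_smul, smul_eq_mul] at h1
    rw [weight_single_apply]
    exact_mod_cast mul_right_cancel₀ hα h1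

/-- The isomorphism matches weight spaces with spaces of multihomogeneous polynomials. -/
theorem equiv_mem_colHomogeneous_iff
    (hι : ∀ i j v, (ι (R.diff (Matrix.single i j 1) v) : Poly k n) = colOp i j (ι v))
    {ν : Fin n → ℕ} {v : V} : (ι v : Poly k n) ∈ colHomogeneous k ν ↔ v ∈ R.weightSpace ν := by
  rw [mem_colHomogeneous_iff, GLRep.mem_weightSpace_iff]
  refine forall_congr' fun j => ?_
  rw [← hι, ← Submodule.coe_smul, ← map_smul, Subtype.coe_inj, ι.injective.eq_iff]

theorem map_fibre_eq_kzFibre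
    (hι : ∀ i j v, (ι (R.diff (Matrix.single i j 1) v) : Poly k n) = colOp i j (ι v))
    (μ : Fin n → ℕ) :
    (R.fibre μ).map ((singular k n lam).subtype ∘ₗ ι.toLinearMap) = kzFibre k lam μ := by
  rw [GLRep.fibre, kzFibre, Submodule.map_iSup]
  congr 1
  funext w
  refine le_antisymm ?_ ?_
  · rintro _ ⟨v, hv, rfl⟩
    exact ⟨(ι v).2, (equiv_mem_colHomogeneous_iff hι).2 hv⟩
  · rintro p ⟨hp, hp'⟩
    refine ⟨ι.symm ⟨p, hp⟩, (equiv_mem_colHomogeneous_iff hι).1 ?_, ?_⟩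
    · rw [ι.apply_symm_apply]; exact hp'
    · simp

theorem exists_fibre_equiv
    (hι : ∀ i j v, (ι (R.diff (Matrix.single i j 1) v) : Poly k n) = colOp i j (ι v))
    (μ : Fin n → ℕ) : ∃ ιμ : R.fibre μ ≃ₗ[ℂ] kzFibre k lam μ,
      ∀ v : R.fibre μ, (ιμ v : Poly k n) = ι v := by
  have hinj : Function.Injective ((singular k n lam).subtype ∘ₗ ι.toLinearMap) :=
    Subtype.val_injective.comp ι.injective
  exact ⟨(Submodule.equivMapOfInjective _ hinj (R.fibre μ)).trans
    (LinearEquiv.ofEq _ _ (map_fibre_eq_kzFibre hι μ)), fun v => rfl⟩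

end Weights

/-! ### The action of monomial matrices -/

section Monomial

variable {n : ℕ} {V : Type*} [AddCommGroup V] [Module ℂ V] (R : GLRep n V)
  {g : GL (Fin n) ℂ} {w : Equiv.Perm (Fin n)}

theorem monomial_entry_ne_zero
    (hg : ∀ a b, a ≠ w b → (g : Matrix (Fin n) (Fin n) ℂ) a b = 0) (b : Fin n) :
    (g : Matrix (Fin n) (Fin n) ℂ) (w b) b ≠ 0 := by
  intro h
  refine ((Matrix.isUnit_iff_isUnit_det _).1 g.isUnit).ne_zero
    (Matrix.det_eq_zero_of_column_eq_zero b fun a => ?_)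
  by_cases ha : a = w b
  · rw [ha, h]
  · exact hg a b ha

/-- The matrices with nonzero entries at `(w b, b)` permute the root vectors up to scalars. -/
theorem monomial_conj_single
    (hg : ∀ a b, a ≠ w b → (g : Matrix (Fin n) (Fin n) ℂ) a b = 0) (i j : Fin n) :
    (g : Matrix (Fin n) (Fin n) ℂ) * Matrix.single i j 1 * (↑g⁻¹ : Matrix (Fin n) (Fin n) ℂ) =
      ((g : Matrix (Fin n) (Fin n) ℂ) (w i) i / (g : Matrix (Fin n) (Fin n) ℂ) (w j) j) •
        Matrix.single (w i) (w j) 1 := by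
  have h : (g : Matrix (Fin n) (Fin n) ℂ) * Matrix.single i j 1 =
      (((g : Matrix (Fin n) (Fin n) ℂ) (w i) i / (g : Matrix (Fin n) (Fin n) ℂ) (w j) j) •
        Matrix.single (w i) (w j) 1) * (g : Matrix (Fin n) (Fin n) ℂ) := by
    refine Matrix.ext fun a b => ?_
    rw [Matrix.smul_mul, Matrix.smul_apply, smul_eq_mul]
    by_cases hb : b = j
    · subst hb
      rw [Matrix.mul_single_apply_same, mul_one]
      by_cases ha : a = w i
      · subst ha
        rw [Matrix.single_mul_apply_same, one_mul, div_mul_cancel₀ _ (monomial_entry_ne_zero hg b)]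
      · rw [Matrix.single_mul_apply_of_ne _ _ _ _ _ ha, hg a i ha, mul_zero]
    · rw [Matrix.mul_single_apply_of_ne _ _ _ _ _ hb]
      by_cases ha : a = w i
      · subst ha
        rw [Matrix.single_mul_apply_same, hg _ _ (fun h => hb (w.injective h).symm), mul_zero,
          mul_zero]
      · rw [Matrix.single_mul_apply_of_ne _ _ _ _ _ ha, mul_zero]
  rw [h, Matrix.mul_assoc, ← Units.val_mul, mul_inv_cancel, Units.val_one, Matrix.mul_one]

theorem GLRep.act_monomial_diff
    (hg : ∀ a b, a ≠ w b → (g : Matrix (Fin n) (Fin n) ℂ) a b = 0) (i j : Fin n) (v : V) :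
    R.act g (R.diff (Matrix.single i j 1) v) =
      ((g : Matrix (Fin n) (Fin n) ℂ) (w i) i / (g : Matrix (Fin n) (Fin n) ℂ) (w j) j) •
        R.diff (Matrix.single (w i) (w j) 1) (R.act g v) := by
  rw [R.act_diff, monomial_conj_single hg, map_smul, LinearMap.smul_apply]

/-- The scalars for `E_{ij}` and `E_{ji}` are inverse to each other, so they cancel in `κ_{ij}`. -/
theorem GLRep.act_monomial_kappa
    (hg : ∀ a b, a ≠ w b → (g : Matrix (Fin n) (Fin n) ℂ) a b = 0) (i j : Fin n) (v : V) :
    R.act g (R.kappa i j v) = R.kappa (w i) (w j) (R.act g v) := by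
  have hi := monomial_entry_ne_zero hg i
  have hj := monomial_entry_ne_zero hg j
  simp only [GLRep.kappa, LinearMap.add_apply, Module.End.mul_apply, map_add,
    R.act_monomial_diff hg, map_smul, smul_smul]
  rw [div_mul_div_cancel₀ hj, div_self hi, one_smul, div_mul_div_cancel₀ hi, div_self hj, one_smul]

theorem GLRep.act_monomial_weightSpace
    (hg : ∀ a b, a ≠ w b → (g : Matrix (Fin n) (Fin n) ℂ) a b = 0) {ν : Fin n → ℕ} {v : V}
    (hv : v ∈ R.weightSpace ν) : R.act g v ∈ R.weightSpace (ν ∘ ⇑w⁻¹) := by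
  rw [GLRep.mem_weightSpace_iff] at hv ⊢
  intro i
  have h := R.act_monomial_diff hg (w⁻¹ i) (w⁻¹ i) v
  rw [hv, map_smul, div_self (monomial_entry_ne_zero hg _), one_smul] at h
  have h1 : w (w⁻¹ i) = i := Equiv.apply_symm_apply w i
  rw [h1] at h
  exact h.symm

theorem GLRep.act_monomial_fibre
    (hg : ∀ a b, a ≠ w b → (g : Matrix (Fin n) (Fin n) ℂ) a b = 0) {μ : Fin n → ℕ} {v : V}
    (hv : v ∈ R.fibre μ) : R.act g v ∈ R.fibre μ := by
  have h : R.fibre μ ≤ (R.fibre μ).comap (R.act g) := by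
    refine iSup_le fun u v hv => ?_
    have h1 := R.act_monomial_weightSpace hg hv
    exact (le_iSup (fun w : Equiv.Perm (Fin n) => R.weightSpace (μ ∘ w)) (u * w⁻¹)) h1
  exact h hv

end Monomial

/-! ### Permutations of the columns -/

section Columns

variable {k n : ℕ}

/-- The permutation of the columns of variables. -/
def permCols (k : ℕ) {n : ℕ} (w : Equiv.Perm (Fin n)) : Poly k n →ₐ[ℂ] Poly k n :=
  MvPolynomial.rename fun q : Fin k × Fin n => (q.1, w q.2)

theorem permCols_mulDeriv (w : Equiv.Perm (Fin n)) (a b : Fin k) (i j : Fin n) (f : Poly k n) :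
    permCols k w (mulDeriv (a, i) (b, j) f) =
      mulDeriv (a, w i) (b, w j) (permCols k w f) := by
  classical
  have hinj : Function.Injective fun q : Fin k × Fin n => (q.1, w q.2) := by
    rintro ⟨a, i⟩ ⟨b, j⟩ h
    simp only [Prod.mk.injEq] at h
    exact Prod.ext h.1 (w.injective h.2)
  rw [mulDeriv_apply, mulDeriv_apply, map_mul, permCols, MvPolynomial.rename_X,
    MvPolynomial.pderiv_rename hinj (b, j)]

theorem permCols_colAct (w : Equiv.Perm (Fin n)) (j : Fin n) (X : Matrix (Fin k) (Fin k) ℂ)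
    (f : Poly k n) : permCols k w (colAct j X f) = colAct (w j) X (permCols k w f) := by
  simp only [colAct, LinearMap.sum_apply, LinearMap.smul_apply, map_sum, map_smul,
    permCols_mulDeriv]

theorem permCols_omega {B : Type*} [Fintype B]
    (X X' : Module.Basis B ℂ (LieAlgebra.SpecialLinear.sl (Fin k) ℂ)) (w : Equiv.Perm (Fin n))
    (i j : Fin n) (f : Poly k n) :
    permCols k w (omega X X' i j f) = omega X X' (w i) (w j) (permCols k w f) := by
  simp only [omega, LinearMap.sum_apply, Module.End.mul_apply, map_sum, permCols_colAct]

theorem permCols_rowOp (w : Equiv.Perm (Fin n)) (a b : Fin k) (f : Poly k n) :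
    permCols k w (rowOp a b f) = rowOp a b (permCols k w f) := by
  simp only [rowOp, LinearMap.sum_apply, map_sum, permCols_mulDeriv]
  exact Equiv.sum_comp w fun j => mulDeriv (a, j) (b, j) (permCols k w f)

theorem permCols_colOp (w : Equiv.Perm (Fin n)) (i j : Fin n) (f : Poly k n) :
    permCols k w (colOp i j f) = colOp (w i) (w j) (permCols k w f) := by
  simp only [colOp, LinearMap.sum_apply, map_sum, permCols_mulDeriv]

theorem permCols_mem_kzFibre {lam : ℕ → ℕ} {μ : Fin n → ℕ} (w : Equiv.Perm (Fin n)) {f : Poly k n}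
    (hf : f ∈ kzFibre k lam μ) : permCols k w f ∈ kzFibre k lam μ := by
  have h : kzFibre k lam μ ≤ (kzFibre k lam μ).comap (permCols k w).toLinearMap := by
    refine iSup_le fun u f hf => ?_
    refine (le_iSup (fun w : Equiv.Perm (Fin n) => singular k n lam ⊓ colHomogeneous k (μ ∘ w))
      (u * w⁻¹)) ⟨?_, ?_⟩
    · have h1 := mem_singular_iff.1 hf.1
      refine mem_singular_iff.2 ⟨fun a b hab => ?_, fun a => ?_⟩
      · exact (permCols_rowOp w a b f).symm.trans (by rw [h1.1 a b hab, map_zero])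
      · exact (permCols_rowOp w a a f).symm.trans (by rw [h1.2, map_smul]; rfl)
    · have h1 := mem_colHomogeneous_iff.1 hf.2
      refine mem_colHomogeneous_iff.2 fun j => ?_
      have h2 := permCols_colOp w (w⁻¹ j) (w⁻¹ j) f
      have h3 : w (w⁻¹ j) = j := Equiv.apply_symm_apply w j
      rw [h1, map_smul, h3] at h2
      exact h2.symm
  exact h hf

theorem eval_neg_col {ν : Fin n → ℕ} {p : Poly k n} (hp : p ∈ colHomogeneous k ν) (i : Fin n)
    (x : Fin k × Fin n → ℂ) :
    MvPolynomial.eval (fun q => if q.2 = i then -x q else x q) p =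
      (-1) ^ ν i * MvPolynomial.eval x p := by
  rw [MvPolynomial.eval_eq', MvPolynomial.eval_eq', Finset.mul_sum]
  refine Finset.sum_congr rfl fun α hα => ?_
  have h1 := congrFun (hp (MvPolynomial.mem_support_iff.1 hα)) i
  rw [weight_single_apply] at h1
  rw [mul_left_comm]
  congr 1
  have h2 : ∀ q : Fin k × Fin n, (if q.2 = i then -x q else x q) ^ α q =
      (if q.2 = i then (-1) ^ α q else 1) * x q ^ α q := by
    intro q
    split_ifs
    · rw [neg_pow]
    · rw [one_mul]
  simp only [h2]
  rw [Finset.prod_mul_distrib, ← h1, ← Finset.prod_pow_eq_pow_sum, Fintype.prod_prod_type]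
  congr 1
  exact Finset.prod_congr rfl fun a _ => by simp

/-- The matrix of the lift of a transposition to the normaliser of the torus. -/
theorem exp_mul_exp_mul_exp {i j : Fin n} (hij : i ≠ j) (a b : Fin n) :
    (NormedSpace.exp (Matrix.single i j (1 : ℂ)) * NormedSpace.exp (-Matrix.single j i (1 : ℂ)) *
      NormedSpace.exp (Matrix.single i j (1 : ℂ))) a b =
      if a = Equiv.swap i j b then (if b = i then -1 else 1) else 0 := by
  have h1 := exp_smul_single hij 1
  have h2 := exp_smul_single hij.symm (-1)
  rw [one_smul] at h1
  rw [neg_one_smul] at h2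
  have h3 : (1 + Matrix.single i j (1 : ℂ)) * (1 + -Matrix.single j i (1 : ℂ)) *
      (1 + Matrix.single i j (1 : ℂ)) = 1 + Matrix.single i j 1 - Matrix.single j i 1 -
        Matrix.single i i 1 - Matrix.single j j 1 := by
    simp only [Matrix.add_mul, Matrix.mul_add, Matrix.one_mul, Matrix.mul_neg,
      Matrix.neg_mul, Matrix.single_mul_single_same, mul_one, ne_eq, hij.symm, not_false_eq_true,
      Matrix.single_mul_single_of_ne]
    abel
  rw [h1, h2, h3]
  simp only [Matrix.sub_apply, Matrix.add_apply, Matrix.one_apply, Matrix.single_apply]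
  by_cases hb : b = i
  · subst hb
    rw [Equiv.swap_apply_left]
    by_cases ha : a = b
    · subst ha; simp [hij, hij.symm]
    · by_cases ha' : a = j
      · subst ha'; simp [ha, hij]
      · simp [ha, ha', Ne.symm ha, Ne.symm ha', hij.symm]
  by_cases hb' : b = j
  · subst hb'
    rw [Equiv.swap_apply_right]
    by_cases ha : a = b
    · subst ha; simp [hij, hij.symm]
    · by_cases ha' : a = i
      · subst ha'; simp [hij, hij.symm]
      · simp [ha, ha', Ne.symm ha, Ne.symm ha']
  · rw [Equiv.swap_apply_of_ne_of_ne hb hb']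
    simp [hb, Ne.symm hb, Ne.symm hb']

variable {V : Type*} [AddCommGroup V] [Module ℂ V] {R : GLRep n V} {lam : ℕ → ℕ}
  {ι : V ≃ₗ[ℂ] singular k n lam}

/-- The permutation of two columns is the action of the lift of the transposition, up to the sign
`(-1) ^ E_{ii}`. -/
theorem permCols_swap_equiv
    (hι : ∀ i j v, (ι (R.diff (Matrix.single i j 1) v) : Poly k n) = colOp i j (ι v))
    {i j : Fin n} (hij : i ≠ j) {g : GL (Fin n) ℂ}
    (hg : (g : Matrix (Fin n) (Fin n) ℂ) = NormedSpace.exp (Matrix.single i j (1 : ℂ)) *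
      NormedSpace.exp (-Matrix.single j i (1 : ℂ)) * NormedSpace.exp (Matrix.single i j (1 : ℂ)))
    {ν : Fin n → ℕ} {v : V} (hv : v ∈ R.weightSpace ν) :
    permCols k (Equiv.swap i j) (ι v : Poly k n) = ι (R.act g ((-1 : ℂ) ^ ν i • v)) := by
  refine MvPolynomial.funext fun x => ?_
  rw [eval_equiv_act hι, permCols, MvPolynomial.eval_rename, map_smul, Submodule.coe_smul,
    MvPolynomial.smul_eval]
  have h1 : mulPt x (g : Matrix (Fin n) (Fin n) ℂ) = fun q => if q.2 = i then
      -(x ∘ fun q : Fin k × Fin n => (q.1, Equiv.swap i j q.2)) q else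
      (x ∘ fun q : Fin k × Fin n => (q.1, Equiv.swap i j q.2)) q := by
    funext q
    rw [mulPt, hg, Finset.sum_eq_single (Equiv.swap i j q.2)]
    · rw [exp_mul_exp_mul_exp hij, if_pos rfl]
      split_ifs <;> simp
    · intro c _ hc
      rw [exp_mul_exp_mul_exp hij, if_neg hc, mul_zero]
    · simp
  rw [h1, eval_neg_col ((equiv_mem_colHomogeneous_iff hι).2 hv), ← mul_assoc, ← mul_pow]
  simp

end Columns

/-! ### Logarithms along paths and scalar twists -/

section Logs

variable {n : ℕ}

/-- `ℓ a b`, for `a < b`, is a continuous logarithm of `z_a - z_b` along `γ`. -/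
def IsLogAlong (γ : unitInterval → Conf n) (ℓ : Fin n → Fin n → unitInterval → ℂ) : Prop :=
  ∀ a b, a < b → Continuous (ℓ a b) ∧ ∀ τ, Complex.exp (ℓ a b τ) = (γ τ).1 a - (γ τ).1 b

theorem exists_isLogAlong {γ : unitInterval → Conf n} (hγ : Continuous γ) :
    ∃ ℓ, IsLogAlong γ ℓ := by
  have key : ∀ a b : Fin n, ∃ ℓ : unitInterval → ℂ, a < b →
      Continuous ℓ ∧ ∀ τ, Complex.exp (ℓ τ) = (γ τ).1 a - (γ τ).1 b := by
    intro a b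
    by_cases hab : a < b
    · have hne : ∀ τ, (γ τ).1 a - (γ τ).1 b ≠ 0 := fun τ =>
        sub_ne_zero.2 ((γ τ).2.ne hab.ne)
      have hc : Continuous fun τ => (γ τ).1 a - (γ τ).1 b :=
        ((continuous_apply a).comp (continuous_subtype_val.comp hγ)).sub
          ((continuous_apply b).comp (continuous_subtype_val.comp hγ))
      let g : C(unitInterval, {z : ℂ // z ≠ 0}) :=
        ⟨fun τ => ⟨(γ τ).1 a - (γ τ).1 b, hne τ⟩, hc.subtype_mk _⟩
      have h0 : g 0 = ⟨Complex.exp (Complex.log ((γ 0).1 a - (γ 0).1 b)), Complex.exp_ne_zero _⟩ :=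
        Subtype.ext (Complex.exp_log (hne 0)).symm
      refine ⟨Complex.isCoveringMap_exp.liftPath g _ h0, fun _ => ⟨ContinuousMap.continuous _,
        fun τ => ?_⟩⟩
      exact congrArg Subtype.val (congrFun (Complex.isCoveringMap_exp.liftPath_lifts g _ h0) τ)
    · exact ⟨0, fun h => absurd h hab⟩
  choose ℓ hℓ using key
  exact ⟨ℓ, hℓ⟩

variable {W : Type*} [AddCommGroup W] [Module ℂ W] {A : Fin n → Fin n → Module.End ℂ W} {c : ℂ}
  {F : Submodule ℂ W}

/-- A linear map that intertwines two connections up to a connection form with scalar values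
`∑ d_{ij} d log (z_i - z_j)` takes parallel sections to parallel sections, after multiplication by
`∏ (z_i - z_j) ^ d_{ij}`. -/
theorem IsParallelFun.twist {W' : Type*} [AddCommGroup W'] [Module ℂ W']
    {A' : Fin n → Fin n → Module.End ℂ W'} {c' : ℂ} {F' : Submodule ℂ W'}
    {γ : unitInterval → Conf n} {s : unitInterval → W} (hs : IsParallelFun A c F γ s)
    {ℓ : Fin n → Fin n → unitInterval → ℂ} (hℓ : IsLogAlong γ ℓ) (d : Fin n → Fin n → ℂ)
    (T : W →ₗ[ℂ] W') (hTF : ∀ v ∈ F, T v ∈ F')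
    (hT : ∀ i j, i < j → ∀ v ∈ F, c' • A' i j (T v) = c • T (A i j v) + d i j • T v) :
    IsParallelFun A' c' F' γ
      (fun τ => Complex.exp (∑ i, ∑ j ∈ Finset.Ioi i, d i j * ℓ i j τ) • T (s τ)) := by
  intro τ₀
  obtain ⟨U, f, hU, hUi, hτ, hf, hsf⟩ := hs τ₀
  set z₀ := (γ τ₀).1 with hz₀
  have hne₀ : ∀ i j : Fin n, i < j → z₀ i - z₀ j ≠ 0 := fun i j h =>
    sub_ne_zero.2 ((γ τ₀).2.ne h.ne)
  -- near `z₀` the logarithms are given by the principal branch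
  let L : Fin n → Fin n → (Fin n → ℂ) → ℂ := fun i j z =>
    ℓ i j τ₀ + Complex.log ((z i - z j) / (z₀ i - z₀ j))
  let U' : Set (Fin n → ℂ) := ⋂ i : Fin n, ⋂ j : Fin n, ⋂ _ : i < j,
    {z | (z i - z j) / (z₀ i - z₀ j) ∈ Complex.slitPlane}
  have hU' : IsOpen U' := isOpen_iInter_of_finite fun i => isOpen_iInter_of_finite fun j =>
    isOpen_iInter_of_finite fun _ => Complex.isOpen_slitPlane.preimage (by fun_prop)
  have hmem : ∀ z, z ∈ U' ↔ ∀ i j : Fin n, i < j →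
      (z i - z j) / (z₀ i - z₀ j) ∈ Complex.slitPlane := fun z => by
    simp [U']
  refine ⟨U ∩ U', fun z => Complex.exp (∑ i, ∑ j ∈ Finset.Ioi i, d i j * L i j z) • T (f z),
    hU.inter hU', Set.inter_subset_left.trans hUi, ⟨hτ, ?_⟩, fun z hz => ⟨?_, fun φ => ?_⟩, ?_⟩
  · refine (hmem _).2 fun i j hij => ?_
    rw [div_self (hne₀ i j hij)]
    exact Complex.one_mem_slitPlane
  · exact F'.smul_mem _ (hTF _ (hf z hz.1).1)
  · have hL : ∀ i j : Fin n, i < j → HasFDerivAt (L i j) ((z i - z j)⁻¹ •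
        ((ContinuousLinearMap.proj i : (Fin n → ℂ) →L[ℂ] ℂ) - ContinuousLinearMap.proj j)) z := by
      intro i j hij
      have h1 : HasFDerivAt (fun z : Fin n → ℂ => (z i - z j) / (z₀ i - z₀ j))
          ((z₀ i - z₀ j)⁻¹ • ((ContinuousLinearMap.proj i : (Fin n → ℂ) →L[ℂ] ℂ) -
            ContinuousLinearMap.proj j)) z := by
        simp only [div_eq_inv_mul]
        exact ((((ContinuousLinearMap.proj i : (Fin n → ℂ) →L[ℂ] ℂ) -
          ContinuousLinearMap.proj j)).hasFDerivAt).const_mul _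
      have h2 := (h1.clog ((hmem z).1 hz.2 i j hij)).const_add (ℓ i j τ₀)
      refine h2.congr_fderiv ?_
      rw [smul_smul]
      congr 1
      have := hne₀ i j hij
      rw [inv_div, div_mul_eq_mul_div, mul_inv_cancel₀ this, one_div]
    have hsum : HasFDerivAt (fun z => ∑ i, ∑ j ∈ Finset.Ioi i, d i j * L i j z)
        (∑ i : Fin n, ∑ j ∈ Finset.Ioi i, d i j • (z i - z j)⁻¹ •
          ((ContinuousLinearMap.proj i : (Fin n → ℂ) →L[ℂ] ℂ) - ContinuousLinearMap.proj j)) z :=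
      HasFDerivAt.fun_sum fun i _ => HasFDerivAt.fun_sum fun j hj =>
        (hL i j (Finset.mem_Ioi.1 hj)).const_mul (d i j)
    have h := hsum.cexp.mul ((hf z hz.1).2 (φ ∘ₗ T))
    simp only [map_smul, smul_eq_mul]
    refine h.congr_fderiv ?_
    refine ContinuousLinearMap.ext fun u => ?_
    simp only [add_apply, sum_apply, smul_apply, smul_eq_mul, Finset.mul_sum,
      ← Finset.sum_add_distrib]
    refine Finset.sum_congr rfl fun i _ => Finset.sum_congr rfl fun j hj => ?_
    have h1 := congrArg φ (hT i j (Finset.mem_Ioi.1 hj) _ (hf z hz.1).1)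
    simp only [map_add, map_smul, smul_eq_mul] at h1
    simp only [LinearMap.comp_apply]
    rw [mul_left_comm c', h1]
    ring
  · have hIm : ∀ᶠ τ in 𝓝 τ₀, ∀ i j : Fin n, i < j → ‖ℓ i j τ - ℓ i j τ₀‖ < Real.pi := by
      refine Filter.eventually_all.2 fun i => Filter.eventually_all.2 fun j => ?_
      by_cases hij : i < j
      · have hc : Filter.Tendsto (fun τ => ‖ℓ i j τ - ℓ i j τ₀‖) (𝓝 τ₀) (𝓝 0) := by
          have h1 := (((hℓ i j hij).1.sub continuous_const).norm).tendsto
            (x := τ₀) (f := fun τ => ‖ℓ i j τ - ℓ i j τ₀‖)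
          simpa using h1
        exact (hc.eventually_lt_const Real.pi_pos).mono fun τ h _ => h
      · exact Filter.Eventually.of_forall fun τ h => absurd h hij
    filter_upwards [hsf, hIm] with τ h1 h2
    rw [h1]
    congr 2
    refine Finset.sum_congr rfl fun i _ => Finset.sum_congr rfl fun j hj => ?_
    have hij := Finset.mem_Ioi.1 hj
    congr 1
    have h3 := (Complex.abs_im_le_norm (ℓ i j τ - ℓ i j τ₀)).trans_lt (h2 i j hij)
    have h4 := abs_lt.1 h3
    simp only [L]
    rw [hz₀, ← (hℓ i j hij).2 τ, ← (hℓ i j hij).2 τ₀, ← Complex.exp_sub,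
      Complex.log_exp h4.1 h4.2.le, add_sub_cancel]

theorem IsParallelFun.mono {F' : Submodule ℂ W} (h : F ≤ F') {γ : unitInterval → Conf n}
    {s : unitInterval → W} (hs : IsParallelFun A c F γ s) : IsParallelFun A c F' γ s := by
  intro τ
  obtain ⟨U, f, hU, hUi, hτ, hf, hsf⟩ := hs τ
  exact ⟨U, f, hU, hUi, hτ, fun z hz => ⟨h (hf z hz).1, (hf z hz).2⟩, hsf⟩

end Logs

/-! ### Logarithms along a half-twist -/

section HalfTwist

variable {n : ℕ} {t : Fin n → ℝ} (ht : StrictAnti t) {i j : Fin n} (hij : (i : ℕ) + 1 = j)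

/-- The logarithms of `z_a - z_b` along the half-twist that are real at the start. The difference
`z_i - z_j` turns by the angle `π`; the other differences stay in the right half-plane, where the
principal branch applies. -/
def twistLog (t : Fin n → ℝ) (i j a b : Fin n) (τ : unitInterval) : ℂ :=
  if a = i ∧ b = j then Real.log (t i - t j) + Complex.I * Real.pi * (τ : ℝ)
  else Complex.log (halfTwistFun t i j τ a - halfTwistFun t i j τ b)

include ht hij in
theorem halfTwistFun_re_mem {l : Fin n} (hl : l = i ∨ l = j) (τ : ℝ) :
    t j ≤ (halfTwistFun t i j τ l).re ∧ (halfTwistFun t i j τ l).re ≤ t i := by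
  have hlt : i < j := Fin.lt_def.2 (by omega)
  have hd : 0 < t i - t j := sub_pos.2 (ht hlt)
  have he : ‖Complex.exp (Real.pi * τ * Complex.I)‖ = 1 := by
    have : (Real.pi * τ * Complex.I : ℂ) = ((Real.pi * τ : ℝ) : ℂ) * Complex.I := by push_cast; ring
    rw [this, Complex.norm_exp_ofReal_mul_I]
  have hre := abs_le.1 ((Complex.abs_re_le_norm _).trans he.le)
  rcases hl with rfl | rfl
  · rw [halfTwistFun, if_pos rfl, Complex.add_re, Complex.re_ofReal_mul, Complex.ofReal_re]
    constructor <;> nlinarith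
  · rw [halfTwistFun, if_neg hlt.ne', if_pos rfl, Complex.sub_re, Complex.re_ofReal_mul,
      Complex.ofReal_re]
    constructor <;> nlinarith

include ht hij in
theorem halfTwistFun_re_pos {a b : Fin n} (hab : a < b) (h : ¬(a = i ∧ b = j)) (τ : ℝ) :
    0 < (halfTwistFun t i j τ a - halfTwistFun t i j τ b).re := by
  have hfar : ∀ l, l ≠ i → l ≠ j → (halfTwistFun t i j τ l).re = t l := fun l h1 h2 => by
    rw [halfTwistFun, if_neg h1, if_neg h2, Complex.ofReal_re]
  have hab' := Fin.lt_def.1 hab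
  rw [Complex.sub_re, sub_pos]
  by_cases ha : a = i ∨ a = j
  · have hb : ¬(b = i ∨ b = j) := by
      rintro (rfl | rfl) <;> rcases ha with rfl | rfl
      · exact lt_irrefl _ hab
      · omega
      · exact h ⟨rfl, rfl⟩
      · exact lt_irrefl _ hab
    push Not at hb
    rw [hfar b hb.1 hb.2]
    refine lt_of_lt_of_le (ht ?_) (halfTwistFun_re_mem ht hij ha τ).1
    have h2 : (b : ℕ) ≠ j := fun h => hb.2 (Fin.ext h)
    have h3 : (i : ℕ) ≤ a := by
      rcases ha with rfl | rfl <;> omega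
    exact Fin.lt_def.2 (by omega)
  · push Not at ha
    rw [hfar a ha.1 ha.2]
    by_cases hb : b = i ∨ b = j
    · refine lt_of_le_of_lt (halfTwistFun_re_mem ht hij hb τ).2 (ht ?_)
      have h2 : (a : ℕ) ≠ i := fun h => ha.1 (Fin.ext h)
      have h3 : (b : ℕ) ≤ j := by
        rcases hb with rfl | rfl <;> omega
      exact Fin.lt_def.2 (by omega)
    · push Not at hb
      rw [hfar b hb.1 hb.2]
      exact ht hab

theorem isLogAlong_twistLog : IsLogAlong (halfTwist t ht i j hij) (twistLog t i j) := by
  have hlt : i < j := Fin.lt_def.2 (by omega)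
  intro a b hab
  by_cases h : a = i ∧ b = j
  · obtain ⟨rfl, rfl⟩ := h
    constructor
    · have h1 : twistLog t a b a b = fun τ : unitInterval =>
          (Real.log (t a - t b) : ℂ) + Complex.I * Real.pi * ((τ : ℝ) : ℂ) :=
        funext fun τ => if_pos ⟨rfl, rfl⟩
      rw [h1]
      fun_prop
    · intro τ
      have hd : (0 : ℝ) < t a - t b := sub_pos.2 (ht hlt)
      change _ = halfTwistFun t a b τ a - halfTwistFun t a b τ b
      rw [twistLog, if_pos ⟨rfl, rfl⟩, halfTwistFun, halfTwistFun, if_pos rfl, if_neg hlt.ne',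
        if_pos rfl, Complex.exp_add, ← Complex.ofReal_exp, Real.exp_log hd,
        show Complex.I * Real.pi * ((τ : ℝ) : ℂ) = Real.pi * ((τ : ℝ) : ℂ) * Complex.I by ring]
      push_cast
      ring
  · have hpos := halfTwistFun_re_pos ht hij hab h
    constructor
    · have h1 : twistLog t i j a b = fun τ : unitInterval =>
          Complex.log (halfTwistFun t i j τ a - halfTwistFun t i j τ b) :=
        funext fun τ => if_neg h
      rw [h1]
      have hc : ∀ l, Continuous fun τ : unitInterval => halfTwistFun t i j τ l := fun l =>
        ((continuous_apply l).comp continuous_subtype_val).comp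
          (halfTwist t ht i j hij).continuous
      refine continuous_iff_continuousAt.2 fun τ => ?_
      exact ((hc a).sub (hc b)).continuousAt.clog (Or.inl (hpos τ))
    · intro τ
      rw [twistLog, if_neg h, Complex.exp_log]
      · rfl
      · intro h0
        have := hpos τ
        rw [h0] at this
        exact lt_irrefl _ this

include ht hij in
theorem twistLog_zero {a b : Fin n} (hab : a < b) :
    twistLog t i j a b 0 = (Real.log (t a - t b) : ℂ) := by
  rw [twistLog]
  split_ifs with h
  · rw [h.1, h.2]; simp
  · have h0 : ∀ l, halfTwistFun t i j (0 : unitInterval) l = (t l : ℂ) := fun l =>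
      congrFun (congrArg Subtype.val (halfTwist t ht i j hij).source) l
    rw [h0, h0, ← Complex.ofReal_sub, Complex.ofReal_log (sub_pos.2 (ht hab)).le]

include ht hij in
theorem twistLog_one {a b : Fin n} (hab : a < b) : twistLog t i j a b 1 =
    (Real.log (t (Equiv.swap i j a) - t (Equiv.swap i j b)) : ℂ) +
      if a = i ∧ b = j then Complex.I * Real.pi else 0 := by
  -- for the pair `(i, j)` the argument of `Real.log` is negative, and its value is the logarithm of
  -- the absolute value
  rw [twistLog]
  split_ifs with h
  · rw [h.1, h.2, Equiv.swap_apply_left, Equiv.swap_apply_right, ← neg_sub (t i),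
      Real.log_neg_eq_log]
    simp
  · have h1 : ∀ l, halfTwistFun t i j (1 : unitInterval) l = (t (Equiv.swap i j l) : ℂ) := fun l =>
      congrFun (congrArg Subtype.val (halfTwist t ht i j hij).target) l
    have h2 := halfTwistFun_re_pos ht hij hab h (1 : unitInterval)
    rw [h1, h1, ← Complex.ofReal_sub, Complex.ofReal_re] at h2
    rw [h1, h1, ← Complex.ofReal_sub, Complex.ofReal_log h2.le, add_zero]

include ht hij in
theorem sum_twistLog_zero (d : Fin n → Fin n → ℂ) :
    ∑ a, ∑ b ∈ Finset.Ioi a, d a b * twistLog t i j a b 0 =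
      ∑ a, ∑ b ∈ Finset.Ioi a, d a b * (Real.log (t a - t b) : ℂ) :=
  Finset.sum_congr rfl fun a _ => Finset.sum_congr rfl fun b hb => by
    rw [twistLog_zero ht hij (Finset.mem_Ioi.1 hb)]

include ht hij in
/-- The effect of the half-twist on `∏ (z_a - z_b) ^ d_{ab}`: the exponents are permuted, and the
pair that is interchanged contributes a phase. -/
theorem sum_twistLog_one {d : Fin n → Fin n → ℂ} (hd : ∀ a b, d a b = d b a) :
    ∑ a, ∑ b ∈ Finset.Ioi a, d a b * twistLog t i j a b 1 =
      ∑ a, ∑ b ∈ Finset.Ioi a, d (Equiv.swap i j a) (Equiv.swap i j b) *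
        (Real.log (t a - t b) : ℂ) + d i j * (Complex.I * Real.pi) := by
  have hlt : i < j := Fin.lt_def.2 (by omega)
  have h1 := sum_Ioi_comp_perm (Equiv.swap i j)
    (fun a b => d (Equiv.swap i j a) (Equiv.swap i j b) * (Real.log (t a - t b) : ℂ))
    (fun a b => by
      rw [hd, ← neg_sub (t a), Real.log_neg_eq_log])
    (fun a => by simp)
  rw [← h1]
  simp only [Equiv.swap_apply_self]
  have h2 : ∑ a, ∑ b ∈ Finset.Ioi a, d a b * (if a = i ∧ b = j then Complex.I * Real.pi else 0) =
      d i j * (Complex.I * Real.pi) := by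
    rw [Finset.sum_eq_single i, Finset.sum_eq_single j]
    · rw [if_pos ⟨rfl, rfl⟩]
    · intro b _ hb
      rw [if_neg (fun h => hb h.2), mul_zero]
    · intro h
      exact absurd (Finset.mem_Ioi.2 hlt) h
    · intro a _ ha
      refine Finset.sum_eq_zero fun b _ => ?_
      rw [if_neg (fun h => ha h.1), mul_zero]
    · simp
  rw [← h2, ← Finset.sum_add_distrib]
  refine Finset.sum_congr rfl fun a _ => ?_
  rw [← Finset.sum_add_distrib]
  refine Finset.sum_congr rfl fun b hb => ?_
  rw [twistLog_one ht hij (Finset.mem_Ioi.1 hb), mul_add]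

end HalfTwist

/-! ### The lift of the braid group to the normaliser of the torus -/

section Tits

variable {n : ℕ}

/-- The diagonal of `E_{ii} + E_{jj}`. -/
def pairInd (i j l : Fin n) : ℂ := (if i = l then 1 else 0) + if j = l then 1 else 0

theorem pairInd_symm (i j l : Fin n) : pairInd i j l = pairInd j i l := add_comm _ _

theorem pairInd_perm (w : Equiv.Perm (Fin n)) (i j l : Fin n) :
    pairInd (w i) (w j) (w l) = pairInd i j l := by
  simp [pairInd, w.injective.eq_iff]

theorem sum_pairInd (i j : Fin n) : ∑ l, pairInd i j l = 2 := by
  simp only [pairInd, Finset.sum_add_distrib, Finset.sum_ite_eq, Finset.mem_univ, if_true]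
  norm_num

/-- `E_{ii} + E_{jj}` as an operator on `ℂ ^ n`. -/
def pairOp (i j : Fin n) : Module.End ℂ (Fin n → ℂ) := LinearMap.mulLeft ℂ (pairInd i j)

theorem pairOp_apply (i j : Fin n) (v : Fin n → ℂ) : pairOp i j v = pairInd i j * v := rfl

theorem isFlatOn_pairOp : IsFlatOn (pairOp (n := n)) ⊤ where
  finite := inferInstance
  mapsTo _ _ _ _ _ := Submodule.mem_top
  symm i j _ v _ := by rw [pairOp, pairOp, funext (pairInd_symm i j)]
  disj i j k l _ _ _ _ _ _ v _ := by simp only [pairOp_apply]; ring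
  tri i j k _ _ _ v _ := by simp only [pairOp_apply]; ring

/-- The permutation representation of `𝔖_n`. -/
def permRep (n : ℕ) : Equiv.Perm (Fin n) →* Module.End ℂ (Fin n → ℂ) where
  toFun w := LinearMap.funLeft ℂ ℂ ⇑w⁻¹
  map_one' := rfl
  map_mul' w w' := by rw [mul_inv_rev]; rfl

theorem permRep_single (w : Equiv.Perm (Fin n)) (l : Fin n) (x : ℂ) :
    permRep n w (Pi.single l x) = Pi.single (w l) x := by
  funext a
  change (Pi.single l x : Fin n → ℂ) (w⁻¹ a) = (Pi.single (w l) x : Fin n → ℂ) a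
  rw [Pi.single_apply, Pi.single_apply]
  exact if_congr (Equiv.symm_apply_eq w) rfl rfl

theorem permRep_pairOp (w : Equiv.Perm (Fin n)) (i j : Fin n) (v : Fin n → ℂ) :
    permRep n w (pairOp i j v) = pairOp (w i) (w j) (permRep n w v) := by
  funext a
  change pairInd i j (w⁻¹ a) * v (w⁻¹ a) = pairInd (w i) (w j) a * v (w⁻¹ a)
  rw [← pairInd_perm w i j (w⁻¹ a)]
  congr 2
  exact Equiv.apply_symm_apply w a

/-- Constant functions are parallel for the trivial connection. -/
theorem isParallelFun_const {W : Type*} [AddCommGroup W] [Module ℂ W] {F : Submodule ℂ W} {v : W}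
    (hv : v ∈ F) (γ : unitInterval → Conf n) : IsParallelFun 0 0 F γ fun _ => v := by
  intro τ
  refine ⟨{z | Function.Injective z}, fun _ => v, isOpen_injective, subset_rfl, (γ τ).2,
    fun z _ => ⟨hv, fun φ => ?_⟩, Filter.Eventually.of_forall fun _ => rfl⟩
  refine (hasFDerivAt_const (φ v) z).congr_fderiv (ContinuousLinearMap.ext fun u => ?_)
  simp only [sum_apply, smul_apply, smul_eq_mul, zero_mul, zero_div, Finset.sum_const_zero]
  rfl

/-- The monodromy of `d - 1/2 ∑ d log (z_i - z_j) (E_{ii} + E_{jj})` is given by monomial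
matrices. -/
theorem IsMonodromy.apply_single {z : Conf n} {π : BraidGroup z →*
      ((⊤ : Submodule ℂ (Fin n → ℂ)) ≃ₗ[ℂ] (⊤ : Submodule ℂ (Fin n → ℂ)))}
    (hπ : IsMonodromy pairOp (1 / 2) ⊤ (fun _ w v => permRep n w v) π) {w : Equiv.Perm (Fin n)}
    (γ : Path z (w⁻¹ • z)) {ℓ : Fin n → Fin n → unitInterval → ℂ} (hℓ : IsLogAlong γ ℓ)
    (l : Fin n) : (π (braidOf w γ) ⟨Pi.single l 1, Submodule.mem_top⟩ : Fin n → ℂ) =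
      Pi.single (w l) (Complex.exp (∑ a, ∑ b ∈ Finset.Ioi a, 1 / 2 * pairInd a b l * ℓ a b 1 -
        ∑ a, ∑ b ∈ Finset.Ioi a, 1 / 2 * pairInd a b l * ℓ a b 0)) := by
  obtain ⟨s, hs, hs0, hs1⟩ := hπ w γ ⟨Pi.single l 1, Submodule.mem_top⟩
  have h1 := (isParallelFun_const (F := Submodule.span ℂ {(Pi.single l 1 : Fin n → ℂ)})
    (Submodule.mem_span_singleton_self _) γ).twist (A' := pairOp) (c' := 1 / 2) (F' := ⊤) hℓ
    (fun a b => 1 / 2 * pairInd a b l) LinearMap.id (fun _ _ => Submodule.mem_top)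
    (fun i j _ v hv => by
      obtain ⟨x, rfl⟩ := Submodule.mem_span_singleton.1 hv
      rw [zero_smul, zero_add, LinearMap.id_apply, pairOp_apply]
      funext a
      by_cases ha : a = l
      · subst ha
        simp only [Pi.smul_apply, Pi.mul_apply, Pi.single_eq_same, smul_eq_mul]
        ring
      · simp [ha])
  have h2 := h1.smul (Complex.exp (-∑ a, ∑ b ∈ Finset.Ioi a, 1 / 2 * pairInd a b l * ℓ a b 0))
  have h3 := IsParallelFun.eq_of_eq isFlatOn_pairOp γ.continuous hs h2 (by
    rw [hs0, smul_smul, ← Complex.exp_add, neg_add_cancel, Complex.exp_zero, one_smul]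
    rfl) 1
  rw [hs1]
  change permRep n w (s 1) = _
  rw [h3, smul_smul, ← Complex.exp_add, neg_add_eq_sub, LinearMap.id_apply, map_smul,
    permRep_single, ← Pi.single_smul, smul_eq_mul, mul_one]

/-- The Vandermonde product changes along a path from `z` to `w⁻¹ z` by the sign of `w`. -/
theorem IsLogAlong.exp_sum {z : Conf n} {w : Equiv.Perm (Fin n)} {γ : Path z (w⁻¹ • z)}
    {ℓ : Fin n → Fin n → unitInterval → ℂ} (hℓ : IsLogAlong γ ℓ) :
    Complex.exp (∑ a, ∑ b ∈ Finset.Ioi a, ℓ a b 1 - ∑ a, ∑ b ∈ Finset.Ioi a, ℓ a b 0) =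
      ((Equiv.Perm.sign w : ℤ) : ℂ) := by
  have h1 : Complex.exp (∑ a, ∑ b ∈ Finset.Ioi a, ℓ a b 1) =
      ∏ a, ∏ b ∈ Finset.Ioi a, (z.1 (w a) - z.1 (w b)) := by
    rw [Complex.exp_sum]
    refine Finset.prod_congr rfl fun a _ => ?_
    rw [Complex.exp_sum]
    refine Finset.prod_congr rfl fun b hb => ?_
    rw [(hℓ a b (Finset.mem_Ioi.1 hb)).2 1]
    have h2 : ∀ l, (γ 1).1 l = z.1 (w l) := fun l => by
      rw [γ.target, Conf.smul_val, inv_inv]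
    rw [h2, h2]
  have h0 : Complex.exp (∑ a, ∑ b ∈ Finset.Ioi a, ℓ a b 0) =
      ∏ a, ∏ b ∈ Finset.Ioi a, (z.1 a - z.1 b) := by
    rw [Complex.exp_sum]
    refine Finset.prod_congr rfl fun a _ => ?_
    rw [Complex.exp_sum]
    refine Finset.prod_congr rfl fun b hb => ?_
    rw [(hℓ a b (Finset.mem_Ioi.1 hb)).2 0, γ.source]
  rw [Complex.exp_sub, h1, w.prod_Ioi_comp_eq_sign_mul_prod (f := fun a b => z.1 a - z.1 b)
    (fun a b => (neg_sub _ _).symm), ← h0, mul_div_cancel_right₀ _ (Complex.exp_ne_zero _)]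

/-- The lift of the Weyl group is a monodromy representation: that of
`d - 1/2 ∑ d log (z_i - z_j) (E_{ii} + E_{jj})` on `ℂ ^ n`, on which `𝔖_n` acts by permutations,
conjugated by a diagonal matrix that normalises the images of the generators. -/
theorem exists_isTitsHom (t : Fin n → ℝ) (ht : StrictAnti t) : ∃ σ, IsTitsHom t ht σ := by
  set z := basePt t ht with hz
  obtain ⟨π, hπ'⟩ := exists_forall_isMonodromy_iff (z := z) isFlatOn_pairOp (1 / 2)
    ((permRep n).comp (MonoidHom.snd _ _)) (fun _ _ _ => Submodule.mem_top)
    (fun w _ i j _ v _ => permRep_pairOp w i j v)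
  have hπ : IsMonodromy pairOp (1 / 2) ⊤ (fun _ w v => permRep n w v) π := (hπ' π).2 rfl
  let ψ : BraidGroup z → Module.End ℂ (Fin n → ℂ) := fun b =>
    (⊤ : Submodule ℂ (Fin n → ℂ)).subtype ∘ₗ (π b).toLinearMap ∘ₗ
      Submodule.topEquiv.symm.toLinearMap
  have hψ : ∀ b b', ψ (b * b') = ψ b * ψ b' := fun b b' => by
    refine LinearMap.ext fun v => ?_
    change (π (b * b') _ : Fin n → ℂ) = (π b _ : Fin n → ℂ)
    rw [map_mul]
    rfl
  have hentry : ∀ (w : Equiv.Perm (Fin n)) (γ : Path z (w⁻¹ • z))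
      (ℓ : Fin n → Fin n → unitInterval → ℂ), IsLogAlong γ ℓ → ∀ a l,
      LinearMap.toMatrix' (ψ (braidOf w γ)) a l = if a = w l then
        Complex.exp (∑ a, ∑ b ∈ Finset.Ioi a, 1 / 2 * pairInd a b l * ℓ a b 1 -
          ∑ a, ∑ b ∈ Finset.Ioi a, 1 / 2 * pairInd a b l * ℓ a b 0) else 0 := by
    intro w γ ℓ hℓ a l
    rw [LinearMap.toMatrix'_apply]
    have h := congrFun (hπ.apply_single γ hℓ l) a
    rw [Pi.single_apply] at h
    exact h
  -- the diagonal matrix used for the normalisation: `Λ` removes the factors `t a - t b`, and the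
  -- second summand of `η` replaces the entries `I`, `I` of the generators by `-1`, `1`
  let Λ : Fin n → ℂ := fun l =>
    ∑ a, ∑ b ∈ Finset.Ioi a, 1 / 2 * pairInd a b l * (Real.log (t a - t b) : ℂ)
  let η : Fin n → ℂ := fun l => Λ l - (l : ℂ) * (Complex.I * Real.pi / 2)
  let D : Matrix (Fin n) (Fin n) ℂ := Matrix.diagonal fun l => Complex.exp (η l)
  let D' : Matrix (Fin n) (Fin n) ℂ := Matrix.diagonal fun l => Complex.exp (-η l)
  have hDD' : D * D' = 1 := by
    simp only [D, D', Matrix.diagonal_mul_diagonal, ← Complex.exp_add, add_neg_cancel,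
      Complex.exp_zero, Matrix.diagonal_one]
  let N : BraidGroup z → Matrix (Fin n) (Fin n) ℂ := fun b => D' * LinearMap.toMatrix' (ψ b) * D
  have hNmul : ∀ b b', N (b * b') = N b * N b' := fun b b' => by
    simp only [N]
    rw [hψ, LinearMap.toMatrix'_mul]
    calc _ = D' * LinearMap.toMatrix' (ψ b) * 1 * (LinearMap.toMatrix' (ψ b') * D) := by
          simp only [Matrix.mul_assoc, Matrix.one_mul]
      _ = _ := by rw [← hDD']; simp only [Matrix.mul_assoc]
  have hNentry : ∀ b a l, N b a l =
      Complex.exp (-η a) * LinearMap.toMatrix' (ψ b) a l * Complex.exp (η l) := fun b a l => by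
    simp only [N, D, D', Matrix.mul_diagonal, Matrix.diagonal_mul]
  -- the determinant is the sign of the permutation times the change of the Vandermonde product
  have hdet : ∀ b, (N b).det = 1 := by
    intro b
    obtain ⟨w, γ, rfl⟩ := exists_braidOf b
    obtain ⟨ℓ, hℓ⟩ := exists_isLogAlong γ.continuous
    have h1 : (N (braidOf w γ)).det = (LinearMap.toMatrix' (ψ (braidOf w γ))).det := by
      simp only [N]
      rw [Matrix.det_mul, Matrix.det_mul, mul_comm, ← mul_assoc, ← Matrix.det_mul, hDD',
        Matrix.det_one, one_mul]
    have h2 : LinearMap.toMatrix' (ψ (braidOf w γ)) = (Matrix.diagonal fun l =>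
        Complex.exp (∑ a, ∑ b ∈ Finset.Ioi a, 1 / 2 * pairInd a b l * ℓ a b 1 -
          ∑ a, ∑ b ∈ Finset.Ioi a, 1 / 2 * pairInd a b l * ℓ a b 0)).submatrix ⇑w⁻¹ id := by
      refine Matrix.ext fun a l => ?_
      rw [hentry w γ ℓ hℓ, Matrix.submatrix_apply, Matrix.diagonal_apply, id]
      have h3 : w⁻¹ a = l ↔ a = w l := Equiv.symm_apply_eq w
      by_cases h : a = w l
      · rw [if_pos h, if_pos (h3.2 h), h3.2 h]
      · rw [if_neg h, if_neg (fun h' => h (h3.1 h'))]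
    have h3 : ∀ τ, ∑ l, ∑ a, ∑ b ∈ Finset.Ioi a, 1 / 2 * pairInd a b l * ℓ a b τ =
        ∑ a, ∑ b ∈ Finset.Ioi a, ℓ a b τ := fun τ => by
      rw [Finset.sum_comm]
      refine Finset.sum_congr rfl fun a _ => ?_
      rw [Finset.sum_comm]
      refine Finset.sum_congr rfl fun b _ => ?_
      rw [← Finset.sum_mul, ← Finset.mul_sum, sum_pairInd]
      norm_num
    rw [h1, h2, Matrix.det_permute, Matrix.det_diagonal, ← Complex.exp_sum,
      Finset.sum_sub_distrib, h3, h3, hℓ.exp_sum, Equiv.Perm.sign_inv, ← Int.cast_mul,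
      ← Units.val_mul, Int.units_mul_self]
    simp
  refine ⟨MonoidHom.mk' (fun b => ⟨N b, hdet b⟩) fun b b' => Subtype.ext (hNmul b b'),
    fun w γ a b hab => ?_, fun i j hij => ?_⟩
  · change N (braidOf w γ) a b = 0
    obtain ⟨ℓ, hℓ⟩ := exists_isLogAlong γ.continuous
    rw [hNentry, hentry w γ ℓ hℓ, if_neg hab, mul_zero, zero_mul]
  · have hne : i ≠ j := fun h => by rw [h] at hij; omega
    refine Matrix.ext fun a l => ?_
    change N (braidGen t ht i j hij) a l = _
    rw [exp_mul_exp_mul_exp hne, hNentry, braidGen,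
      hentry _ _ _ (isLogAlong_twistLog ht hij)]
    by_cases h : a = Equiv.swap i j l
    · rw [if_pos h, if_pos h, h]
      have h1 := sum_twistLog_one ht hij (d := fun a b => 1 / 2 * pairInd a b l)
        (fun a b => by rw [pairInd_symm])
      have h2 := sum_twistLog_zero ht hij (fun a b => 1 / 2 * pairInd a b l)
      have h3 : ∀ a b, pairInd (Equiv.swap i j a) (Equiv.swap i j b) l =
          pairInd a b (Equiv.swap i j l) := fun a b => by
        rw [← pairInd_perm (Equiv.swap i j) a b, Equiv.swap_apply_self]
      simp only [h3] at h1
      rw [h1, h2, ← Complex.exp_add, ← Complex.exp_add]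
      have h4 : -η (Equiv.swap i j l) + (Λ (Equiv.swap i j l) +
          1 / 2 * pairInd i j l * (Complex.I * Real.pi) - Λ l) + η l =
          (((Equiv.swap i j l : Fin n) : ℂ) - (l : ℂ) + pairInd i j l) *
            (Complex.I * Real.pi / 2) := by
        simp only [η]; ring
      rw [h4]
      have hijc : ((j : ℕ) : ℂ) = (i : ℕ) + 1 := by rw [← hij]; push_cast; rfl
      by_cases hl : l = i
      · subst hl
        rw [if_pos rfl, Equiv.swap_apply_left, hijc, pairInd, if_pos rfl, if_neg hne.symm]
        rw [← Complex.exp_pi_mul_I]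
        congr 1
        ring
      rw [if_neg hl]
      by_cases hl' : l = j
      · subst hl'
        rw [Equiv.swap_apply_right, hijc, pairInd, if_pos rfl, if_neg hne, ← Complex.exp_zero]
        congr 1
        ring
      · rw [Equiv.swap_apply_of_ne_of_ne hl hl', pairInd, if_neg (Ne.symm hl), if_neg (Ne.symm hl'),
          ← Complex.exp_zero]
        congr 1
        ring
    · rw [if_neg h, if_neg h, mul_zero, zero_mul]

end Tits

/-! ### Flatness of the two connections -/

section Flat

variable {n : ℕ}

theorem IsInfinitesimalBraid.isFlatOn {W : Type*} [AddCommGroup W] [Module ℂ W]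
    {B A : Fin n → Fin n → Module.End ℂ W} (hB : IsInfinitesimalBraid B) {r : ℂ}
    (hA : ∀ i j, i ≠ j → A i j = r • B i j) {F : Submodule ℂ W} (hF : FiniteDimensional ℂ F)
    (hAF : ∀ i j, i ≠ j → ∀ v ∈ F, A i j v ∈ F) : IsFlatOn A F where
  finite := hF
  mapsTo := hAF
  symm i j h v _ := by rw [hA i j h, hA j i h.symm, hB.symm i j h]
  disj i j k l h1 h2 h3 h4 h5 h6 v _ := by
    have h := LinearMap.congr_fun (hB.disj i j k l h1 h2 h3 h4 h5 h6) v
    simp only [Module.End.mul_apply] at h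
    simp only [hA i j h1, hA k l h2, LinearMap.smul_apply, map_smul, h]
  tri i j k h1 h2 h3 v _ := by
    have h := LinearMap.congr_fun (hB.tri i j k h1 h2 h3) v
    simp only [Module.End.mul_apply, LinearMap.add_apply] at h
    simp only [hA i j h1, hA i k h2, hA j k h3, LinearMap.smul_apply, map_smul, ← smul_add, h]

variable {V : Type*} [AddCommGroup V] [Module ℂ V] (R : GLRep n V)

theorem GLRep.kappa_mem_weightSpace {i j : Fin n} (hij : i ≠ j) {ν : Fin n → ℕ} {v : V}
    (hv : v ∈ R.weightSpace ν) : R.kappa i j v ∈ R.weightSpace ν := by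
  rw [GLRep.mem_weightSpace_iff] at hv ⊢
  intro a
  have h := LinearMap.congr_fun (R.isGlAction.diag_casimir_comm a hij).eq v
  rw [Module.End.mul_apply, Module.End.mul_apply, hv, map_smul] at h
  exact h

theorem GLRep.kappa_mem_fibre {i j : Fin n} (hij : i ≠ j) {μ : Fin n → ℕ} {v : V}
    (hv : v ∈ R.fibre μ) : R.kappa i j v ∈ R.fibre μ := by
  have h : R.fibre μ ≤ (R.fibre μ).comap (R.kappa i j) := iSup_le fun u v hv =>
    (le_iSup (fun w : Equiv.Perm (Fin n) => R.weightSpace (μ ∘ w)) u)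
      (R.kappa_mem_weightSpace hij hv)
  exact h hv

theorem GLRep.isFlatOn_kappa [FiniteDimensional ℂ V] {F : Submodule ℂ V}
    (hF : ∀ i j, i ≠ j → ∀ v ∈ F, R.kappa i j v ∈ F) : IsFlatOn R.kappa F :=
  R.isGlAction.isInfinitesimalBraid_casimir.isFlatOn (r := 1)
    (fun i j _ => (one_smul ℂ (R.kappa i j)).symm) inferInstance hF

variable {k : ℕ} {B : Type*} [Fintype B] [DecidableEq B]
  {X X' : Module.Basis B ℂ (LieAlgebra.SpecialLinear.sl (Fin k) ℂ)}

theorem isInfinitesimalBraid_casimir_sub_polyTwist :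
    IsInfinitesimalBraid fun i j => casimir (colOp (k := k) (n := n)) i j - polyTwist i j := by
  refine isGlAction_colOp.isInfinitesimalBraid_sub (fun i j _ => ?_) fun i j x hx => ?_
  · rw [polyTwist, polyTwist, isGlAction_colOp.diag_comm i j, add_comm (colOp i i)]
  · exact ((hx i).add_left (hx j)).add_left (((hx i).mul_left (hx j)).smul_left _)

theorem omega_eq_half_smul (hk : 1 ≤ k)
    (hX : ∀ a b : B, Matrix.trace ((X a : Matrix (Fin k) (Fin k) ℂ) *
      (X' b : Matrix (Fin k) (Fin k) ℂ)) = if a = b then 1 else 0) {i j : Fin n} (hij : i ≠ j) :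
    omega X X' i j = (1 / 2 : ℂ) • (casimir colOp i j - polyTwist i j) := by
  rw [← two_smul_omega hk X X' hX hij, smul_smul]
  norm_num

theorem omega_mem_kzFibre (hk : 1 ≤ k)
    (hX : ∀ a b : B, Matrix.trace ((X a : Matrix (Fin k) (Fin k) ℂ) *
      (X' b : Matrix (Fin k) (Fin k) ℂ)) = if a = b then 1 else 0) {i j : Fin n} (hij : i ≠ j)
    {lam : ℕ → ℕ} {μ : Fin n → ℕ} {f : Poly k n} (hf : f ∈ kzFibre k lam μ) :
    omega X X' i j f ∈ kzFibre k lam μ := by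
  have h : kzFibre k lam μ ≤ (kzFibre k lam μ).comap (omega X X' i j) := by
    refine iSup_le fun u f hf => ?_
    refine (le_iSup (fun w : Equiv.Perm (Fin n) => singular k n lam ⊓ colHomogeneous k (μ ∘ w)) u)
      ⟨?_, ?_⟩
    · change omega X X' i j f ∈ singular k n lam
      rw [omega_eq_half_smul hk hX hij]
      exact Submodule.smul_mem _ _ (Submodule.sub_mem _
        (Submodule.add_mem _ (colOp_mem_singular (colOp_mem_singular hf.1 _ _) _ _)
          (colOp_mem_singular (colOp_mem_singular hf.1 _ _) _ _))
        (Submodule.add_mem _ (Submodule.add_mem _ (colOp_mem_singular hf.1 _ _)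
          (colOp_mem_singular hf.1 _ _)) (Submodule.smul_mem _ _
            (colOp_mem_singular (colOp_mem_singular hf.1 _ _) _ _))))
    · change omega X X' i j f ∈ colHomogeneous k _
      have h1 := mem_colHomogeneous_iff.1 hf.2
      refine mem_colHomogeneous_iff.2 fun a => ?_
      have hdc : ∀ b, Commute (colOp (k := k) a a) (colOp b b) := fun b =>
        isGlAction_colOp.diag_comm a b
      have hcomm : Commute (colOp a a) (omega X X' i j) := by
        rw [omega_eq_half_smul hk hX hij]
        exact ((isGlAction_colOp.diag_casimir_comm a hij).sub_right
          (((hdc i).add_right (hdc j)).add_right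
            (((hdc i).mul_right (hdc j)).smul_right _))).smul_right _
      have h2 := LinearMap.congr_fun hcomm.eq f
      rw [Module.End.mul_apply, Module.End.mul_apply, h1, map_smul] at h2
      exact h2
  exact h hf

theorem isFlatOn_omega (hk : 1 ≤ k)
    (hX : ∀ a b : B, Matrix.trace ((X a : Matrix (Fin k) (Fin k) ℂ) *
      (X' b : Matrix (Fin k) (Fin k) ℂ)) = if a = b then 1 else 0) {lam : ℕ → ℕ} {μ : Fin n → ℕ}
    (hfin : FiniteDimensional ℂ (kzFibre k lam μ)) : IsFlatOn (omega X X') (kzFibre k lam μ) :=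
  isInfinitesimalBraid_casimir_sub_polyTwist.isFlatOn
    (fun _ _ hij => omega_eq_half_smul hk hX hij) hfin
    fun _ _ hij _ hf => omega_mem_kzFibre hk hX hij hf

end Flat

/-! ### Existence of the monodromy representations -/

section Monodromies

variable {k n : ℕ} {z : Conf n}

/-- The action of `𝔖_n` on polynomials by permutations of the columns. -/
def permColsRep (k n : ℕ) : Equiv.Perm (Fin n) →* Module.End ℂ (Poly k n) where
  toFun w := (permCols k w).toLinearMap
  map_one' := by
    refine LinearMap.ext fun f => ?_
    have h : (fun q : Fin k × Fin n => (q.1, (1 : Equiv.Perm (Fin n)) q.2)) = id := rfl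
    change MvPolynomial.rename (fun q : Fin k × Fin n => (q.1, (1 : Equiv.Perm (Fin n)) q.2)) f = f
    rw [h, MvPolynomial.rename_id_apply]
  map_mul' w w' := by
    refine LinearMap.ext fun f => ?_
    change permCols k (w * w') f = permCols k w (permCols k w' f)
    rw [permCols, permCols, permCols, MvPolynomial.rename_rename]
    rfl

theorem exists_forall_isKZMonodromy_iff (hk : 1 ≤ k) {B : Type*} [Fintype B] [DecidableEq B]
    {X X' : Module.Basis B ℂ (LieAlgebra.SpecialLinear.sl (Fin k) ℂ)}
    (hX : ∀ a b : B, Matrix.trace ((X a : Matrix (Fin k) (Fin k) ℂ) *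
      (X' b : Matrix (Fin k) (Fin k) ℂ)) = if a = b then 1 else 0) {lam : ℕ → ℕ} {μ : Fin n → ℕ}
    (hfin : FiniteDimensional ℂ (kzFibre k lam μ)) (c : ℂ) :
    ∃ π₀ : BraidGroup z →* (kzFibre k lam μ ≃ₗ[ℂ] kzFibre k lam μ),
      ∀ π, IsKZMonodromy X X' c lam μ π ↔ π = π₀ :=
  exists_forall_isMonodromy_iff (isFlatOn_omega hk hX hfin) c
    ((permColsRep k n).comp (MonoidHom.snd (BraidGroup z) _))
    (fun p _ hf => permCols_mem_kzFibre p.2 hf)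
    fun w _ i j _ f _ => permCols_omega X X' w i j f

variable {V : Type*} [AddCommGroup V] [Module ℂ V] [FiniteDimensional ℂ V]

theorem exists_forall_isCasimirMonodromy_iff (R : GLRep n V) (h : ℂ) (μ : Fin n → ℕ)
    {t : Fin n → ℝ} {ht : StrictAnti t}
    {σ : BraidGroup (basePt t ht) →* Matrix.SpecialLinearGroup (Fin n) ℂ} (hσ : IsTitsHom t ht σ) :
    ∃ π₀ : BraidGroup (basePt t ht) →* (R.fibre μ ≃ₗ[ℂ] R.fibre μ),
      ∀ π, IsCasimirMonodromy R h μ σ π ↔ π = π₀ :=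
  exists_forall_isMonodromy_iff
    (R.isFlatOn_kappa fun _ _ hij _ hv => R.kappa_mem_fibre hij hv) h
    ((R.act.comp (Matrix.SpecialLinearGroup.toGL.comp σ)).comp (MonoidHom.fst _ _))
    (fun p v hv => by
      obtain ⟨w, γ, hb⟩ := exists_braidOf p.1
      have h1 := hσ.1 w γ
      rw [← hb] at h1
      exact R.act_monomial_fibre (g := (σ p.1 : GL (Fin n) ℂ)) h1 hv)
    fun w γ i j _ v _ =>
      R.act_monomial_kappa (g := (σ (braidOf w γ) : GL (Fin n) ℂ)) (hσ.1 w γ) i j v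

end Monodromies

/-! ### Comparison of the monodromies of a half-twist -/

section Comparison

variable {k n : ℕ} {V : Type*} [AddCommGroup V] [Module ℂ V]
  {R : GLRep n V} {lam : ℕ → ℕ} {μ : Fin n → ℕ}

/-- The value of `E_{ii} + E_{jj} + 2 E_{ii} E_{jj} / k` on vectors of weight `ν`. -/
def twistWeight (k : ℕ) (ν : Fin n → ℕ) (i j : Fin n) : ℂ := ν i + ν j + 2 / k * (ν i * ν j)

theorem twistWeight_symm (ν : Fin n → ℕ) (i j : Fin n) :
    twistWeight k ν i j = twistWeight k ν j i := by
  rw [twistWeight, twistWeight]; ring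

/-- The exponent of the gauge transformation on vectors of weight `ν`. -/
def gaugeExponent (k : ℕ) (h : ℂ) (ν : Fin n → ℕ) (t : Fin n → ℝ) : ℂ :=
  ∑ a, ∑ b ∈ Finset.Ioi a, (h * (Real.log (t a - t b) : ℂ)) * twistWeight k ν a b

theorem GLRep.cartan_apply {ν : Fin n → ℕ} {v : R.fibre μ} (hv : (v : V) ∈ R.weightSpace ν)
    (i : Fin n) : R.cartan μ i v = (ν i : ℂ) • v :=
  Subtype.ext (GLRep.mem_weightSpace_iff.1 hv i)

theorem GLRep.twist_apply {ν : Fin n → ℕ} {v : R.fibre μ} (hv : (v : V) ∈ R.weightSpace ν)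
    (i j : Fin n) : R.twist k μ i j v = twistWeight k ν i j • v := by
  simp only [GLRep.twist, LinearMap.add_apply, LinearMap.smul_apply, Module.End.mul_apply,
    GLRep.cartan_apply hv, map_smul, twistWeight, add_smul, smul_smul]
  rw [mul_comm ((ν j : ℕ) : ℂ)]

theorem GLRep.gauge_apply [FiniteDimensional ℂ V] {ν : Fin n → ℕ} {v : R.fibre μ}
    (hv : (v : V) ∈ R.weightSpace ν) (h : ℂ) (t : Fin n → ℝ) :
    R.gauge k h μ t v = Complex.exp (gaugeExponent k h ν t) • v := by
  refine endExp_apply_of_eigen ?_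
  simp only [LinearMap.sum_apply, LinearMap.smul_apply, GLRep.twist_apply hv, smul_smul,
    gaugeExponent, Finset.sum_smul]

theorem polyTwist_apply {ν : Fin n → ℕ} {f : Poly k n} (hf : f ∈ colHomogeneous k ν) (i j : Fin n) :
    polyTwist i j f = twistWeight k ν i j • f := by
  have h := mem_colHomogeneous_iff.1 hf
  simp only [polyTwist, LinearMap.add_apply, LinearMap.smul_apply, Module.End.mul_apply, h,
    map_smul, twistWeight, add_smul, smul_smul]
  rw [mul_comm ((ν j : ℕ) : ℂ)]

theorem neg_one_pow_eq_exp (m : ℕ) : (-1 : ℂ) ^ m = Complex.exp (Complex.I * Real.pi * m) := by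
  rw [← Complex.exp_pi_mul_I, ← Complex.exp_nat_mul]
  congr 1
  ring

/-- The comparison of the two monodromies on the half-twist. On vectors of weight `ν`, the
isomorphism `ι` takes a parallel section of the Casimir connection, multiplied by
`∏ (z_a - z_b) ^ (-h D_{ab}(ν))`, to a parallel section of the KZ connection. The values of this
function at the end points give the gauge transformation and the phase; the sign comes from the
comparison of the lift of the transposition with the permutation of two columns. -/
theorem gauge_comp_monodromy [FiniteDimensional ℂ V] (hk : 1 ≤ k) {B : Type*} [Fintype B]
    [DecidableEq B] {X X' : Module.Basis B ℂ (LieAlgebra.SpecialLinear.sl (Fin k) ℂ)}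
    (hX : ∀ a b : B, Matrix.trace ((X a : Matrix (Fin k) (Fin k) ℂ) *
      (X' b : Matrix (Fin k) (Fin k) ℂ)) = if a = b then 1 else 0)
    {ι : V ≃ₗ[ℂ] singular k n lam} {ιμ : R.fibre μ ≃ₗ[ℂ] kzFibre k lam μ}
    (hι : ∀ i j v, (ι (R.diff (Matrix.single i j 1) v) : Poly k n) = colOp i j (ι v))
    (hιμ : ∀ v : R.fibre μ, (ιμ v : Poly k n) = ι v) {t : Fin n → ℝ} {ht : StrictAnti t}
    {σ : BraidGroup (basePt t ht) →* Matrix.SpecialLinearGroup (Fin n) ℂ} (hσ : IsTitsHom t ht σ)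
    {h : ℂ} {πKZ : BraidGroup (basePt t ht) →* (kzFibre k lam μ ≃ₗ[ℂ] kzFibre k lam μ)}
    (hKZ : IsKZMonodromy X X' (2 * h) lam μ πKZ)
    {πκ : BraidGroup (basePt t ht) →* (R.fibre μ ≃ₗ[ℂ] R.fibre μ)}
    (hκ : IsCasimirMonodromy R h μ σ πκ) (i j : Fin n) (hij : (i : ℕ) + 1 = j) :
    R.gauge k h μ t ∘ₗ ιμ.symm.toLinearMap ∘ₗ
        (πKZ (braidGen t ht i j hij)).toLinearMap ∘ₗ ιμ.toLinearMap =
      (πκ (braidGen t ht i j hij)).toLinearMap ∘ₗ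
        endExp (-(Real.pi * Complex.I * h) • R.twist k μ i j) ∘ₗ
        endExp ((Complex.I * Real.pi) • R.cartan μ i) ∘ₗ R.gauge k h μ t := by
  have hne : i ≠ j := fun h => by rw [h] at hij; omega
  have hfin : FiniteDimensional ℂ (kzFibre k lam μ) := ιμ.finiteDimensional
  set b := braidGen t ht i j hij with hb
  set T : V →ₗ[ℂ] Poly k n := (singular k n lam).subtype ∘ₗ ι.toLinearMap with hT
  have hTapply : ∀ v, T v = (ι v : Poly k n) := fun _ => rfl
  -- the case of a weight vector
  have key : ∀ (ν : Fin n → ℕ), R.weightSpace ν ≤ R.fibre μ → ∀ v : R.fibre μ,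
      (v : V) ∈ R.weightSpace ν → R.gauge k h μ t (ιμ.symm (πKZ b (ιμ v))) =
        πκ b (endExp (-(Real.pi * Complex.I * h) • R.twist k μ i j)
          (endExp ((Complex.I * Real.pi) • R.cartan μ i) (R.gauge k h μ t v))) := by
    intro ν hν v hv
    have hflat : IsFlatOn R.kappa (R.weightSpace ν) :=
      R.isFlatOn_kappa fun _ _ hij _ hv => R.kappa_mem_weightSpace hij hv
    obtain ⟨s, hs, hs0⟩ := hflat.exists_isParallelFun h (halfTwist t ht i j hij).continuous hv
    -- parallel transport for the Casimir connection
    have hκv : (πκ b v : V) = R.act (σ b : GL (Fin n) ℂ) (s 1) := by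
      obtain ⟨s', hs', hs'0, hs'1⟩ := hκ (Equiv.swap i j) (halfTwist t ht i j hij) v
      have h1 := (hs.mono hν).eq_of_eq
        (R.isFlatOn_kappa fun _ _ hij _ hv => R.kappa_mem_fibre hij hv)
        (halfTwist t ht i j hij).continuous hs' (hs0.trans hs'0.symm) 1
      rw [h1]
      exact hs'1
    have hκw : (πκ b v : V) ∈ R.weightSpace (ν ∘ ⇑(Equiv.swap i j)) := by
      rw [hκv]
      exact R.act_monomial_weightSpace (g := (σ b : GL (Fin n) ℂ))
        (hσ.1 (Equiv.swap i j) (halfTwist t ht i j hij)) (hs.mem 1)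
    -- parallel transport for the KZ connection
    set d : Fin n → Fin n → ℂ := fun a b => -h * twistWeight k ν a b with hd
    have hKZs : IsParallelFun (omega X X') (2 * h) (kzFibre k lam μ) (halfTwist t ht i j hij)
        (fun τ => Complex.exp (∑ a, ∑ b ∈ Finset.Ioi a, d a b * twistLog t i j a b τ) •
          T (s τ)) := by
      refine hs.twist (isLogAlong_twistLog ht hij) d T (fun u hu => ?_) fun a c hac u hu => ?_
      · rw [hTapply, ← hιμ ⟨u, hν hu⟩]
        exact (ιμ _).2
      · have h1 := two_smul_omega hk X X' hX hac.ne
        have h2 : T (R.kappa a c u) = casimir colOp a c (T u) := by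
          simp only [hTapply, GLRep.kappa, casimir, LinearMap.add_apply, Module.End.mul_apply,
            map_add, Submodule.coe_add, hι]
        have h3 : polyTwist a c (T u) = twistWeight k ν a c • T u :=
          polyTwist_apply ((equiv_mem_colHomogeneous_iff hι).2 hu) a c
        have h4 := LinearMap.congr_fun h1 (T u)
        rw [LinearMap.smul_apply, LinearMap.sub_apply, h3, ← h2] at h4
        rw [mul_comm, mul_smul, h4, smul_sub, smul_smul]
        simp only [hd, neg_mul, neg_smul, sub_eq_add_neg]
    have hKZv : (πKZ b (ιμ v) : Poly k n) =
        Complex.exp (∑ a, ∑ b ∈ Finset.Ioi a, d a b * twistLog t i j a b 1 -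
          ∑ a, ∑ b ∈ Finset.Ioi a, d a b * twistLog t i j a b 0) •
          permCols k (Equiv.swap i j) (T (s 1)) := by
      obtain ⟨s', hs', hs'0, hs'1⟩ := hKZ (Equiv.swap i j) (halfTwist t ht i j hij) (ιμ v)
      have h1 := hKZs.smul
        (Complex.exp (-∑ a, ∑ b ∈ Finset.Ioi a, d a b * twistLog t i j a b 0))
      have h2 := IsParallelFun.eq_of_eq (isFlatOn_omega hk hX hfin)
        (halfTwist t ht i j hij).continuous hs' h1 (by
          rw [hs'0, hs0, smul_smul, ← Complex.exp_add, neg_add_cancel, Complex.exp_zero, one_smul,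
            hTapply, hιμ]) 1
      rw [← map_smul, sub_eq_neg_add, Complex.exp_add, mul_smul, ← h2]
      exact hs'1
    have hswap : permCols k (Equiv.swap i j) (T (s 1)) =
        (-1 : ℂ) ^ ν i • (ιμ (πκ b v) : Poly k n) := by
      rw [hTapply, permCols_swap_equiv hι hne (g := (σ b : GL (Fin n) ℂ)) (hσ.2 i j hij) (hs.mem 1),
        hιμ, hκv, map_smul, map_smul, Submodule.coe_smul]
    have hd0 : ∑ a, ∑ b ∈ Finset.Ioi a, d a b * twistLog t i j a b 0 = -gaugeExponent k h ν t := by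
      rw [sum_twistLog_zero ht hij, gaugeExponent, ← Finset.sum_neg_distrib]
      refine Finset.sum_congr rfl fun a _ => ?_
      rw [← Finset.sum_neg_distrib]
      refine Finset.sum_congr rfl fun b _ => ?_
      rw [hd]; ring
    have hd1 : ∑ a, ∑ b ∈ Finset.Ioi a, d a b * twistLog t i j a b 1 =
        -gaugeExponent k h (ν ∘ ⇑(Equiv.swap i j)) t +
          -h * twistWeight k ν i j * (Complex.I * Real.pi) := by
      rw [sum_twistLog_one ht hij (fun a b => by rw [hd]; dsimp only; rw [twistWeight_symm]),
        gaugeExponent, ← Finset.sum_neg_distrib]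
      congr 1
      refine Finset.sum_congr rfl fun a _ => ?_
      rw [← Finset.sum_neg_distrib]
      refine Finset.sum_congr rfl fun b _ => ?_
      simp only [hd, twistWeight, Function.comp_apply]; ring
    have hιv : ιμ.symm (πKZ b (ιμ v)) = (Complex.exp (gaugeExponent k h ν t -
        gaugeExponent k h (ν ∘ ⇑(Equiv.swap i j)) t -
          h * twistWeight k ν i j * (Complex.I * Real.pi)) * (-1 : ℂ) ^ ν i) • πκ b v := by
      rw [LinearEquiv.symm_apply_eq, map_smul]
      refine Subtype.ext ?_
      rw [hKZv, hswap, hd0, hd1, Submodule.coe_smul, smul_smul]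
      congr 3
      ring
    rw [hιv, map_smul, GLRep.gauge_apply hκw, GLRep.gauge_apply hv, map_smul, map_smul, map_smul,
      endExp_apply_of_eigen (c := Complex.I * Real.pi * ν i) (v := v), map_smul, map_smul,
      endExp_apply_of_eigen (c := -(Real.pi * Complex.I * h) * twistWeight k ν i j) (v := v),
      map_smul, smul_smul, smul_smul, smul_smul, neg_one_pow_eq_exp, ← Complex.exp_add,
      ← Complex.exp_add, ← Complex.exp_add, ← Complex.exp_add]
    · congr 2
      ring
    · rw [LinearMap.smul_apply, GLRep.twist_apply hv, smul_smul]
    · rw [LinearMap.smul_apply, GLRep.cartan_apply hv, smul_smul]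
  -- the weight vectors span the fibre
  have hle : R.fibre μ ≤ (LinearMap.eqLocus (R.gauge k h μ t ∘ₗ ιμ.symm.toLinearMap ∘ₗ
        (πKZ b).toLinearMap ∘ₗ ιμ.toLinearMap)
      ((πκ b).toLinearMap ∘ₗ endExp (-(Real.pi * Complex.I * h) • R.twist k μ i j) ∘ₗ
        endExp ((Complex.I * Real.pi) • R.cartan μ i) ∘ₗ R.gauge k h μ t)).map
      (R.fibre μ).subtype := by
    refine iSup_le fun w v hv => ?_
    have hw : R.weightSpace (μ ∘ w) ≤ R.fibre μ :=
      le_iSup (fun w : Equiv.Perm (Fin n) => R.weightSpace (μ ∘ w)) w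
    exact ⟨⟨v, hw hv⟩, key (μ ∘ w) hw ⟨v, hw hv⟩ hv, rfl⟩
  refine LinearMap.ext fun v => ?_
  obtain ⟨v', hv', h1⟩ := hle v.2
  obtain rfl : v' = v := Subtype.ext h1
  exact hv'

end Comparison

end DualPair

end

theorem mainTheorem4 (k n : ℕ) (hk : 1 ≤ k)
    (lam : ℕ → ℕ) (hlam : Antitone lam) (hrows : ∀ i, min k n ≤ i → lam i = 0)
    {B : Type*} [Fintype B] [DecidableEq B]
    (X X' : Module.Basis B ℂ (LieAlgebra.SpecialLinear.sl (Fin k) ℂ))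
    (hX : ∀ a b : B, Matrix.trace ((X a : Matrix (Fin k) (Fin k) ℂ) *
      (X' b : Matrix (Fin k) (Fin k) ℂ)) = if a = b then 1 else 0)
    {V : Type*} [AddCommGroup V] [Module ℂ V] [FiniteDimensional ℂ V]
    (R : DualPair.GLRep n V) (hR : R.IsIrreducibleOfHighestWeight lam)
    (μ : Fin n → ℕ) (hμ : R.weightSpace μ ≠ ⊥) :
    ∃ (ι : V ≃ₗ[ℂ] DualPair.singular k n lam) (ιμ : R.fibre μ ≃ₗ[ℂ] DualPair.kzFibre k lam μ),
      (∀ (Y : Matrix (Fin n) (Fin n) ℂ) (v : V),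
        (ι (R.diff Y v) : DualPair.Poly k n) = DualPair.glnAct Y (ι v)) ∧
      (∀ v : R.fibre μ, (ιμ v : DualPair.Poly k n) = ι v) ∧
      ∀ (t : Fin n → ℝ) (ht : StrictAnti t),
        (∃ σ, DualPair.IsTitsHom t ht σ) ∧
        ∀ σ, DualPair.IsTitsHom t ht σ → ∀ h : ℂ,
          ∃ (πKZ : DualPair.BraidGroup (DualPair.basePt t ht) →*
                (DualPair.kzFibre k lam μ ≃ₗ[ℂ] DualPair.kzFibre k lam μ))
            (πκ : DualPair.BraidGroup (DualPair.basePt t ht) →*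
                (R.fibre μ ≃ₗ[ℂ] R.fibre μ)),
            (∀ π, DualPair.IsKZMonodromy X X' (2 * h) lam μ π ↔ π = πKZ) ∧
            (∀ π, DualPair.IsCasimirMonodromy R h μ σ π ↔ π = πκ) ∧
            ∀ (i j : Fin n) (hij : (i : ℕ) + 1 = j),
              R.gauge k h μ t ∘ₗ ιμ.symm.toLinearMap ∘ₗ
                  (πKZ (DualPair.braidGen t ht i j hij)).toLinearMap ∘ₗ ιμ.toLinearMap =
                (πκ (DualPair.braidGen t ht i j hij)).toLinearMap ∘ₗ
                  DualPair.endExp (-(Real.pi * Complex.I * h) • R.twist k μ i j) ∘ₗ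
                  DualPair.endExp ((Complex.I * Real.pi) • R.cartan μ i) ∘ₗ
                  R.gauge k h μ t := by
  obtain ⟨ι, hι⟩ := DualPair.exists_equiv_singular hlam hrows hR
  obtain ⟨ιμ, hιμ⟩ := DualPair.exists_fibre_equiv hι μ
  have hfin : FiniteDimensional ℂ (DualPair.kzFibre k lam μ) := ιμ.finiteDimensional
  refine ⟨ι, ιμ, DualPair.equivariant_diff hι, hιμ, fun t ht =>
    ⟨DualPair.exists_isTitsHom t ht, fun σ hσ h => ?_⟩⟩
  obtain ⟨πKZ, hKZ⟩ :=
    DualPair.exists_forall_isKZMonodromy_iff (z := DualPair.basePt t ht) hk hX hfin (2 * h)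
  obtain ⟨πκ, hκ⟩ := DualPair.exists_forall_isCasimirMonodromy_iff R h μ hσ
  exact ⟨πKZ, πκ, hKZ, hκ, fun i j hij => DualPair.gauge_comp_monodromy hk hX hι hιμ hσ
    ((hKZ πKZ).2 rfl) ((hκ πκ).2 rfl) i j hij⟩
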